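/- Let $X$ be a scheme. Let $V, V'$ be vector bundles of rank $3$ and $I, I'$ line bundles on $X$, let $q: V\to I$ and $q': V'\to I'$ be quadratic forms, and let $C_0(V,q,I)$ be the even Clifford algebra bundle, that is, the degree zero part of the generalised Clifford algebra $\widetilde C(V,q,I)=(TV\otimes L[I])/\langle x\otimes x\otimes 1-1\otimes q(x)\rangle$, where $L[I]=\bigoplus_{n\in\mathbb Z} I^{n}$ and $V$, $I$ have degrees $1$, $2$. For a bilinear form $b: V|_U\times V|_U\to I|_U$ over an affine open $U\subseteq X$ with $b(x,x)=q(x)$, let $\psi_b:\widetilde C(V,q,I)|_U\to\widetilde C(V,0,I)|_U=(\Lambda(V)\otimes L[I])|_U$ be the $\mathcal O_U$-linear map that is the identity on $L[I]$ and satisfies $\psi_b(xy)=x\,\psi_b(y)+d_{b(x,-)}\psi_b(y)$ for $x\in V$; here, for $f: V|_U\to I|_U$ linear, $d_f$ is the endomorphism vanishing on $L[I]$ with $d_f(xy)=f(x)y-x\,d_f(y)$ for $x\in V$. Over every affine open $U$ such $b$ exist, and $\psi_b$ restricts to an isomorphism $C_0(V,q,I)|_U\cong(\mathcal O_X\oplus\Lambda^2V\otimes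 I^{-1})|_U$. Every isomorphism of algebra bundles $\varphi: C_0(V,q,I)\cong C_0(V',q',I')$ determines an isomorphism of vector bundles $$\varphi_{\Lambda^2}:\Lambda^2V\otimes I^{-1}\cong\Lambda^2V'\otimes I'^{-1}$$ such that for every affine open $U$ and all bilinear forms $b$, $b'$ inducing $q|_U$, $q'|_U$, the isomorphism $\psi_{b'}\circ\varphi\circ\psi_b^{-1}$ of $(\mathcal O_X\oplus\Lambda^2V\otimes I^{-1})|_U$ with $(\mathcal O_X\oplus\Lambda^2V'\otimes I'^{-1})|_U$ followed by the projection to $\Lambda^2V'\otimes I'^{-1}$ is the projection to $\Lambda^2V\otimes I^{-1}$ followed by $\varphi_{\Lambda^2}$. The isomorphism $\varphi_{\Lambda^2}$ is already determined by this condition for the members of one affine open covering and one choice of $b$, $b'$ on each of them. Moreover $\mathrm{id}_{\Lambda^2}=\mathrm{id}$ and $(\chi\circ\varphi)_{\Lambda^2}=\chi_{\Lambda^2}\circ\varphi_{\Lambda^2}$. If $V=V'$ and $I=I'$, then $\det(\varphi_{\Lambda^2})\in\mathrm{Aut}(\Lambda^3(\Lambda^2V\otimes I^{-1}))=\Gamma(X,\mathcal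 O_X^*)$ is a well-defined unit. Let $\mathrm{Iso}'[C_0(V,q,I),C_0(V,q',I)]$ be the set of those $\varphi$ for which $\det(\varphi_{\Lambda^2})$ is a square in $\Gamma(X,\mathcal O_X^*)$, and $\text{S-Iso}[C_0(V,q,I),C_0(V,q',I)]$ the set of those with $\det(\varphi_{\Lambda^2})=1$. Then $\text{S-Iso}\subseteq\mathrm{Iso}'$, and for $q=q'$ these sets are subgroups $\text{S-Aut}(C_0(V,q,I))\subseteq\mathrm{Aut}'(C_0(V,q,I))$ of the group $\mathrm{Aut}(C_0(V,q,I))$ of algebra bundle automorphisms. -/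

import Mathlib

universe u

namespace QuadBundle

open scoped TensorProduct

section Algebra

variable {R : Type u} [CommRing R]
variable {V I D : Type u} [AddCommGroup V] [Module R V] [AddCommGroup I] [Module R I]
  [AddCommGroup D] [Module R D]

/-- Relations of the Laurent-Rees algebra of `I`, where `D` plays the role of `I⁻¹` through the
pairing `ev : D × I → R`: the generators commute, and `i · d = ev d i`. -/
inductive LaurentRees.Rel (ev : D →ₗ[R] I →ₗ[R] R) :
    TensorAlgebra R (I × D) → TensorAlgebra R (I × D) → Prop
  | comm (a b : I × D) : LaurentRees.Rel ev
      (TensorAlgebra.ι R a * TensorAlgebra.ι R b) (TensorAlgebra.ι R b * TensorAlgebra.ι R a)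
  | pair (i : I) (d : D) : LaurentRees.Rel ev
      (TensorAlgebra.ι R ((i, 0) : I × D) * TensorAlgebra.ι R ((0, d) : I × D))
      (algebraMap R _ (ev d i))

/-- The Laurent-Rees algebra `L[I] = R ⊕ ⨁_{n > 0} (Tⁿ(I) ⊕ Tⁿ(I⁻¹))` of an invertible module `I`
with inverse `D = I⁻¹`, presented by generators `I`, `I⁻¹` and the relation given by the
identification `I ⊗ I⁻¹ = R`. (For invertible `I` the algebras `T(I)` and `T(I⁻¹)`
are commutative.) -/
def LaurentRees (ev : D →ₗ[R] I →ₗ[R] R) : Type u := RingQuot (LaurentRees.Rel ev)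

namespace LaurentRees

variable (ev : D →ₗ[R] I →ₗ[R] R)

noncomputable instance : Ring (LaurentRees ev) :=
  inferInstanceAs (Ring (RingQuot (LaurentRees.Rel ev)))
noncomputable instance : Algebra R (LaurentRees ev) :=
  inferInstanceAs (Algebra R (RingQuot (LaurentRees.Rel ev)))

/-- The inclusion of `I ⊕ I⁻¹` in `L[I]`. -/
noncomputable def gen : I × D →ₗ[R] LaurentRees ev :=
  (RingQuot.mkAlgHom R (Rel ev)).toLinearMap ∘ₗ TensorAlgebra.ι R

/-- The inclusion of `I` in `L[I]`. -/
noncomputable def ιI : I →ₗ[R] LaurentRees ev := gen ev ∘ₗ LinearMap.inl R I D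

/-- The inclusion of `I⁻¹` in `L[I]`. -/
noncomputable def ιD : D →ₗ[R] LaurentRees ev := gen ev ∘ₗ LinearMap.inr R I D

variable {ev}

theorem gen_comm (a b : I × D) : gen ev a * gen ev b = gen ev b * gen ev a := by
  have := RingQuot.mkAlgHom_rel R (Rel.comm (ev := ev) a b)
  rw [map_mul, map_mul] at this
  exact this

theorem pair_eq (i : I) (d : D) : ιI ev i * ιD ev d = algebraMap R _ (ev d i) := by
  have := RingQuot.mkAlgHom_rel R (Rel.pair (ev := ev) i d)
  rw [map_mul, AlgHom.commutes] at this
  exact this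

variable {A : Type u} [Ring A] [Algebra R A]

/-- The universal property of `L[I]`. -/
noncomputable def lift (g : I × D →ₗ[R] A) (hc : ∀ a b, g a * g b = g b * g a)
    (hp : ∀ i d, g (i, 0) * g (0, d) = algebraMap R A (ev d i)) : LaurentRees ev →ₐ[R] A :=
  RingQuot.liftAlgHom R ⟨TensorAlgebra.lift R g, by
    intro x y h
    cases h with
    | comm a b => simpa using hc a b
    | pair i d => simpa using hp i d⟩

theorem lift_gen (g : I × D →ₗ[R] A) (hc) (hp) (a : I × D) :
    lift (ev := ev) g hc hp (gen ev a) = g a := by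
  simp only [lift, gen]
  erw [RingQuot.liftAlgHom_mkAlgHom_apply]
  simp

theorem hom_ext {f g : LaurentRees ev →ₐ[R] A} (h : ∀ a, f (gen ev a) = g (gen ev a)) : f = g := by
  apply RingQuot.ringQuot_ext'
  apply TensorAlgebra.hom_ext
  ext a
  · exact h _
  · exact h _

/-- A subalgebra containing the generators is everything. -/
theorem mem_of_gen (S : Subalgebra R (LaurentRees ev)) (h : ∀ a, gen ev a ∈ S)
    (x : LaurentRees ev) : x ∈ S := by
  let g : I × D →ₗ[R] S := (gen ev).codRestrict S.toSubmodule h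
  let F : LaurentRees ev →ₐ[R] S := lift g (fun a b => Subtype.ext (gen_comm a b))
    (fun i d => Subtype.ext (pair_eq i d))
  have : S.val.comp F = AlgHom.id R _ := hom_ext fun a => by
    simp only [AlgHom.comp_apply, F, lift_gen]; rfl
  have h2 := AlgHom.congr_fun this x
  rw [AlgHom.id_apply] at h2
  rw [← h2]
  exact (F x).2

end LaurentRees

/-- Generators of the ideal `J(q, I)`: `(x ⊗ x) ⊗ 1 - 1 ⊗ q(x)`. -/
inductive GenClifford.Rel (ev : D →ₗ[R] I →ₗ[R] R) (q : QuadraticMap R V I) :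
    TensorAlgebra R V ⊗[R] LaurentRees ev → TensorAlgebra R V ⊗[R] LaurentRees ev → Prop
  | sq (x : V) : GenClifford.Rel ev q
      ((TensorAlgebra.ι R x * TensorAlgebra.ι R x) ⊗ₜ 1) (1 ⊗ₜ LaurentRees.ιI ev (q x))

/-- The generalised Clifford algebra `C̃(V, q, I) = (TV ⊗ L[I]) / J(q, I)`. -/
def GenClifford (ev : D →ₗ[R] I →ₗ[R] R) (q : QuadraticMap R V I) : Type u :=
  RingQuot (GenClifford.Rel ev q)

namespace GenClifford

variable (ev : D →ₗ[R] I →ₗ[R] R) (q : QuadraticMap R V I)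

noncomputable instance : Ring (GenClifford ev q) :=
  inferInstanceAs (Ring (RingQuot (GenClifford.Rel ev q)))
noncomputable instance : Algebra R (GenClifford ev q) :=
  inferInstanceAs (Algebra R (RingQuot (GenClifford.Rel ev q)))

/-- The quotient map `TV ⊗ L[I] → C̃(V, q, I)`. -/
noncomputable def mk : TensorAlgebra R V ⊗[R] LaurentRees ev →ₐ[R] GenClifford ev q :=
  RingQuot.mkAlgHom R (Rel ev q)

/-- The canonical map `V → C̃(V, q, I)`. -/
noncomputable def ιV : V →ₗ[R] GenClifford ev q :=
  ((mk ev q).comp Algebra.TensorProduct.includeLeft).toLinearMap ∘ₗ TensorAlgebra.ι R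

/-- The canonical map `L[I] → C̃(V, q, I)`. -/
noncomputable def ofL : LaurentRees ev →ₐ[R] GenClifford ev q :=
  (mk ev q).comp Algebra.TensorProduct.includeRight

/-- The canonical map `I → C̃(V, q, I)`. -/
noncomputable def ιI : I →ₗ[R] GenClifford ev q := (ofL ev q).toLinearMap ∘ₗ LaurentRees.ιI ev

/-- The canonical map `I⁻¹ → C̃(V, q, I)`. -/
noncomputable def ιD : D →ₗ[R] GenClifford ev q := (ofL ev q).toLinearMap ∘ₗ LaurentRees.ιD ev

variable {ev q}

theorem ιV_sq (x : V) : ιV ev q x * ιV ev q x = ιI ev q (q x) := by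
  have := RingQuot.mkAlgHom_rel R (Rel.sq (ev := ev) (q := q) x)
  change mk ev q _ = mk ev q _ at this
  simp only [ιV, ιI, ofL, LinearMap.comp_apply, AlgHom.toLinearMap_apply, AlgHom.comp_apply,
    Algebra.TensorProduct.includeLeft_apply, Algebra.TensorProduct.includeRight_apply,
    ← map_mul, Algebra.TensorProduct.tmul_mul_tmul, mul_one]
  exact this

theorem ιV_ofL (x : V) (l : LaurentRees ev) : Commute (ιV ev q x) (ofL ev q l) := by
  simp only [Commute, SemiconjBy, ιV, ofL, LinearMap.comp_apply, AlgHom.toLinearMap_apply,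
    AlgHom.comp_apply, Algebra.TensorProduct.includeLeft_apply,
    Algebra.TensorProduct.includeRight_apply,
    ← map_mul, Algebra.TensorProduct.tmul_mul_tmul, mul_one, one_mul]

theorem ofL_comm (l m : LaurentRees ev) : Commute (ofL ev q l) (ofL ev q m) := by
  suffices h : Commute l m from h.map (ofL ev q)
  have key : ∀ a, ∀ y, Commute (LaurentRees.gen ev a) y := fun a y => by
    have := LaurentRees.mem_of_gen (Subalgebra.centralizer R {LaurentRees.gen ev a})
      (fun b => by
        rw [Subalgebra.mem_centralizer_iff]
        rintro g rfl
        exact LaurentRees.gen_comm a b) y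
    rw [Subalgebra.mem_centralizer_iff] at this
    exact this _ rfl
  have := LaurentRees.mem_of_gen (Subalgebra.centralizer R {m})
      (fun b => by
        rw [Subalgebra.mem_centralizer_iff]
        rintro g rfl
        exact (key b _).symm) l
  rw [Subalgebra.mem_centralizer_iff] at this
  exact (this _ rfl).symm

theorem pair_eq (i : I) (d : D) : ιI ev q i * ιD ev q d = algebraMap R _ (ev d i) := by
  simp only [ιI, ιD, LinearMap.comp_apply, AlgHom.toLinearMap_apply, ← map_mul,
    LaurentRees.pair_eq, AlgHom.commutes]

section lift

variable {A : Type u} [Ring A] [Algebra R A]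

/-- Linear maps on `V`, `I`, `I⁻¹` satisfying the relations of `C̃(V, q, I)`. -/
structure Compat (ev : D →ₗ[R] I →ₗ[R] R) (q : QuadraticMap R V I)
    (v : V →ₗ[R] A) (i : I →ₗ[R] A) (d : D →ₗ[R] A) : Prop where
  sq : ∀ x, v x * v x = i (q x)
  vi : ∀ x a, Commute (v x) (i a)
  vd : ∀ x a, Commute (v x) (d a)
  ii : ∀ a b, Commute (i a) (i b)
  idd : ∀ a b, Commute (i a) (d b)
  dd : ∀ a b, Commute (d a) (d b)
  pair : ∀ a b, i a * d b = algebraMap R A (ev b a)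

theorem Compat.gen_comm {v : V →ₗ[R] A} {i : I →ₗ[R] A} {d : D →ₗ[R] A} (h : Compat ev q v i d)
    (a b : I × D) : (i.coprod d) a * (i.coprod d) b = (i.coprod d) b * (i.coprod d) a := by
  simp only [LinearMap.coprod_apply]
  exact ((h.ii _ _).add_right (h.idd _ _)).add_left (((h.idd _ _).symm).add_right (h.dd _ _))

/-- The map `L[I] → A` of the universal property. -/
noncomputable def liftL {v : V →ₗ[R] A} {i : I →ₗ[R] A} {d : D →ₗ[R] A}
    (h : Compat ev q v i d) : LaurentRees ev →ₐ[R] A :=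
  LaurentRees.lift (i.coprod d) h.gen_comm (fun a b => by simpa using h.pair a b)

/-- The universal property of `C̃(V, q, I)`. -/
noncomputable def lift {v : V →ₗ[R] A} {i : I →ₗ[R] A} {d : D →ₗ[R] A}
    (h : Compat ev q v i d) : GenClifford ev q →ₐ[R] A :=
  RingQuot.liftAlgHom R ⟨Algebra.TensorProduct.lift (TensorAlgebra.lift R v) (liftL h) (by
      intro x y
      have h1 : ∀ x : V, ∀ y, Commute (v x) (liftL h y) := fun x y => by
        have := LaurentRees.mem_of_gen
          ((Subalgebra.centralizer R {v x}).comap (liftL h))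
          (fun b => by
            rw [Subalgebra.mem_comap, Subalgebra.mem_centralizer_iff]
            rintro g rfl
            rw [liftL, LaurentRees.lift_gen, LinearMap.coprod_apply]
            exact (h.vi _ _).add_right (h.vd _ _)) y
        rw [Subalgebra.mem_comap, Subalgebra.mem_centralizer_iff] at this
        exact this _ rfl
      induction x using TensorAlgebra.induction with
      | algebraMap r => rw [AlgHom.commutes]; exact Algebra.commutes r _
      | ι x => rw [TensorAlgebra.lift_ι_apply]; exact h1 x y
      | mul a b ha hb => rw [map_mul]; exact ha.mul_left hb
      | add a b ha hb => rw [map_add]; exact ha.add_left hb), by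
    intro x y hxy
    cases hxy with
    | sq x =>
      simp only [Algebra.TensorProduct.lift_tmul, map_mul, TensorAlgebra.lift_ι_apply, map_one,
        mul_one, one_mul, h.sq, liftL, LaurentRees.ιI, LinearMap.comp_apply,
        LaurentRees.lift_gen]
      simp⟩

theorem lift_mk {v : V →ₗ[R] A} {i : I →ₗ[R] A} {d : D →ₗ[R] A} (h : Compat ev q v i d) (x) (l) :
    lift h (mk ev q (x ⊗ₜ l)) = TensorAlgebra.lift R v x * liftL h l := by
  simp only [lift, mk]
  erw [RingQuot.liftAlgHom_mkAlgHom_apply]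
  simp

@[simp] theorem lift_ιV {v : V →ₗ[R] A} {i : I →ₗ[R] A} {d : D →ₗ[R] A} (h : Compat ev q v i d)
    (x : V) : lift h (ιV ev q x) = v x := by
  change lift h (mk ev q (TensorAlgebra.ι R x ⊗ₜ 1)) = _
  simp [lift_mk]

@[simp] theorem lift_ιI {v : V →ₗ[R] A} {i : I →ₗ[R] A} {d : D →ₗ[R] A} (h : Compat ev q v i d)
    (x : I) : lift h (ιI ev q x) = i x := by
  change lift h (mk ev q (1 ⊗ₜ LaurentRees.gen ev (x, 0))) = _
  simp [lift_mk, liftL, LaurentRees.lift_gen]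

@[simp] theorem lift_ιD {v : V →ₗ[R] A} {i : I →ₗ[R] A} {d : D →ₗ[R] A} (h : Compat ev q v i d)
    (x : D) : lift h (ιD ev q x) = d x := by
  change lift h (mk ev q (1 ⊗ₜ LaurentRees.gen ev (0, x))) = _
  simp [lift_mk, liftL, LaurentRees.lift_gen]

theorem hom_ext {f g : GenClifford ev q →ₐ[R] A} (hv : ∀ x, f (ιV ev q x) = g (ιV ev q x))
    (hi : ∀ x, f (ιI ev q x) = g (ιI ev q x)) (hd : ∀ x, f (ιD ev q x) = g (ιD ev q x)) :
    f = g := by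
  apply RingQuot.ringQuot_ext'
  apply Algebra.TensorProduct.ext
  · apply TensorAlgebra.hom_ext
    ext x
    exact hv x
  · apply LaurentRees.hom_ext
    rintro ⟨a, b⟩
    have e : ((a, b) : I × D) = (a, 0) + (0, b) := by simp
    rw [e, map_add, map_add, map_add]
    exact congrArg₂ (· + ·) (hi a) (hd b)

end lift

/-- The canonical maps satisfy the relations. -/
theorem compat : Compat ev q (ιV ev q) (ιI ev q) (ιD ev q) where
  sq := ιV_sq
  vi _ _ := ιV_ofL _ _
  vd _ _ := ιV_ofL _ _
  ii _ _ := ofL_comm _ _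
  idd _ _ := ofL_comm _ _
  dd _ _ := ofL_comm _ _
  pair := pair_eq

/-- A subalgebra containing the generators is everything. -/
theorem mem_of_gen (S : Subalgebra R (GenClifford ev q)) (hv : ∀ x, ιV ev q x ∈ S)
    (hi : ∀ x, ιI ev q x ∈ S) (hd : ∀ x, ιD ev q x ∈ S) (c : GenClifford ev q) : c ∈ S := by
  have hc : Compat ev q ((ιV ev q).codRestrict S.toSubmodule hv)
      ((ιI ev q).codRestrict S.toSubmodule hi) ((ιD ev q).codRestrict S.toSubmodule hd) (A := S) :=
    { sq := fun x => Subtype.ext (compat.sq x)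
      vi := fun x a => Subtype.ext (compat.vi x a)
      vd := fun x a => Subtype.ext (compat.vd x a)
      ii := fun x a => Subtype.ext (compat.ii x a)
      idd := fun x a => Subtype.ext (compat.idd x a)
      dd := fun x a => Subtype.ext (compat.dd x a)
      pair := fun x a => Subtype.ext (compat.pair x a) }
  have : S.val.comp (lift hc) = AlgHom.id R _ := hom_ext
    (fun x => by rw [AlgHom.comp_apply, lift_ιV]; rfl)
    (fun x => by rw [AlgHom.comp_apply, lift_ιI]; rfl)
    (fun x => by rw [AlgHom.comp_apply, lift_ιD]; rfl)
  have h2 := AlgHom.congr_fun this c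
  rw [AlgHom.id_apply] at h2
  rw [← h2]
  exact (lift hc c).2

/-- Induction: a submodule containing `1` and stable under left multiplication by the generators
is everything. -/
theorem mem_of_mul_mem (N : Submodule R (GenClifford ev q)) (h1 : 1 ∈ N)
    (hv : ∀ x, ∀ c ∈ N, ιV ev q x * c ∈ N) (hi : ∀ x, ∀ c ∈ N, ιI ev q x * c ∈ N)
    (hd : ∀ x, ∀ c ∈ N, ιD ev q x * c ∈ N) (c : GenClifford ev q) : c ∈ N := by
  let S : Subalgebra R (GenClifford ev q) :=
    { carrier := {a | ∀ c ∈ N, a * c ∈ N}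
      mul_mem' := fun {a b} ha hb c hc => by rw [mul_assoc]; exact ha _ (hb _ hc)
      add_mem' := fun {a b} ha hb c hc => by rw [add_mul]; exact N.add_mem (ha _ hc) (hb _ hc)
      algebraMap_mem' := fun r c hc => by rw [← Algebra.smul_def]; exact N.smul_mem _ hc }
  have := mem_of_gen S hv hi hd c 1 h1
  rwa [mul_one] at this

section contraction

/-- `(u, w) ↦ (x u, f(x) u - x w)` -/
noncomputable def contrGen (f : V →ₗ[R] I) :
    V →ₗ[R] Module.End R (GenClifford ev q × GenClifford ev q) :=
  LinearMap.mk₂ R (fun x p => (ιV ev q x * p.1, ιI ev q (f x) * p.1 - ιV ev q x * p.2))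
    (fun x y p => by simp only [map_add, add_mul, Prod.mk_add_mk]; congr 1; abel)
    (fun r x p => by simp only [map_smul, smul_mul_assoc, Prod.smul_mk, smul_sub])
    (fun x p p' => by
      simp only [Prod.fst_add, Prod.snd_add, mul_add, Prod.mk_add_mk]; congr 1; abel)
    (fun r x p => by
      simp only [Prod.smul_fst, Prod.smul_snd, mul_smul_comm, Prod.smul_mk, smul_sub])

/-- Left multiplication on both components. -/
noncomputable def diagMul :
    GenClifford ev q →ₐ[R] Module.End R (GenClifford ev q × GenClifford ev q) :=
  Algebra.lsmul R R (GenClifford ev q × GenClifford ev q)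

theorem diagMul_apply (c : GenClifford ev q) (p) : diagMul c p = (c * p.1, c * p.2) := rfl

theorem contrGen_apply (f : V →ₗ[R] I) (x : V) (p : GenClifford ev q × GenClifford ev q) :
    contrGen f x p = (ιV ev q x * p.1, ιI ev q (f x) * p.1 - ιV ev q x * p.2) := rfl

theorem contrGen_comm (f : V →ₗ[R] I) (x : V) (l : LaurentRees ev) :
    Commute (contrGen (ev := ev) (q := q) f x) (diagMul (ofL ev q l)) := by
  apply LinearMap.ext
  intro p
  have h1 := (ιV_ofL (q := q) x l).eq
  have h2 : ιI ev q (f x) * ofL ev q l = ofL ev q l * ιI ev q (f x) :=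
    (ofL_comm (q := q) (LaurentRees.ιI ev (f x)) l).eq
  simp only [Module.End.mul_apply, diagMul_apply, contrGen_apply, mul_sub, ← mul_assoc, h1, h2]

theorem contrCompat (f : V →ₗ[R] I) : Compat ev q (contrGen (ev := ev) (q := q) f)
    (diagMul.toLinearMap ∘ₗ ιI ev q) (diagMul.toLinearMap ∘ₗ ιD ev q) where
  sq x := by
    apply LinearMap.ext
    intro p
    have h2 : ιI ev q (f x) * ιV ev q x = ιV ev q x * ιI ev q (f x) := (compat.vi x (f x)).eq.symm
    simp only [Module.End.mul_apply, contrGen_apply, LinearMap.comp_apply,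
      AlgHom.toLinearMap_apply, diagMul_apply, mul_sub, ← mul_assoc, ιV_sq, h2]
    simp
  vi _ _ := contrGen_comm _ _ _
  vd _ _ := contrGen_comm _ _ _
  ii _ _ := (compat.ii _ _).map diagMul
  idd _ _ := (compat.idd _ _).map diagMul
  dd _ _ := (compat.dd _ _).map diagMul
  pair a b := by
    simp only [LinearMap.comp_apply, AlgHom.toLinearMap_apply, ← map_mul, pair_eq,
      AlgHom.commutes]

/-- The endomorphism `d_f` of `C̃(V, q, I)` defined by `f : V → I`: it vanishes on `L[I]`, and
`d_f (x y) = f(x) y - x d_f(y)` for `x` in `V` (see `contr_one`, `contr_ιV`, `contr_ιI`, `contr_ιD`). -/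
noncomputable def contr (f : V →ₗ[R] I) : GenClifford ev q →ₗ[R] GenClifford ev q where
  toFun c := (lift (contrCompat f) c (1, 0)).2
  map_add' a b := by simp
  map_smul' r a := by simp

theorem lift_contr_fst (f : V →ₗ[R] I) (c : GenClifford ev q) :
    (lift (contrCompat f) c (1, 0)).1 = c := by
  let N : Submodule R (GenClifford ev q) :=
    { carrier := {c | (lift (contrCompat f) c (1, 0)).1 = c}
      add_mem' := fun {a b} ha hb => by
        simp only [Set.mem_ofPred_eq] at ha hb ⊢
        rw [map_add, LinearMap.add_apply, Prod.fst_add, ha, hb]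
      zero_mem' := by simp
      smul_mem' := fun r a ha => by
        simp only [Set.mem_ofPred_eq] at ha ⊢
        rw [map_smul, LinearMap.smul_apply, Prod.smul_fst, ha] }
  refine mem_of_mul_mem N ?_ ?_ ?_ ?_ c
  · change (lift (contrCompat f) 1 (1, 0)).1 = 1
    simp
  · intro x c (hc : _ = _)
    change (lift (contrCompat f) (_ * c) (1, 0)).1 = _
    rw [map_mul, Module.End.mul_apply, lift_ιV, contrGen_apply, hc]
  · intro x c (hc : _ = _)
    change (lift (contrCompat f) (_ * c) (1, 0)).1 = _
    rw [map_mul, Module.End.mul_apply, lift_ιI]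
    change _ * _ = _
    rw [hc]
  · intro x c (hc : _ = _)
    change (lift (contrCompat f) (_ * c) (1, 0)).1 = _
    rw [map_mul, Module.End.mul_apply, lift_ιD]
    change _ * _ = _
    rw [hc]

theorem contr_one (f : V →ₗ[R] I) : contr (ev := ev) (q := q) f 1 = 0 := by
  simp [contr]

theorem contr_ιV (f : V →ₗ[R] I) (x : V) (c : GenClifford ev q) :
    contr f (ιV ev q x * c) = ιI ev q (f x) * c - ιV ev q x * contr f c := by
  simp only [contr, LinearMap.coe_mk, AddHom.coe_mk, map_mul, Module.End.mul_apply, lift_ιV,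
    contrGen_apply, lift_contr_fst]

theorem contr_ιI (f : V →ₗ[R] I) (x : I) (c : GenClifford ev q) :
    contr f (ιI ev q x * c) = ιI ev q x * contr f c := by
  simp only [contr, LinearMap.coe_mk, AddHom.coe_mk, map_mul, Module.End.mul_apply, lift_ιI]
  rfl

theorem contr_ιD (f : V →ₗ[R] I) (x : D) (c : GenClifford ev q) :
    contr f (ιD ev q x * c) = ιD ev q x * contr f c := by
  simp only [contr, LinearMap.coe_mk, AddHom.coe_mk, map_mul, Module.End.mul_apply, lift_ιD]
  rfl

theorem contr_contr (f : V →ₗ[R] I) (c : GenClifford ev q) : contr f (contr f c) = 0 := by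
  refine mem_of_mul_mem (LinearMap.ker (contr f ∘ₗ contr f)) ?_ ?_ ?_ ?_ c
  · simp [contr_one]
  · intro x c hc
    rw [LinearMap.mem_ker, LinearMap.comp_apply] at hc ⊢
    rw [contr_ιV, map_sub, contr_ιI, contr_ιV, hc]
    simp
  · intro x c hc
    rw [LinearMap.mem_ker, LinearMap.comp_apply] at hc ⊢
    rw [contr_ιI, contr_ιI, hc, mul_zero]
  · intro x c hc
    rw [LinearMap.mem_ker, LinearMap.comp_apply] at hc ⊢
    rw [contr_ιD, contr_ιD, hc, mul_zero]

/-- `d_f` is linear in `f`. -/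
theorem contr_add (f g : V →ₗ[R] I) (c : GenClifford ev q) :
    contr (f + g) c = contr f c + contr g c := by
  have : c ∈ LinearMap.ker (contr (f + g) - (contr f + contr g) :
      GenClifford ev q →ₗ[R] GenClifford ev q) := by
    refine mem_of_mul_mem _ ?_ ?_ ?_ ?_ c
    · simp [contr_one]
    · intro x c hc
      rw [LinearMap.mem_ker, LinearMap.sub_apply, LinearMap.add_apply, sub_eq_zero] at hc ⊢
      simp only [contr_ιV, hc, LinearMap.add_apply, map_add, add_mul, mul_add]
      abel
    · intro x c hc
      rw [LinearMap.mem_ker, LinearMap.sub_apply, LinearMap.add_apply, sub_eq_zero] at hc ⊢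
      simp only [contr_ιI, hc, mul_add]
    · intro x c hc
      rw [LinearMap.mem_ker, LinearMap.sub_apply, LinearMap.add_apply, sub_eq_zero] at hc ⊢
      simp only [contr_ιD, hc, mul_add]
  rwa [LinearMap.mem_ker, LinearMap.sub_apply, LinearMap.add_apply, sub_eq_zero] at this

theorem contr_smul (r : R) (f : V →ₗ[R] I) (c : GenClifford ev q) :
    contr (r • f) c = r • contr f c := by
  have : c ∈ LinearMap.ker (contr (r • f) - r • contr f :
      GenClifford ev q →ₗ[R] GenClifford ev q) := by
    refine mem_of_mul_mem _ ?_ ?_ ?_ ?_ c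
    · simp [contr_one]
    · intro x c hc
      rw [LinearMap.mem_ker, LinearMap.sub_apply, LinearMap.smul_apply, sub_eq_zero] at hc ⊢
      simp only [contr_ιV, hc, LinearMap.smul_apply, map_smul, smul_mul_assoc, mul_smul_comm,
        smul_sub]
    · intro x c hc
      rw [LinearMap.mem_ker, LinearMap.sub_apply, LinearMap.smul_apply, sub_eq_zero] at hc ⊢
      simp only [contr_ιI, hc, mul_smul_comm]
    · intro x c hc
      rw [LinearMap.mem_ker, LinearMap.sub_apply, LinearMap.smul_apply, sub_eq_zero] at hc ⊢
      simp only [contr_ιD, hc, mul_smul_comm]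
  rwa [LinearMap.mem_ker, LinearMap.sub_apply, LinearMap.smul_apply, sub_eq_zero] at this

end contraction

section bourbaki

variable {q' : QuadraticMap R V I}

/-- `c ↦ x c + d_{b_x}(c)`, where `b_x = b(x, -)`. -/
noncomputable def psiGen (b : V →ₗ[R] V →ₗ[R] I) : V →ₗ[R] Module.End R (GenClifford ev q) :=
  LinearMap.mk₂ R (fun x c => ιV ev q x * c + contr (b x) c)
    (fun x y c => by simp only [map_add, add_mul, contr_add]; abel)
    (fun r x c => by simp only [map_smul, smul_mul_assoc, contr_smul, smul_add])
    (fun x c c' => by simp only [map_add, mul_add]; abel)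
    (fun r x c => by simp only [map_smul, mul_smul_comm, smul_add])

theorem psiGen_apply (b : V →ₗ[R] V →ₗ[R] I) (x : V) (c : GenClifford ev q) :
    psiGen b x c = ιV ev q x * c + contr (b x) c := rfl

theorem lmul_app (a c : GenClifford ev q) : Algebra.lmul R (GenClifford ev q) a c = a * c := rfl

theorem psiCompat (b : V →ₗ[R] V →ₗ[R] I) (h : ∀ x, q' x = q x + b x x) :
    Compat ev q' (psiGen (ev := ev) (q := q) b)
      ((Algebra.lmul R (GenClifford ev q)).toLinearMap ∘ₗ ιI ev q)
      ((Algebra.lmul R (GenClifford ev q)).toLinearMap ∘ₗ ιD ev q) where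
  sq x := by
    apply LinearMap.ext
    intro c
    simp only [Module.End.mul_apply, psiGen_apply, LinearMap.comp_apply,
      AlgHom.toLinearMap_apply, map_add, contr_ιV, contr_contr,
      ← mul_assoc, ιV_sq, h, lmul_app, LinearMap.add_apply]
    abel
  vi x a := by
    apply LinearMap.ext
    intro c
    simp only [Module.End.mul_apply, psiGen_apply, LinearMap.comp_apply,
      AlgHom.toLinearMap_apply, lmul_app, mul_add, contr_ιI, ← mul_assoc,
      (compat.vi x a).eq]
  vd x a := by
    apply LinearMap.ext
    intro c
    simp only [Module.End.mul_apply, psiGen_apply, LinearMap.comp_apply,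
      AlgHom.toLinearMap_apply, lmul_app, mul_add, contr_ιD, ← mul_assoc,
      (compat.vd x a).eq]
  ii _ _ := (compat.ii _ _).map (Algebra.lmul R (GenClifford ev q))
  idd _ _ := (compat.idd _ _).map (Algebra.lmul R (GenClifford ev q))
  dd _ _ := (compat.dd _ _).map (Algebra.lmul R (GenClifford ev q))
  pair a b := by
    simp only [LinearMap.comp_apply, AlgHom.toLinearMap_apply, ← map_mul, pair_eq,
      AlgHom.commutes]

/-- The Bourbaki map `ψ_b : C̃(V, q', I) → C̃(V, q, I)`, for `q' = q + q_b`. It fixes `L[I]`, and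
`ψ_b(x y) = x ψ_b(y) + d_{b_x}(ψ_b(y))` for `x` in `V` (see `psi_one`, `psi_ιV`, `psi_ιI`, `psi_ιD`). -/
noncomputable def psi (b : V →ₗ[R] V →ₗ[R] I) (h : ∀ x, q' x = q x + b x x) :
    GenClifford ev q' →ₗ[R] GenClifford ev q where
  toFun c := lift (psiCompat b h) c 1
  map_add' a b := by simp
  map_smul' r a := by simp

theorem psi_one (b : V →ₗ[R] V →ₗ[R] I) (h : ∀ x, q' x = q x + b x x) :
    psi (ev := ev) b h 1 = 1 := by
  simp [psi]

theorem psi_ιV (b : V →ₗ[R] V →ₗ[R] I) (h : ∀ x, q' x = q x + b x x) (x : V)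
    (c : GenClifford ev q') :
    psi b h (ιV ev q' x * c) = ιV ev q x * psi b h c + contr (b x) (psi b h c) := by
  simp [psi, psiGen_apply]

theorem psi_ιI (b : V →ₗ[R] V →ₗ[R] I) (h : ∀ x, q' x = q x + b x x) (x : I)
    (c : GenClifford ev q') : psi b h (ιI ev q' x * c) = ιI ev q x * psi b h c := by
  simp [psi]

theorem psi_ιD (b : V →ₗ[R] V →ₗ[R] I) (h : ∀ x, q' x = q x + b x x) (x : D)
    (c : GenClifford ev q') : psi b h (ιD ev q' x * c) = ιD ev q x * psi b h c := by
  simp [psi]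

end bourbaki

section exterior

theorem extCompat : Compat ev (0 : QuadraticMap R V I)
    ((Algebra.TensorProduct.includeLeft :
      ExteriorAlgebra R V →ₐ[R] ExteriorAlgebra R V ⊗[R] LaurentRees ev).toLinearMap ∘ₗ
        ExteriorAlgebra.ι R)
    ((Algebra.TensorProduct.includeRight :
      LaurentRees ev →ₐ[R] ExteriorAlgebra R V ⊗[R] LaurentRees ev).toLinearMap ∘ₗ
        LaurentRees.ιI ev)
    ((Algebra.TensorProduct.includeRight :
      LaurentRees ev →ₐ[R] ExteriorAlgebra R V ⊗[R] LaurentRees ev).toLinearMap ∘ₗ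
        LaurentRees.ιD ev) where
  sq x := by simp
  vi x a := by simp [Commute, SemiconjBy]
  vd x a := by simp [Commute, SemiconjBy]
  ii a b := Commute.map (x := LaurentRees.ιI ev a) (y := LaurentRees.ιI ev b)
    (LaurentRees.gen_comm _ _) Algebra.TensorProduct.includeRight
  idd a b := Commute.map (x := LaurentRees.ιI ev a) (y := LaurentRees.ιD ev b)
    (LaurentRees.gen_comm _ _) Algebra.TensorProduct.includeRight
  dd a b := Commute.map (x := LaurentRees.ιD ev a) (y := LaurentRees.ιD ev b)
    (LaurentRees.gen_comm _ _) Algebra.TensorProduct.includeRight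
  pair a b := by
    simp only [LinearMap.comp_apply, AlgHom.toLinearMap_apply, ← map_mul, LaurentRees.pair_eq,
      AlgHom.commutes]

variable (ev) in
/-- The canonical identification `C̃(V, 0, I) = Λ(V) ⊗ L[I]`. -/
noncomputable def toExterior :
    GenClifford ev (0 : QuadraticMap R V I) →ₐ[R] ExteriorAlgebra R V ⊗[R] LaurentRees ev :=
  lift extCompat

variable (ev) in
/-- The Bourbaki map `ψ_b : C̃(V, q_b, I) → C̃(V, 0, I) = Λ(V) ⊗ L[I]`. -/
noncomputable def psiExt (b : V →ₗ[R] V →ₗ[R] I) (h : ∀ x, q x = b x x) :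
    GenClifford ev q →ₗ[R] ExteriorAlgebra R V ⊗[R] LaurentRees ev :=
  (toExterior ev).toLinearMap ∘ₗ psi b (fun x => by simp [h])

variable (ev V) in
/-- The canonical map `R ⊕ Λ²(V) ⊗ I⁻¹ → Λ(V) ⊗ L[I]`, `(r, ω ⊗ ζ) ↦ r · 1 + ω ⊗ ζ`. -/
noncomputable def lambdaEv :
    R × (⋀[R]^2 V ⊗[R] D) →ₗ[R] ExteriorAlgebra R V ⊗[R] LaurentRees ev :=
  (Algebra.linearMap R _).coprod (TensorProduct.map (⋀[R]^2 V).subtype (LaurentRees.ιD ev))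

end exterior

section grading

variable (ev q)

/-- Products of elements of `V` (degree `1`), `I` (degree `2`) and `I⁻¹` (degree `-2`) of total
degree `n`. -/
inductive IsMonomial : ℤ → GenClifford ev q → Prop
  | mk (v : List V) (i : List I) (d : List D) : IsMonomial
      ((v.length : ℤ) + 2 * i.length - 2 * d.length)
      ((v.map (ιV ev q)).prod * (i.map (ιI ev q)).prod * (d.map (ιD ev q)).prod)

/-- The submodule `C_n` of elements of degree `n` in `C̃(V, q, I)`. -/
noncomputable def degreePart (n : ℤ) : Submodule R (GenClifford ev q) :=
  Submodule.span R {c | IsMonomial ev q n c}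

variable {ev q}

theorem isMonomial_one : IsMonomial ev q 0 1 := by
  have := IsMonomial.mk (ev := ev) (q := q) [] [] []
  simpa using this

theorem IsMonomial.mul {m n : ℤ} {a b : GenClifford ev q} (ha : IsMonomial ev q m a)
    (hb : IsMonomial ev q n b) : IsMonomial ev q (m + n) (a * b) := by
  obtain ⟨v, i, d⟩ := ha
  obtain ⟨v', i', d'⟩ := hb
  have := IsMonomial.mk (ev := ev) (q := q) (v ++ v') (i ++ i') (d ++ d')
  have c1 : Commute (i.map (ιI ev q)).prod (v'.map (ιV ev q)).prod := by
    refine Commute.list_prod_left _ _ fun x hx => Commute.list_prod_right _ _ fun y hy => ?_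
    obtain ⟨x, -, rfl⟩ := List.mem_map.1 hx
    obtain ⟨y, -, rfl⟩ := List.mem_map.1 hy
    exact (compat.vi _ _).symm
  have c2 : Commute (d.map (ιD ev q)).prod (v'.map (ιV ev q)).prod := by
    refine Commute.list_prod_left _ _ fun x hx => Commute.list_prod_right _ _ fun y hy => ?_
    obtain ⟨x, -, rfl⟩ := List.mem_map.1 hx
    obtain ⟨y, -, rfl⟩ := List.mem_map.1 hy
    exact (compat.vd _ _).symm
  have c3 : Commute (d.map (ιD ev q)).prod (i'.map (ιI ev q)).prod := by
    refine Commute.list_prod_left _ _ fun x hx => Commute.list_prod_right _ _ fun y hy => ?_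
    obtain ⟨x, -, rfl⟩ := List.mem_map.1 hx
    obtain ⟨y, -, rfl⟩ := List.mem_map.1 hy
    exact (compat.idd _ _).symm
  simp only [List.map_append, List.prod_append, List.length_append] at this
  generalize (v.map (ιV ev q)).prod = A at *
  generalize (v'.map (ιV ev q)).prod = A' at *
  generalize (i.map (ιI ev q)).prod = B at *
  generalize (i'.map (ιI ev q)).prod = B' at *
  generalize (d.map (ιD ev q)).prod = C at *
  generalize (d'.map (ιD ev q)).prod = C' at *
  have e : A * B * C * (A' * B' * C') = A * A' * (B * B') * (C * C') := by
    calc A * B * C * (A' * B' * C') = A * B * (C * A') * B' * C' := by simp only [mul_assoc]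
      _ = A * (B * A') * (C * B') * C' := by rw [c2.eq]; simp only [mul_assoc]
      _ = A * A' * (B * B') * (C * C') := by rw [c1.eq, c3.eq]; simp only [mul_assoc]
  rw [e]
  convert this using 1
  push_cast
  ring

variable (ev q)

/-- The even Clifford algebra `C₀(V, q, I)`: the subalgebra of elements of degree `0` in the
generalised Clifford algebra. -/
noncomputable def C0 : Subalgebra R (GenClifford ev q) :=
  (degreePart ev q 0).toSubalgebra (Submodule.subset_span isMonomial_one) (fun a b ha hb => by
    induction ha, hb using Submodule.span_induction₂ with
    | mem_mem x y hx hy => exact Submodule.subset_span (by simpa using IsMonomial.mul hx hy)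
    | zero_left y hy => simp
    | zero_right x hx => simp
    | add_left x y z _ _ _ h1 h2 => rw [add_mul]; exact add_mem h1 h2
    | add_right x y z _ _ _ h1 h2 => rw [mul_add]; exact add_mem h1 h2
    | smul_left r x y _ _ h => rw [smul_mul_assoc]; exact Submodule.smul_mem _ _ h
    | smul_right r x y _ _ h => rw [mul_smul_comm]; exact Submodule.smul_mem _ _ h)

end grading

end GenClifford

end Algebra
end QuadBundle

namespace QuadBundle

open CategoryTheory AlgebraicGeometry
open scoped TensorProduct

section BaseChange

variable {R S : Type u} [CommRing R] [CommRing S] {σ : R →+* S}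
variable {V I D V' I' D' : Type u} [AddCommGroup V] [Module R V] [AddCommGroup I] [Module R I]
  [AddCommGroup D] [Module R D] [AddCommGroup V'] [Module S V'] [AddCommGroup I'] [Module S I']
  [AddCommGroup D'] [Module S D']
variable {ev : D →ₗ[R] I →ₗ[R] R} {q : QuadraticMap R V I}
variable {ev' : D' →ₗ[S] I' →ₗ[S] S} {q' : QuadraticMap S V' I'}

/-- The ring homomorphism `C̃(V, q, I) → C̃(V', q', I')` induced by semilinear maps that are
compatible with the quadratic forms and the pairings. -/
noncomputable def GenClifford.map (v : V →ₛₗ[σ] V') (i : I →ₛₗ[σ] I') (d : D →ₛₗ[σ] D')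
    (hq : ∀ x, q' (v x) = i (q x)) (hev : ∀ a δ, ev' (d δ) (i a) = σ (ev δ a)) :
    GenClifford ev q →+* GenClifford ev' q' :=
  letI : Algebra R (GenClifford ev' q') := Algebra.compHom _ σ
  (GenClifford.lift (A := GenClifford ev' q')
    (v := { toFun := fun x => GenClifford.ιV ev' q' (v x)
            map_add' := fun x y => by rw [map_add, map_add]
            map_smul' := fun r x => by rw [map_smulₛₗ, map_smul]; rfl })
    (i := { toFun := fun x => GenClifford.ιI ev' q' (i x)
            map_add' := fun x y => by rw [map_add, map_add]
            map_smul' := fun r x => by rw [map_smulₛₗ, map_smul]; rfl })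
    (d := { toFun := fun x => GenClifford.ιD ev' q' (d x)
            map_add' := fun x y => by rw [map_add, map_add]
            map_smul' := fun r x => by rw [map_smulₛₗ, map_smul]; rfl })
    { sq := fun x => by
        change GenClifford.ιV ev' q' (v x) * GenClifford.ιV ev' q' (v x) = _
        rw [GenClifford.ιV_sq, hq]; rfl
      vi := fun x a => GenClifford.compat.vi _ _
      vd := fun x a => GenClifford.compat.vd _ _
      ii := fun x a => GenClifford.compat.ii _ _
      idd := fun x a => GenClifford.compat.idd _ _
      dd := fun x a => GenClifford.compat.dd _ _
      pair := fun a δ => by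
        change GenClifford.ιI ev' q' (i a) * GenClifford.ιD ev' q' (d δ) = _
        rw [GenClifford.pair_eq, hev]; rfl }).toRingHom

section

variable (v : V →ₛₗ[σ] V') (i : I →ₛₗ[σ] I') (d : D →ₛₗ[σ] D')
    (hq : ∀ x, q' (v x) = i (q x)) (hev : ∀ a δ, ev' (d δ) (i a) = σ (ev δ a))

theorem GenClifford.map_ιV (x : V) :
    GenClifford.map v i d hq hev (ιV ev q x) = ιV ev' q' (v x) := by
  let _ : Algebra R (GenClifford ev' q') := Algebra.compHom _ σ
  exact GenClifford.lift_ιV _ x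

theorem GenClifford.map_ιI (x : I) :
    GenClifford.map v i d hq hev (ιI ev q x) = ιI ev' q' (i x) := by
  let _ : Algebra R (GenClifford ev' q') := Algebra.compHom _ σ
  exact GenClifford.lift_ιI _ x

theorem GenClifford.map_ιD (x : D) :
    GenClifford.map v i d hq hev (ιD ev q x) = ιD ev' q' (d x) := by
  let _ : Algebra R (GenClifford ev' q') := Algebra.compHom _ σ
  exact GenClifford.lift_ιD _ x

theorem GenClifford.map_smul' (r : R) (c : GenClifford ev q) :
    GenClifford.map v i d hq hev (r • c) = σ r • GenClifford.map v i d hq hev c := by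
  let _ : Algebra R (GenClifford ev' q') := Algebra.compHom _ σ
  exact _root_.map_smul (GenClifford.lift (A := GenClifford ev' q') _) r c

theorem GenClifford.map_mem_degreePart (n : ℤ) (c : GenClifford ev q)
    (hc : c ∈ degreePart ev q n) : GenClifford.map v i d hq hev c ∈ degreePart ev' q' n := by
  induction hc using Submodule.span_induction with
  | mem x hx =>
    refine Submodule.subset_span ?_
    obtain ⟨a, b, c⟩ := hx
    have := IsMonomial.mk (ev := ev') (q := q') (a.map v) (b.map i) (c.map d)
    simp only [List.length_map, List.map_map] at this
    change IsMonomial _ _ _ _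
    rw [map_mul, map_mul, map_list_prod, map_list_prod, map_list_prod, List.map_map, List.map_map,
      List.map_map]
    have e1 : ⇑(GenClifford.map v i d hq hev) ∘ ⇑(ιV ev q) = ⇑(ιV ev' q') ∘ ⇑v :=
      funext fun x => GenClifford.map_ιV v i d hq hev x
    have e2 : ⇑(GenClifford.map v i d hq hev) ∘ ⇑(ιI ev q) = ⇑(ιI ev' q') ∘ ⇑i :=
      funext fun x => GenClifford.map_ιI v i d hq hev x
    have e3 : ⇑(GenClifford.map v i d hq hev) ∘ ⇑(ιD ev q) = ⇑(ιD ev' q') ∘ ⇑d :=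
      funext fun x => GenClifford.map_ιD v i d hq hev x
    rw [e1, e2, e3]
    exact this
  | zero => rw [map_zero]; exact zero_mem _
  | add x y _ _ hx hy => rw [map_add]; exact add_mem hx hy
  | smul r x _ hx => rw [GenClifford.map_smul']; exact Submodule.smul_mem _ _ hx

/-- The induced ring homomorphism `C₀(V, q, I) → C₀(V', q', I')`. -/
noncomputable def GenClifford.mapC0 : C0 ev q →+* C0 ev' q' :=
  (GenClifford.map v i d hq hev).restrict (C0 ev q) (C0 ev' q')
    (fun c hc => GenClifford.map_mem_degreePart v i d hq hev 0 c hc)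

end

/-- The semilinear map `Λ²(V) ⊗ D → N` induced by semilinear maps `v : V → V'`, `d : D → D'` and
an alternating bilinear map `β` on `V'` with values in `Hom(D', N)`. -/
noncomputable def lamLift {N : Type u} [AddCommGroup N] [Module S N]
    (β : V' [⋀^Fin 2]→ₗ[S] (D' →ₗ[S] N)) (v : V →ₛₗ[σ] V') (d : D →ₛₗ[σ] D') :
    (⋀[R]^2 V ⊗[R] D) →ₛₗ[σ] N :=
  letI : Module R N := Module.compHom N σ
  let F : V [⋀^Fin 2]→ₗ[R] (D →ₗ[R] N) :=
    { toFun := fun m =>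
        { toFun := fun δ => β (v ∘ m) (d δ)
          map_add' := fun x y => by rw [map_add, map_add]
          map_smul' := fun r x => by rw [map_smulₛₗ, map_smul]; rfl }
      map_update_add' := fun m j x y => by
        apply LinearMap.ext
        intro δ
        change β _ (d δ) = β _ (d δ) + β _ (d δ)
        rw [Function.comp_update, Function.comp_update, Function.comp_update, map_add,
          AlternatingMap.map_update_add, LinearMap.add_apply]
      map_update_smul' := fun m j r x => by
        apply LinearMap.ext
        intro δ
        change β _ (d δ) = σ r • β _ (d δ)
        rw [Function.comp_update, Function.comp_update, map_smulₛₗ,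
          AlternatingMap.map_update_smul, LinearMap.smul_apply]
      map_eq_zero_of_eq' := fun m j k h hjk => by
        apply LinearMap.ext
        intro δ
        change β (v ∘ m) (d δ) = 0
        rw [AlternatingMap.map_eq_zero_of_eq _ _ (i := j) (j := k) (by simp [h]) hjk,
          LinearMap.zero_apply] }
  let G := TensorProduct.lift (exteriorPower.alternatingMapLinearEquiv F)
  { toFun := G
    map_add' := fun x y => map_add G x y
    map_smul' := fun r x => G.map_smul r x }

/-- The semilinear map `Λ²(V) ⊗ D → Λ²(V') ⊗ D'` induced by semilinear maps `V → V'`, `D → D'`: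
`(x ∧ y) ⊗ ζ ↦ (v x ∧ v y) ⊗ d ζ`. -/
noncomputable def lamMap (v : V →ₛₗ[σ] V') (d : D →ₛₗ[σ] D') :
    (⋀[R]^2 V ⊗[R] D) →ₛₗ[σ] (⋀[S]^2 V' ⊗[S] D') :=
  lamLift (N := ⋀[S]^2 V' ⊗[S] D')
    ((TensorProduct.mk S (⋀[S]^2 V') D').compAlternatingMap (exteriorPower.ιMulti S 2)) v d

theorem lamMap_tmul (v : V →ₛₗ[σ] V') (d : D →ₛₗ[σ] D') (m : Fin 2 → V) (δ : D) :
    lamMap v d (exteriorPower.ιMulti R 2 m ⊗ₜ[R] δ) =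
      exteriorPower.ιMulti S 2 (v ∘ m) ⊗ₜ[S] d δ := by
  let _ : Module R (⋀[S]^2 V' ⊗[S] D') := Module.compHom _ σ
  simp only [lamMap, lamLift, LinearMap.coe_mk, AddHom.coe_mk, TensorProduct.lift.tmul]
  erw [exteriorPower.alternatingMapLinearEquiv_apply_ιMulti]
  rfl

end BaseChange

section Sheaves

variable {X : Scheme.{u}}

/-- Restriction of functions. -/
noncomputable def res {U W : X.Opens} (h : W ≤ U) : Γ(X, U) →+* Γ(X, W) :=
  (X.presheaf.map (homOfLE h).op).hom

/-- Restriction of sections of a sheaf of modules. -/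
noncomputable def secRes (M : X.Modules) {U W : X.Opens} (h : W ≤ U) :
    Γ(M, U) →ₛₗ[res h] Γ(M, W) where
  toFun x := M.presheaf.map (homOfLE h).op x
  map_add' x y := map_add _ x y
  map_smul' r x := Scheme.Modules.map_smul M (homOfLE h) r x

theorem res_res {U W Z : X.Opens} (h : W ≤ U) (h' : Z ≤ W) (r : Γ(X, U)) :
    res h' (res h r) = res (h'.trans h) r := by
  have := X.presheaf.map_comp (homOfLE h).op (homOfLE h').op
  exact (congrArg (fun f => f.hom r) this).symm

/-- `M` is a vector bundle of rank `n`: a sheaf of modules that is locally isomorphic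
to `𝒪ⁿ`. -/
def IsVectorBundle (M : X.Modules) (n : ℕ) : Prop :=
  ∀ x : X, ∃ U : X.Opens, x ∈ U ∧
    Nonempty (M.restrict U.ι ≅
      (SheafOfModules.free (ULift.{u} (Fin n)) : SheafOfModules (U : Scheme).ringCatSheaf))

/-- Sections over `U` of the dual sheaf `I⁻¹ = ℋom(I, 𝒪)`: morphisms `I|_U → 𝒪_U`, that is,
linear maps `Γ(I, W) → Γ(X, W)` for all `W ≤ U`, compatible with restriction. -/
def dualSub (I : X.Modules) (U : X.Opens) :
    AddSubgroup (∀ W : {W : X.Opens // W ≤ U}, Γ(I, W.1) →ₗ[Γ(X, W.1)] Γ(X, W.1)) where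
  carrier := {f | ∀ (W Z : {W : X.Opens // W ≤ U}) (h : Z.1 ≤ W.1) (x : Γ(I, W.1)),
    f Z (secRes I h x) = res h (f W x)}
  add_mem' := fun {f g} hf hg W Z h x => by
    simp only [Pi.add_apply, LinearMap.add_apply, map_add, hf W Z h x, hg W Z h x]
  zero_mem' := fun W Z h x => by simp
  neg_mem' := fun {f} hf W Z h x => by
    simp only [Pi.neg_apply, LinearMap.neg_apply, map_neg, hf W Z h x]

/-- `Γ(U, I⁻¹)`. -/
abbrev DualSec (I : X.Modules) (U : X.Opens) : Type u := dualSub I U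

noncomputable instance (I : X.Modules) (U : X.Opens) : Module Γ(X, U) (DualSec I U) where
  smul r f := ⟨fun W => res W.2 r • f.1 W, fun W Z h x => by
    simp only [LinearMap.smul_apply, smul_eq_mul, map_mul, f.2 W Z h x, res_res]⟩
  one_smul f := Subtype.ext (funext fun W => by
    change res W.2 1 • f.1 W = f.1 W
    rw [map_one, one_smul])
  mul_smul r s f := Subtype.ext (funext fun W => by
    change res W.2 (r * s) • f.1 W = res W.2 r • res W.2 s • f.1 W
    rw [map_mul, mul_smul])
  smul_zero r := Subtype.ext (funext fun W => by
    change res W.2 r • (0 : Γ(I, W.1) →ₗ[Γ(X, W.1)] Γ(X, W.1)) = 0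
    rw [smul_zero])
  smul_add r f g := Subtype.ext (funext fun W => by
    change res W.2 r • (f.1 W + g.1 W) = res W.2 r • f.1 W + res W.2 r • g.1 W
    rw [smul_add])
  add_smul r s f := Subtype.ext (funext fun W => by
    change res W.2 (r + s) • f.1 W = res W.2 r • f.1 W + res W.2 s • f.1 W
    rw [map_add, add_smul])
  zero_smul f := Subtype.ext (funext fun W => by
    change res W.2 0 • f.1 W = 0
    rw [map_zero, zero_smul])

/-- Restriction of sections of `I⁻¹`. -/
noncomputable def dualRes (I : X.Modules) {U W : X.Opens} (h : W ≤ U) :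
    DualSec I U →ₛₗ[res h] DualSec I W where
  toFun f := ⟨fun Z => f.1 ⟨Z.1, Z.2.trans h⟩, fun Y Z hZ x =>
    f.2 ⟨Y.1, Y.2.trans h⟩ ⟨Z.1, Z.2.trans h⟩ hZ x⟩
  map_add' f g := rfl
  map_smul' r f := Subtype.ext (funext fun Z => by
    change res (Z.2.trans h) r • _ = res Z.2 (res h r) • _
    rw [res_res])

/-- The evaluation pairing `Γ(U, I⁻¹) × Γ(U, I) → Γ(U, 𝒪)`. -/
noncomputable def evalPair (I : X.Modules) (U : X.Opens) :
    DualSec I U →ₗ[Γ(X, U)] Γ(I, U) →ₗ[Γ(X, U)] Γ(X, U) where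
  toFun f := f.1 ⟨U, le_rfl⟩
  map_add' f g := rfl
  map_smul' r f := by
    change res (le_refl U) r • _ = r • _
    have : res (le_refl U) r = r := by
      have := X.presheaf.map_id (Opposite.op U)
      exact congrArg (fun f => f.hom r) this
    rw [this]

theorem evalPair_res (I : X.Modules) {U W : X.Opens} (h : W ≤ U) (a : Γ(I, U))
    (δ : DualSec I U) :
    evalPair I W (dualRes I h δ) (secRes I h a) = res h (evalPair I U δ a) :=
  δ.2 ⟨U, le_rfl⟩ ⟨W, h⟩ h a

variable (X) in
/-- A vector bundle `V` of rank `3` and a line bundle `I` on `X`. -/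
structure BundlePair where
  /-- the vector bundle of rank `3` -/
  V : X.Modules
  /-- the line bundle -/
  I : X.Modules
  isVectorBundle : IsVectorBundle V 3
  isLineBundle : IsVectorBundle I 1

/-- A quadratic form on `V` with values in `I`. -/
structure QuadForm (P : BundlePair X) where
  /-- the quadratic form on sections -/
  form : ∀ U : X.Opens, QuadraticMap Γ(X, U) Γ(P.V, U) Γ(P.I, U)
  form_res : ∀ {U W : X.Opens} (h : W ≤ U) (x : Γ(P.V, U)),
    form W (secRes P.V h x) = secRes P.I h (form U x)

variable {P P' P'' : BundlePair X}

/-- Sections of the algebra bundle `C₀(V, q, I)` over an affine open set `U`. -/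
noncomputable abbrev EvenSec (q : QuadForm P) (U : X.affineOpens) :
    Subalgebra Γ(X, U.1) (GenClifford (evalPair P.I U.1) (q.form U.1)) :=
  GenClifford.C0 (evalPair P.I U.1) (q.form U.1)

/-- Restriction of sections of `C₀(V, q, I)`. -/
noncomputable def evenRes (q : QuadForm P) {U W : X.affineOpens} (h : W ≤ U) :
    EvenSec q U →+* EvenSec q W :=
  GenClifford.mapC0 (secRes P.V h) (secRes P.I h) (dualRes P.I h) (fun x => q.form_res h x)
    (fun a δ => evalPair_res P.I h a δ)

/-- Sections of the vector bundle `Λ²(V) ⊗ I⁻¹` over an affine open set `U`. -/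
abbrev LamSec (P : BundlePair X) (U : X.affineOpens) : Type u :=
  ⋀[Γ(X, U.1)]^2 Γ(P.V, U.1) ⊗[Γ(X, U.1)] DualSec P.I U.1

/-- Restriction of sections of `Λ²(V) ⊗ I⁻¹`. -/
noncomputable def lamRes (P : BundlePair X) {U W : X.affineOpens} (h : W ≤ U) :
    LamSec P U →ₛₗ[res (X := X) (U := U.1) (W := W.1) h] LamSec P W :=
  lamMap (secRes P.V h) (dualRes P.I h)

/-- Isomorphisms of algebra bundles `C₀(V, q, I) ≅ C₀(V', q', I')`: isomorphisms of algebras of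
sections over all affine open sets, compatible with restriction. -/
@[ext]
structure EvenIso (q : QuadForm P) (q' : QuadForm P') where
  /-- the isomorphism on sections over an affine open set -/
  app : ∀ U : X.affineOpens, EvenSec q U ≃ₐ[Γ(X, U.1)] EvenSec q' U
  app_res : ∀ {U W : X.affineOpens} (h : W ≤ U) (c : EvenSec q U),
    app W (evenRes q h c) = evenRes q' h (app U c)

/-- Isomorphisms of vector bundles `Λ²(V) ⊗ I⁻¹ ≅ Λ²(V') ⊗ I'⁻¹`: isomorphisms of modules of
sections over all affine open sets, compatible with restriction. -/
@[ext]
structure LamIso (P P' : BundlePair X) where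
  /-- the isomorphism on sections over an affine open set -/
  app : ∀ U : X.affineOpens, LamSec P U ≃ₗ[Γ(X, U.1)] LamSec P' U
  app_res : ∀ {U W : X.affineOpens} (h : W ≤ U) (t : LamSec P U),
    app W (lamRes P h t) = lamRes P' h (app U t)

/-- The identity. -/
noncomputable def EvenIso.refl (q : QuadForm P) : EvenIso q q := ⟨fun _ => AlgEquiv.refl, fun _ _ => rfl⟩

/-- Composition: first `φ`, then `χ`. -/
noncomputable def EvenIso.trans {q : QuadForm P} {q' : QuadForm P'} {q'' : QuadForm P''} (φ : EvenIso q q')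
    (χ : EvenIso q' q'') : EvenIso q q'' :=
  ⟨fun U => (φ.app U).trans (χ.app U), fun {_ W} h c =>
    (congrArg (χ.app W) (φ.app_res h c)).trans (χ.app_res h _)⟩

/-- The inverse. -/
noncomputable def EvenIso.symm {q : QuadForm P} {q' : QuadForm P'} (φ : EvenIso q q') : EvenIso q' q :=
  ⟨fun U => (φ.app U).symm, fun {U W} h c =>
    (φ.app W).injective (((φ.app W).apply_symm_apply _).trans
      ((congrArg (evenRes q' h) ((φ.app U).apply_symm_apply c)).symm.trans
        (φ.app_res h _).symm))⟩

/-- The group `Aut(C₀(V, q, I))`, with `φ * χ = φ ∘ χ`. -/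
noncomputable instance (q : QuadForm P) : Group (EvenIso q q) where
  mul φ χ := χ.trans φ
  one := EvenIso.refl q
  inv φ := φ.symm
  mul_assoc _ _ _ := rfl
  one_mul _ := rfl
  mul_one _ := rfl
  inv_mul_cancel φ := EvenIso.ext (funext fun U => AlgEquiv.self_trans_symm (φ.app U))

/-- The identity. -/
noncomputable def LamIso.refl (P : BundlePair X) : LamIso P P := ⟨fun _ => LinearEquiv.refl _ _, fun _ _ => rfl⟩

/-- Composition: first `f`, then `g`. -/
noncomputable def LamIso.trans (f : LamIso P P') (g : LamIso P' P'') : LamIso P P'' :=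
  ⟨fun U => (f.app U).trans (g.app U), fun {_ W} h c =>
    (congrArg (g.app W) (f.app_res h c)).trans (g.app_res h _)⟩

/-- Bilinear forms on `V|_U` with values in `I|_U`, for `U` affine. -/
abbrev BilSec (P : BundlePair X) (U : X.affineOpens) : Type u :=
  Γ(P.V, U.1) →ₗ[Γ(X, U.1)] Γ(P.V, U.1) →ₗ[Γ(X, U.1)] Γ(P.I, U.1)

/-- `q|_U = q_b`. -/
def QuadForm.InducedBy (q : QuadForm P) (U : X.affineOpens) (b : BilSec P U) : Prop :=
  ∀ x, q.form U.1 x = b x x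

/-- `e` is the isomorphism `ψ_b : C₀(V, q_b, I)|_U ≅ (𝒪 ⊕ Λ²(V) ⊗ I⁻¹)|_U`, the restriction
to the elements of degree zero of the Bourbaki map
`ψ_b : C̃(V, q_b, I)|_U → (Λ(V) ⊗ L[I])|_U`. -/
def IsPsi (q : QuadForm P) (U : X.affineOpens) (b : BilSec P U)
    (e : EvenSec q U ≃ₗ[Γ(X, U.1)] Γ(X, U.1) × LamSec P U) : Prop :=
  ∃ hb : q.InducedBy U b, ∀ c : EvenSec q U,
    GenClifford.lambdaEv Γ(P.V, U.1) (evalPair P.I U.1) (e c) =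
      GenClifford.psiExt (evalPair P.I U.1) b hb c

/-- Over the affine open set `U`, the isomorphism
`ψ_{b'} ∘ φ ∘ ψ_b⁻¹ : 𝒪 ⊕ Λ²(V) ⊗ I⁻¹ ≅ 𝒪 ⊕ Λ²(V') ⊗ I'⁻¹` induces `f`
from `Λ²(V) ⊗ I⁻¹` to `Λ²(V') ⊗ I'⁻¹`. -/
def IsTransferAt {q : QuadForm P} {q' : QuadForm P'} (φ : EvenIso q q') (f : LamIso P P')
    (U : X.affineOpens) (b : BilSec P U) (b' : BilSec P' U) : Prop :=
  ∀ e e', IsPsi q U b e → IsPsi q' U b' e' → ∀ r ω,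
    (e' (φ.app U (e.symm (r, ω)))).2 = f.app U ω

/-- `f` is induced by `φ`, over every affine open set and for all choices of bilinear forms
inducing `q` and `q'` there. -/
def IsTransfer {q : QuadForm P} {q' : QuadForm P'} (φ : EvenIso q q') (f : LamIso P P') : Prop :=
  ∀ (U : X.affineOpens) (b : BilSec P U) (b' : BilSec P' U), q.InducedBy U b → q'.InducedBy U b' →
    IsTransferAt φ f U b b'

/-- `det f = u`: the automorphism `Λ³(f)` of the determinant `Λ³(Λ²(V) ⊗ I⁻¹)` is multiplication
by the global unit `u`. -/
def IsDet (f : LamIso P P) (u : Γ(X, ⊤)ˣ) : Prop :=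
  ∀ U : X.affineOpens, exteriorPower.map (R := Γ(X, U.1)) (M := LamSec P U) (N := LamSec P U) 3
    (f.app U).toLinearMap = res (le_top : U.1 ≤ ⊤) (u : Γ(X, ⊤)) • LinearMap.id

/-- `Iso'[C₀(V, q, I), C₀(V, q', I)]`: those `φ` for which `det φ_{Λ²}` is a square. -/
def IsoSq (q q' : QuadForm P) : Set (EvenIso q q') :=
  {φ | ∃ f u, IsTransfer φ f ∧ IsDet f u ∧ IsSquare u}

/-- `S-Iso[C₀(V, q, I), C₀(V, q', I)]`: those `φ` for which `det φ_{Λ²} = 1`. -/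
def SIso (q q' : QuadForm P) : Set (EvenIso q q') :=
  {φ | ∃ f, IsTransfer φ f ∧ IsDet f 1}

end Sheaves

end QuadBundle

open AlgebraicGeometry QuadBundle

/-!
Over an affine open set `U`, the sections of the vector bundles `V`, `I` and `I⁻¹` form projective
modules whose restrictions to basic open sets are localizations (`HasFrames.isAway`,
`HasFrames.projective`). So `q` comes from a bilinear form `b` (`exists_bilin`). The Bourbaki map
`ψ_b` preserves degrees and has the inverse `ψ_{-b}`, hence it identifies the even Clifford algebra
with the elements of degree zero in `Λ(V) ⊗ L[I]`. These are `𝒪 ⊕ Λ²(V) ⊗ I⁻¹`, because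
`Λ⁴(V) = 0` (`ιMulti_four_eq_zero`, `toExterior_mem_range`) and because
`𝒪 ⊕ Λ²(V) ⊗ I⁻¹ → Λ(V) ⊗ L[I]` is injective (`lambdaEv_injective`), which is checked after
trivializing `I`.

Since `ψ_b(x y ζ) = ζ(b(x, y)) + (x ∧ y) ⊗ ζ`, the second component of `ψ_b` is the linear
projection `π` of the even Clifford algebra to `Λ²(V) ⊗ I⁻¹` with `π(1) = 0` and
`π(x y ζ) = (x ∧ y) ⊗ ζ` (`GenClifford.IsLamProj`). It does not depend on `b`, is compatible with
restriction, and its kernel is `𝒪 · 1`. An isomorphism `φ` of algebras preserves this kernel,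
so there is a unique `φ_{Λ²}` with `φ_{Λ²} ∘ π = π' ∘ φ` (`transfer`), and functoriality is immediate.

All identities between sections over affine open sets are local, by `eq_zero_of_torsion`: an element
that is torsion with respect to functions whose basic open sets cover is zero. In
particular a morphism is determined on an affine open covering. In the same way, the determinant of
an automorphism of `Λ²(V) ⊗ I⁻¹` is glued from the determinants over the open sets on which this
bundle is free of rank three (`LamIso.exists_det`). It is multiplicative, so `φ ↦ det φ_{Λ²}` is a
homomorphism on the automorphism group (`detHom`), and the two subgroups are its kernel and the
preimage of the squares.
-/

/-! ### Frames of vector bundles -/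

namespace QuadBundle
open CategoryTheory AlgebraicGeometry
open scoped TensorProduct

section Frames

variable {X : Scheme.{u}}

/-- A trivialization `M|_U ≅ 𝒪ⁿ` gives sections over `U` that restrict to a basis over every smaller
open set. -/
theorem IsVectorBundle.exists_frame {M : X.Modules} {n : ℕ} (hM : IsVectorBundle M n) (x : X) :
    ∃ U : X.Opens, x ∈ U ∧ ∃ v : Fin n → Γ(M, U), ∀ {W : X.Opens} (h : W ≤ U),
      Function.Bijective fun c : Fin n → Γ(X, W) => ∑ j, c j • secRes M h (v j) := by
  obtain ⟨U, hx, ⟨e⟩⟩ := hM x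
  refine ⟨U.ι ''ᵁ ⊤, by simpa using hx, ?_⟩
  let N : SheafOfModules (U : Scheme).ringCatSheaf := M.restrict U.ι
  let F : SheafOfModules (U : Scheme).ringCatSheaf := SheafOfModules.free (ULift.{u} (Fin n))
  let e' : N ≅ F := e
  let un : SheafOfModules (U : Scheme).ringCatSheaf := SheafOfModules.unit _
  let ι : ULift.{u} (Fin n) → (un ⟶ F) := fun j => SheafOfModules.ιFree j
  have hext : ∀ {G : SheafOfModules (U : Scheme).ringCatSheaf} (f g : F ⟶ G),
      (∀ j, ι j ≫ f = ι j ≫ g) → f = g := fun f g h =>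
    Limits.Cofan.IsColimit.hom_ext (SheafOfModules.isColimitFreeCofan _) _ _ h
  -- the free sheaf is a biproduct: `p j` are the projections to the inclusions `ι j`
  let p : ULift.{u} (Fin n) → (F ⟶ un) := fun j =>
    Limits.Cofan.IsColimit.desc (SheafOfModules.isColimitFreeCofan _)
      (fun i => if i = j then 𝟙 _ else 0)
  have hp : ∀ i j, ι i ≫ p j = if i = j then 𝟙 _ else 0 := fun i j =>
    Limits.Cofan.IsColimit.fac (SheafOfModules.isColimitFreeCofan _) _ i
  have hs : ∑ j, p j ≫ ι j = 𝟙 F := by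
    refine hext _ _ fun i => ?_
    rw [Preadditive.comp_sum]
    simp only [← Category.assoc, hp]
    rw [Finset.sum_eq_single i]
    · simp
    · intro j _ hj
      rw [if_neg (Ne.symm hj), Limits.zero_comp]
    · simp
  let a : ULift.{u} (Fin n) → (N ⟶ un) := fun j => e'.hom ≫ p j
  let b : ULift.{u} (Fin n) → (un ⟶ N) := fun j => ι j ≫ e'.inv
  have hba : ∀ i j, b i ≫ a j = if i = j then 𝟙 _ else 0 := fun i j => by
    simp only [a, b, Category.assoc, Iso.inv_hom_id_assoc, hp]
  have hab : ∑ j, a j ≫ b j = 𝟙 N := by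
    have := congrArg (fun f => e'.hom ≫ f ≫ e'.inv) hs
    simp only [Preadditive.sum_comp, Preadditive.comp_sum, Category.id_comp,
      Iso.hom_inv_id] at this
    simpa only [a, b, Category.assoc] using this
  -- coordinates and inclusions of sections, for `M` in place of the free sheaf
  let A (W : (U : Scheme).Opens) (j : ULift.{u} (Fin n)) :
      Γ(M, U.ι ''ᵁ W) → Γ(X, U.ι ''ᵁ W) := fun s => ((a j).val.app (Opposite.op W)).hom s
  let B (W : (U : Scheme).Opens) (j : ULift.{u} (Fin n)) :
      Γ(X, U.ι ''ᵁ W) → Γ(M, U.ι ''ᵁ W) := fun s => ((b j).val.app (Opposite.op W)).hom s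
  have hBA : ∀ W i j r, A W j (B W i r) = if i = j then r else 0 := fun W i j r => by
    have h1 : A W j (B W i r) = ((b i ≫ a j).val.app (Opposite.op W)).hom r := rfl
    rw [h1, hba]
    split_ifs <;> rfl
  have hAB : ∀ W s, ∑ j, B W j (A W j s) = s := fun W s => by
    let ev : (N ⟶ N) →+ Γ(M, U.ι ''ᵁ W) :=
      { toFun := fun f => (f.val.app (Opposite.op W)).hom s
        map_zero' := rfl
        map_add' := fun _ _ => rfl }
    have h1 := congrArg ev hab
    rw [map_sum] at h1
    exact h1
  have hB : ∀ W j r, B W j r = r • B W j 1 := fun W j r => by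
    have h1 := ((b j).val.app (Opposite.op W)).hom.map_smul r
      (1 : (U : Scheme).ringCatSheaf.obj.obj (Opposite.op W))
    have h2 : B W j r = B W j (r * 1) := by rw [mul_one]
    rw [h2]
    refine Eq.trans h1 ?_
    change (U.ι.appIso W).inv r • B W j 1 = _
    rw [Scheme.Opens.ι_appIso]
    rfl
  have hres : ∀ (W : (U : Scheme).Opens) (h : U.ι ''ᵁ W ≤ U.ι ''ᵁ ⊤) j,
      secRes M h (B ⊤ j 1) = B W j 1 := fun W h j => by
    have h1 := congrArg (fun f => f.hom
      (1 : (U : Scheme).ringCatSheaf.obj.obj (Opposite.op ⊤)))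
      ((b j).val.naturality (homOfLE (le_top : W ≤ ⊤)).op)
    refine Eq.trans h1.symm ?_
    change ((b j).val.app (Opposite.op W)).hom _ = ((b j).val.app (Opposite.op W)).hom _
    congr 1
    exact map_one (X.presheaf.map _).hom
  refine ⟨fun j => B ⊤ ⟨j⟩ 1, fun {W} h => ?_⟩
  obtain ⟨W, rfl⟩ : ∃ W' : (U : Scheme).Opens, W = U.ι ''ᵁ W' :=
    ⟨U.ι ⁻¹ᵁ W, by
      rw [Scheme.Hom.image_preimage_eq_opensRange_inf]
      refine (inf_eq_right.2 (h.trans ?_)).symm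
      simp⟩
  have hA : ∀ j (x y : Γ(M, U.ι ''ᵁ W)), A W j (x + y) = A W j x + A W j y := fun j x y =>
    map_add ((a j).val.app (Opposite.op W)).hom x y
  have key : ∀ c : Fin n → Γ(X, U.ι ''ᵁ W),
      ∑ j, c j • secRes M h (B ⊤ ⟨j⟩ 1) = ∑ j : Fin n, B W ⟨j⟩ (c j) := fun c =>
    Finset.sum_congr rfl fun j _ => by rw [hres, ← hB]
  have hAs : ∀ (c : Fin n → Γ(X, U.ι ''ᵁ W)) i, A W ⟨i⟩ (∑ j : Fin n, B W ⟨j⟩ (c j)) = c i :=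
    fun c i => by
      let Ah : Γ(M, U.ι ''ᵁ W) →+ Γ(X, U.ι ''ᵁ W) := AddMonoidHom.mk' (A W ⟨i⟩) (hA _)
      change Ah _ = _
      rw [map_sum, Finset.sum_eq_single i]
      · exact (hBA _ _ _ _).trans (if_pos rfl)
      · intro j _ hj
        exact (hBA _ _ _ _).trans (if_neg fun h => hj (ULift.up_injective h))
      · simp
  constructor
  · intro c c' hcc
    simp only [key] at hcc
    funext i
    rw [← hAs c i, hcc, hAs]
  · intro s
    refine ⟨fun j => A W ⟨j⟩ s, ?_⟩
    simp only [key]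
    conv_rhs => rw [← hAB W s]
    exact (Equiv.ulift.sum_comp (fun j : Fin n => B W ⟨j⟩ (A W ⟨j⟩ s))).symm

end Frames

end QuadBundle

/-! ### Sheaves of modules and the dual of a line bundle -/

namespace QuadBundle
open CategoryTheory AlgebraicGeometry
open scoped TensorProduct

section Sheaf

variable {X : Scheme.{u}}

theorem res_self {U : X.Opens} (h : U ≤ U) (r : Γ(X, U)) : res h r = r :=
  congrArg (fun f => f.hom r) (X.presheaf.map_id (Opposite.op U))

theorem res_sep {ι : Type u} {U : ι → X.Opens} {V : X.Opens} (h : ∀ i, U i ≤ V)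
    (hc : V ≤ ⨆ i, U i) {r s : Γ(X, V)} (hr : ∀ i, res (h i) r = res (h i) s) : r = s :=
  X.sheaf.eq_of_locally_eq' U V (fun i => homOfLE (h i)) hc r s hr

theorem res_glue {ι : Type u} {U : ι → X.Opens} {V : X.Opens} (h : ∀ i, U i ≤ V)
    (hc : V ≤ ⨆ i, U i) (s : ∀ i, Γ(X, U i))
    (hs : ∀ i j, res (inf_le_left : U i ⊓ U j ≤ U i) (s i) = res inf_le_right (s j)) :
    ∃ t : Γ(X, V), ∀ i, res (h i) t = s i :=
  (X.sheaf.existsUnique_gluing' U V (fun i => homOfLE (h i)) hc s hs).exists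

variable {F : X.Opens → Type u} [∀ U, AddCommGroup (F U)] [∀ U, Module Γ(X, U) (F U)]

/-- The sheaf axioms for a family of modules `F U` over the rings `Γ(X, U)` with restriction
maps `ρ`. -/
structure IsModSheaf (ρ : ∀ ⦃U W : X.Opens⦄ (h : W ≤ U), F U →ₛₗ[res h] F W) : Prop where
  trans : ∀ {U W Z : X.Opens} (h : W ≤ U) (h' : Z ≤ W) (s : F U),
    ρ h' (ρ h s) = ρ (h'.trans h) s
  sep : ∀ {ι : Type u} {U : ι → X.Opens} {V : X.Opens} (h : ∀ i, U i ≤ V) (_ : V ≤ ⨆ i, U i)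
    (s : F V), (∀ i, ρ (h i) s = 0) → s = 0
  glue : ∀ {ι : Type u} {U : ι → X.Opens} {V : X.Opens} (h : ∀ i, U i ≤ V) (_ : V ≤ ⨆ i, U i)
    (s : ∀ i, F (U i)),
    (∀ i j, ρ (inf_le_left : U i ⊓ U j ≤ U i) (s i) = ρ inf_le_right (s j)) →
    ∃ t : F V, ∀ i, ρ (h i) t = s i

/-- A family of sections over `U` whose restrictions to every smaller open set form a basis. -/
def IsFrame (ρ : ∀ ⦃U W : X.Opens⦄ (h : W ≤ U), F U →ₛₗ[res h] F W) {n : ℕ} {U : X.Opens}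
    (v : Fin n → F U) : Prop :=
  ∀ ⦃W : X.Opens⦄ (h : W ≤ U),
    Function.Bijective fun c : Fin n → Γ(X, W) => ∑ j, c j • ρ h (v j)

variable {ρ : ∀ ⦃U W : X.Opens⦄ (h : W ≤ U), F U →ₛₗ[res h] F W}

namespace IsFrame

variable {n : ℕ} {U : X.Opens} {v : Fin n → F U}

/-- The basis of `F W` given by the restriction of a frame. -/
noncomputable def basis (hv : IsFrame ρ v) {W : X.Opens} (h : W ≤ U) :
    Module.Basis (Fin n) Γ(X, W) (F W) :=
  Module.Basis.ofEquivFun (LinearEquiv.ofBijective (Fintype.linearCombination Γ(X, W)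
    (fun j => ρ h (v j))) (by
      have := hv h
      convert this using 1
      funext c
      exact Fintype.linearCombination_apply _ _ _)).symm

theorem basis_apply (hv : IsFrame ρ v) {W : X.Opens} (h : W ≤ U) (j : Fin n) :
    hv.basis h j = ρ h (v j) := by
  simp [basis, Fintype.linearCombination_apply, Pi.single_apply, ite_smul]

/-- Coordinates with respect to a frame commute with restriction. -/
theorem basis_repr_res (hρ : IsModSheaf ρ) (hv : IsFrame ρ v) {W Z : X.Opens} (h : W ≤ U)
    (h' : Z ≤ W) (s : F W) (j : Fin n) :
    (hv.basis (h'.trans h)).repr (ρ h' s) j = res h' ((hv.basis h).repr s j) := by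
  have h1 : ρ h' s = ∑ j, res h' ((hv.basis h).repr s j) • hv.basis (h'.trans h) j := by
    conv_lhs => rw [← (hv.basis h).sum_repr s]
    rw [map_sum]
    refine Finset.sum_congr rfl fun j _ => ?_
    rw [LinearMap.map_smulₛₗ, basis_apply, basis_apply, hρ.trans]
  rw [h1]
  exact congrFun ((hv.basis (h'.trans h)).repr_sum_self _) j

theorem restrict (hρ : IsModSheaf ρ) (hv : IsFrame ρ v) {W : X.Opens} (h : W ≤ U) :
    IsFrame ρ (fun j => ρ h (v j)) := fun Z hZ => by
  simp only [hρ.trans]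
  exact hv _

end IsFrame

theorem secRes_isModSheaf (M : X.Modules) : IsModSheaf (@secRes X M) where
  trans h h' s :=
    (congrArg (fun f => f.hom s) (M.presheaf.map_comp (homOfLE h).op (homOfLE h').op)).symm
  sep {ι U V} h hc s hs := by
    refine TopCat.Sheaf.eq_of_locally_eq' ⟨M.presheaf, M.isSheaf⟩ U V (fun i => homOfLE (h i)) hc
      s 0 fun i => (hs i).trans (map_zero _).symm
  glue {ι U V} h hc s hs :=
    (TopCat.Sheaf.existsUnique_gluing' ⟨M.presheaf, M.isSheaf⟩ U V (fun i => homOfLE (h i)) hc s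
      fun i j => hs i j).exists

section Dual

variable (I : X.Modules)

theorem dualRes_apply {U W : X.Opens} (h : W ≤ U) (f : DualSec I U) (Z : {Z : X.Opens // Z ≤ W}) :
    (dualRes I h f).1 Z = f.1 ⟨Z.1, Z.2.trans h⟩ := rfl

theorem dual_smul_apply {U : X.Opens} (r : Γ(X, U)) (f : DualSec I U)
    (Z : {Z : X.Opens // Z ≤ U}) (s : Γ(I, Z.1)) : (r • f).1 Z s = res Z.2 r * f.1 Z s := rfl

theorem dual_ext {U : X.Opens} {f g : DualSec I U} (h : ∀ Z s, f.1 Z s = g.1 Z s) : f = g :=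
  Subtype.ext (funext fun Z => LinearMap.ext (h Z))

/-- Sections of `I⁻¹` glue: the values of the glued morphism on a section `s` of `I` are glued from
the values on restrictions of `s`. -/
theorem dual_glue {ι : Type u} {U : ι → X.Opens} {V : X.Opens} (h : ∀ i, U i ≤ V)
    (hc : V ≤ ⨆ i, U i) (f : ∀ i, DualSec I (U i))
    (hf : ∀ i j, dualRes I (inf_le_left : U i ⊓ U j ≤ U i) (f i) = dualRes I inf_le_right (f j)) :
    ∃ t : DualSec I V, ∀ i, dualRes I (h i) t = f i := by
  have hI := secRes_isModSheaf I
  have hcov : ∀ {W : X.Opens}, W ≤ V → W ≤ ⨆ i, W ⊓ U i := fun {W} hW => by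
    rw [← inf_iSup_eq]; exact le_inf le_rfl (hW.trans hc)
  have hle : ∀ (W : X.Opens) i, W ⊓ U i ≤ W := fun W i => inf_le_left
  have hval : ∀ {i j} (Z : X.Opens) (hi : Z ≤ U i) (hj : Z ≤ U j) (s : Γ(I, Z)),
      (f i).1 ⟨Z, hi⟩ s = (f j).1 ⟨Z, hj⟩ s := fun {i j} Z hi hj s =>
    congrArg (fun F : DualSec I (U i ⊓ U j) => F.1 ⟨Z, le_inf hi hj⟩ s) (hf i j)
  have key : ∀ (W : {W : X.Opens // W ≤ V}) (s : Γ(I, W.1)), ∃ t : Γ(X, W.1), ∀ i,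
      res (hle W.1 i) t = (f i).1 ⟨W.1 ⊓ U i, inf_le_right⟩ (secRes I (hle W.1 i) s) := by
    intro W s
    refine res_glue (hle W.1) (hcov W.2) _ fun i j => ?_
    rw [← (f i).2 ⟨W.1 ⊓ U i, inf_le_right⟩ ⟨W.1 ⊓ U i ⊓ (W.1 ⊓ U j), inf_le_left.trans inf_le_right⟩
        inf_le_left,
      ← (f j).2 ⟨W.1 ⊓ U j, inf_le_right⟩
        ⟨W.1 ⊓ U i ⊓ (W.1 ⊓ U j), inf_le_right.trans inf_le_right⟩ inf_le_right,
      hI.trans, hI.trans]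
    exact hval _ _ _ _
  choose T hT using key
  have hTu : ∀ (W : {W : X.Opens // W ≤ V}) (s : Γ(I, W.1)) (t : Γ(X, W.1)), (∀ i,
      res (hle W.1 i) t = (f i).1 ⟨W.1 ⊓ U i, inf_le_right⟩ (secRes I (hle W.1 i) s)) →
      T W s = t := fun W s t ht => res_sep (hle W.1) (hcov W.2) fun i => by rw [hT, ht]
  refine ⟨⟨fun W =>
    { toFun := T W
      map_add' := fun x y => hTu _ _ _ fun i => by rw [map_add, map_add, map_add, hT, hT]
      map_smul' := fun r x => hTu _ _ _ fun i => by
        have e : secRes I (hle W.1 i) (r • x) = res (hle W.1 i) r • secRes I (hle W.1 i) x :=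
          LinearMap.map_smulₛₗ _ _ _
        rw [e]
        have e' := LinearMap.map_smul ((f i).1 ⟨W.1 ⊓ U i, inf_le_right⟩) (res (hle W.1 i) r)
          (secRes I (hle W.1 i) x)
        refine Eq.trans ?_ e'.symm
        rw [← hT]
        exact map_mul _ _ _ }, ?_⟩, ?_⟩
  · intro W Z hZ x
    refine hTu _ _ _ fun i => ?_
    have e : Z.1 ⊓ U i ≤ W.1 ⊓ U i := inf_le_inf_right _ hZ
    rw [res_res, hI.trans, ← res_res (hle W.1 i) e]
    change res e (res _ (T W x)) = _
    rw [hT, ← (f i).2 ⟨W.1 ⊓ U i, inf_le_right⟩ ⟨Z.1 ⊓ U i, inf_le_right⟩ e, hI.trans]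
  · intro i
    refine dual_ext I fun Z s => hTu _ _ _ fun j => ?_
    rw [← (f i).2 Z ⟨Z.1 ⊓ U j, inf_le_left.trans Z.2⟩ inf_le_left]
    exact hval _ _ _ _

theorem dualRes_isModSheaf : IsModSheaf (@dualRes X I) where
  trans h h' s := rfl
  sep {ι U V} h hc f hf := dual_ext I fun Z s => by
    refine res_sep (fun i => (inf_le_left : Z.1 ⊓ U i ≤ Z.1)) ?_ fun i => ?_
    · rw [← inf_iSup_eq]; exact le_inf le_rfl (Z.2.trans hc)
    · have := congrArg (fun F : DualSec I (U i) =>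
        F.1 ⟨Z.1 ⊓ U i, inf_le_right⟩ (secRes I inf_le_left s)) (hf i)
      rw [← f.2 Z ⟨Z.1 ⊓ U i, inf_le_left.trans Z.2⟩ inf_le_left]
      refine Eq.trans this ?_
      exact (map_zero (res _)).symm
  glue := dual_glue I

/-- The frame of `I⁻¹` dual to a frame of `I`. -/
noncomputable def dualFrame {I : X.Modules} {U : X.Opens} {i₀ : Fin 1 → Γ(I, U)}
    (hi : IsFrame (@secRes X I) i₀) : DualSec I U :=
  ⟨fun W => (hi.basis W.2).coord 0, fun W _ h s =>
    hi.basis_repr_res (secRes_isModSheaf I) W.2 h s 0⟩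

theorem dualFrame_apply {I : X.Modules} {U : X.Opens} {i₀ : Fin 1 → Γ(I, U)}
    (hi : IsFrame (@secRes X I) i₀) {W : X.Opens} (h : W ≤ U) :
    (dualFrame hi).1 ⟨W, h⟩ (secRes I h (i₀ 0)) = 1 := by
  have := hi.basis_apply h 0
  rw [← this]
  exact (hi.basis h).repr_self_apply 0 0 |>.trans (if_pos rfl)

theorem dualFrame_isFrame {I : X.Modules} {U : X.Opens} {i₀ : Fin 1 → Γ(I, U)}
    (hi : IsFrame (@secRes X I) i₀) : IsFrame (@dualRes X I) (fun _ : Fin 1 => dualFrame hi) := by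
  intro W h
  constructor
  · have e : ∀ c : Γ(X, W), (c • dualRes I h (dualFrame hi)).1 ⟨W, le_rfl⟩ (secRes I h (i₀ 0)) =
        c := fun c => by
      refine (dual_smul_apply I c _ _ _).trans ?_
      rw [res_self]
      refine (congrArg (c * ·) (dualFrame_apply hi h)).trans (mul_one c)
    intro c c' hcc
    funext j
    simp only [Fin.sum_univ_one] at hcc
    rw [Subsingleton.elim j 0, ← e (c 0), hcc, e]
  · intro δ
    refine ⟨fun _ => δ.1 ⟨W, le_rfl⟩ (secRes I h (i₀ 0)), dual_ext I fun Z s => ?_⟩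
    simp only [Fin.sum_univ_one, dual_smul_apply, dualRes_apply]
    rw [← δ.2 ⟨W, le_rfl⟩ Z Z.2, (secRes_isModSheaf I).trans]
    conv_rhs => rw [← (hi.basis (Z.2.trans h)).sum_repr s, Fin.sum_univ_one, map_smul,
      hi.basis_apply, smul_eq_mul]
    exact mul_comm _ _

end Dual

end Sheaf
end QuadBundle

/-! ### Sections over affine open sets and localization -/

namespace QuadBundle
open CategoryTheory AlgebraicGeometry
open scoped TensorProduct

section Away

variable {R B : Type u} [CommRing R] [CommRing B] {σ : R →+* B}
variable {M N : Type u} [AddCommGroup M] [Module R M] [AddCommGroup N] [Module B N]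

/-- The semilinear map `ℓ : M → N` exhibits `N` as the localization of `M` at the powers
of `f`. -/
structure IsAway (f : R) (ℓ : M →ₛₗ[σ] N) : Prop where
  isUnit : IsUnit (σ f)
  torsion : ∀ m, ℓ m = 0 → ∃ n : ℕ, f ^ n • m = 0
  surj : ∀ y, ∃ (n : ℕ) (x : M), σ f ^ n • y = ℓ x

end Away

section Sheaf

variable {X : Scheme.{u}}

theorem res_torsion {U W : X.Opens} (hU : IsAffineOpen U) (f : Γ(X, U)) (h : W ≤ U)
    (hW : W = X.basicOpen f) {r : Γ(X, U)} (hr : res h r = 0) : ∃ n : ℕ, f ^ n * r = 0 := by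
  let _ := (res h).toAlgebra
  have : IsLocalization.Away f Γ(X, W) := hU.isLocalization_of_eq_basicOpen f (homOfLE h) hW
  have h1 : algebraMap Γ(X, U) Γ(X, W) r = algebraMap Γ(X, U) Γ(X, W) 0 := by rw [map_zero]; exact hr
  obtain ⟨⟨_, n, rfl⟩, hn⟩ := (IsLocalization.eq_iff_exists (Submonoid.powers f) _).1 h1
  exact ⟨n, by simpa using hn⟩

theorem res_surj {U W : X.Opens} (hU : IsAffineOpen U) (f : Γ(X, U)) (h : W ≤ U)
    (hW : W = X.basicOpen f) (y : Γ(X, W)) :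
    ∃ (n : ℕ) (x : Γ(X, U)), res h f ^ n * y = res h x := by
  let _ := (res h).toAlgebra
  have : IsLocalization.Away f Γ(X, W) := hU.isLocalization_of_eq_basicOpen f (homOfLE h) hW
  obtain ⟨⟨x, ⟨_, n, rfl⟩⟩, hn⟩ := IsLocalization.surj (Submonoid.powers f) y
  refine ⟨n, x, Eq.trans ?_ hn⟩
  rw [mul_comm, ← map_pow]
  rfl

theorem res_isUnit {U W : X.Opens} (f : Γ(X, U)) (h : W ≤ U)
    (hW : W = X.basicOpen f) : IsUnit (res h f) := by
  subst hW
  exact RingedSpace.isUnit_res_basicOpen X.toRingedSpace f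

theorem inf_eq_basicOpen_res {U V W : X.Opens} (f : Γ(X, U)) (hW : W = X.basicOpen f) (h : V ≤ U) :
    V ⊓ W = X.basicOpen (res h f) := by
  rw [hW]; exact (X.basicOpen_res f (homOfLE h).op).symm

/-- Finitely many exponents have a common upper bound. -/
theorem exists_pow_common {ι : Type*} [Finite ι] {p : ι → ℕ → Prop}
    (h : ∀ i, ∃ n, p i n) (hp : ∀ i m n, m ≤ n → p i m → p i n) : ∃ n, ∀ i, p i n := by
  cases nonempty_fintype ι
  choose n hn using h
  exact ⟨Finset.univ.sup n, fun i => hp i _ _ (Finset.le_sup (Finset.mem_univ i)) (hn i)⟩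

theorem pow_smul_zero_mono {R M : Type*} [CommRing R] [AddCommGroup M] [Module R M] {f : R}
    {x : M} {m n : ℕ} (h : m ≤ n) (hx : f ^ m • x = 0) : f ^ n • x = 0 := by
  rw [← Nat.sub_add_cancel h, pow_add, mul_smul, hx, smul_zero]

variable {F : X.Opens → Type u} [∀ U, AddCommGroup (F U)] [∀ U, Module Γ(X, U) (F U)]
variable {ρ : ∀ ⦃U W : X.Opens⦄ (h : W ≤ U), F U →ₛₗ[res h] F W}

/-- For a free sheaf of modules this is the corresponding fact about functions, in coordinates. -/
theorem IsFrame.isAway (hρ : IsModSheaf ρ) {n : ℕ} {U : X.Opens} (hU : IsAffineOpen U)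
    {v : Fin n → F U} (hv : IsFrame ρ v) {W : X.Opens} (f : Γ(X, U)) (h : W ≤ U)
    (hW : W = X.basicOpen f) : IsAway f (ρ h) where
  isUnit := res_isUnit f h hW
  torsion s hs := by
    have h1 : ∀ j, ∃ k : ℕ, f ^ k • (hv.basis le_rfl).repr s j = 0 := fun j => by
      refine res_torsion hU f h hW ?_
      rw [← hv.basis_repr_res hρ le_rfl h, hs, map_zero, Finsupp.zero_apply]
    obtain ⟨k, hk⟩ := exists_pow_common h1 fun j a b hab ha =>
      pow_smul_zero_mono (M := Γ(X, U)) hab ha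
    refine ⟨k, (hv.basis le_rfl).repr.injective (Finsupp.ext fun j => ?_)⟩
    rw [map_smul, map_zero, Finsupp.smul_apply, hk, Finsupp.zero_apply]
  surj y := by
    have h1 : ∀ j, ∃ k x, res h f ^ k * (hv.basis h).repr y j = res h x := fun j =>
      res_surj hU f h hW _
    obtain ⟨k, hk⟩ := exists_pow_common h1 fun j a b hab ⟨x, hx⟩ =>
      ⟨f ^ (b - a) * x, by
        rw [map_mul, map_pow, ← hx, ← mul_assoc, ← pow_add, Nat.sub_add_cancel hab]⟩
    choose x hx using hk
    refine ⟨k, ∑ j, x j • v j, ?_⟩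
    conv_lhs => rw [← (hv.basis h).sum_repr y]
    rw [map_sum, Finset.smul_sum]
    refine Finset.sum_congr rfl fun j _ => ?_
    rw [LinearMap.map_smulₛₗ, ← hx, mul_smul, hv.basis_apply]

/-- Existence of local frames of rank `n`. -/
def HasFrames (ρ : ∀ ⦃U W : X.Opens⦄ (h : W ≤ U), F U →ₛₗ[res h] F W) (n : ℕ) : Prop :=
  ∀ x : X, ∃ U : X.Opens, x ∈ U ∧ ∃ v : Fin n → F U, IsFrame ρ v

theorem HasFrames.exists_basicOpen (hρ : IsModSheaf ρ) {n : ℕ} (hF : HasFrames ρ n) {U : X.Opens}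
    (hU : IsAffineOpen U) {x : X} (hx : x ∈ U) :
    ∃ g : Γ(X, U), x ∈ X.basicOpen g ∧ ∃ v : Fin n → F (X.basicOpen g), IsFrame ρ v := by
  obtain ⟨O, hxO, v, hv⟩ := hF x
  obtain ⟨g, hg, hxg⟩ := hU.exists_basicOpen_le (V := O) ⟨x, hxO⟩ hx
  exact ⟨g, hxg, _, hv.restrict hρ hg⟩

theorem HasFrames.exists_finset (hρ : IsModSheaf ρ) {n : ℕ} (hF : HasFrames ρ n) {U : X.Opens}
    (hU : IsAffineOpen U) :
    ∃ t : Finset Γ(X, U), U ≤ ⨆ g : t, X.basicOpen (g : Γ(X, U)) ∧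
      ∀ g : t, ∃ v : Fin n → F (X.basicOpen (g : Γ(X, U))), IsFrame ρ v := by
  let S : Set Γ(X, U) := {g | ∃ v : Fin n → F (X.basicOpen g), IsFrame ρ v}
  have hS : Ideal.span S = ⊤ := by
    rw [← hU.self_le_iSup_basicOpen_iff]
    intro x hx
    obtain ⟨g, hxg, hv⟩ := hF.exists_basicOpen hρ hU hx
    exact TopologicalSpace.Opens.mem_iSup.2 ⟨⟨g, hv⟩, hxg⟩
  obtain ⟨t, ht, ht'⟩ := (Ideal.span_eq_top_iff_finite _).1 hS
  refine ⟨t, ?_, fun g => ht g.2⟩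
  exact (hU.self_le_iSup_basicOpen_iff (s := (t : Set Γ(X, U)))).2 ht'

/-- A sheaf of modules with local frames is quasi-coherent: over an affine open set, restriction
to a basic open set is a localization. -/
theorem HasFrames.isAway (hρ : IsModSheaf ρ) {n : ℕ} (hF : HasFrames ρ n) {U : X.Opens}
    (hU : IsAffineOpen U) {W : X.Opens} (f : Γ(X, U)) (h : W ≤ U) (hW : W = X.basicOpen f) :
    IsAway f (ρ h) := by
  obtain ⟨t, ht, hv⟩ := hF.exists_finset hρ hU
  choose v hv using hv
  let D : t → X.Opens := fun g => X.basicOpen (g : Γ(X, U))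
  have hD : ∀ g, D g ≤ U := fun g => X.basicOpen_le _
  have hDa : ∀ g, IsAffineOpen (D g) := fun g => hU.basicOpen _
  -- local injectivity up to torsion, over any affine open set with a frame
  have tors : ∀ (Z : X.Opens) (hZ : Z ≤ U) (_ : IsAffineOpen Z) (w : Fin n → F Z)
      (_ : IsFrame ρ w) (s : F Z), ρ (inf_le_left : Z ⊓ W ≤ Z) s = 0 →
      ∃ k : ℕ, (res hZ f) ^ k • s = 0 := fun Z hZ hZa w hw s hs =>
    (hw.isAway hρ hZa (res hZ f) inf_le_left (inf_eq_basicOpen_res f hW hZ)).torsion s hs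
  have zero : ∀ s : F U, (∀ g, ρ (hD g) s = 0) → s = 0 := hρ.sep hD ht
  refine ⟨res_isUnit f h hW, ?_, ?_⟩
  · intro s hs
    have h1 : ∀ g, ∃ k : ℕ, (res (hD g) f) ^ k • ρ (hD g) s = 0 := fun g => by
      refine tors _ _ (hDa g) _ (hv g) _ ?_
      rw [hρ.trans, ← hρ.trans h inf_le_right, hs, map_zero]
    obtain ⟨k, hk⟩ := exists_pow_common h1 fun j a b hab ha =>
      pow_smul_zero_mono hab ha
    refine ⟨k, zero _ fun g => ?_⟩
    rw [LinearMap.map_smulₛₗ, map_pow, hk]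
  · intro y
    have h1 : ∀ g, ∃ (k : ℕ) (x : F (D g)),
        (res (inf_le_left : D g ⊓ W ≤ D g) (res (hD g) f)) ^ k • ρ inf_le_right y =
          ρ (inf_le_left : D g ⊓ W ≤ D g) x := fun g =>
      ((hv g).isAway hρ (hDa g) (res (hD g) f) inf_le_left
        (inf_eq_basicOpen_res f hW (hD g))).surj _
    obtain ⟨k, hk⟩ := exists_pow_common h1 fun g a b hab ⟨x, hx⟩ =>
      ⟨res (hD g) f ^ (b - a) • x, by
        rw [LinearMap.map_smulₛₗ, ← hx, map_pow, smul_smul, ← pow_add, Nat.sub_add_cancel hab]⟩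
    choose x hx using hk
    -- the local lifts `x g` of `f ^ k • y` agree on overlaps up to `f`-torsion
    have h2 : ∀ p : t × t, ∃ m : ℕ, (res (inf_le_left.trans (hD p.1) : D p.1 ⊓ D p.2 ≤ U) f) ^ m •
        (ρ (inf_le_left : D p.1 ⊓ D p.2 ≤ D p.1) (x p.1) - ρ inf_le_right (x p.2)) = 0 := by
      rintro ⟨a, b⟩
      refine tors _ _ ?_ _ ((hv a).restrict hρ inf_le_left) _ ?_
      · have : D a ⊓ D b = X.basicOpen ((a : Γ(X, U)) * (b : Γ(X, U))) := (X.basicOpen_mul _ _).symm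
        rw [this]
        exact hU.basicOpen _
      · have e1 := congrArg (ρ (inf_le_inf_right W inf_le_left : D a ⊓ D b ⊓ W ≤ D a ⊓ W)) (hx a)
        have e2 := congrArg (ρ (inf_le_inf_right W inf_le_right : D a ⊓ D b ⊓ W ≤ D b ⊓ W)) (hx b)
        simp only [LinearMap.map_smulₛₗ, map_pow, res_res, hρ.trans] at e1 e2
        rw [map_sub, hρ.trans, hρ.trans, ← e1, ← e2, sub_self]
    obtain ⟨m, hm⟩ := exists_pow_common h2 fun j a b hab ha =>
      pow_smul_zero_mono hab ha
    obtain ⟨s, hs⟩ := hρ.glue hD ht (fun g => res (hD g) f ^ m • x g) fun a b => by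
      have := hm (a, b)
      rw [smul_sub, sub_eq_zero] at this
      simpa only [LinearMap.map_smulₛₗ, map_pow, res_res] using this
    refine ⟨m + k, s, ?_⟩
    have hc : W ≤ ⨆ g, D g ⊓ W := by
      rw [← iSup_inf_eq]; exact le_inf (h.trans ht) le_rfl
    refine sub_eq_zero.1 (hρ.sep (fun g => (inf_le_right : D g ⊓ W ≤ W)) hc _ fun g => ?_)
    have e3 := congrArg (ρ (inf_le_left : D g ⊓ W ≤ D g)) (hs g)
    rw [LinearMap.map_smulₛₗ, ← hx, hρ.trans] at e3
    rw [map_sub, hρ.trans, LinearMap.map_smulₛₗ, e3, smul_smul]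
    simp only [map_pow, res_res, ← pow_add, sub_self]

end Sheaf
end QuadBundle

/-! ### Exterior powers and tensor products of localizations -/

namespace QuadBundle
open CategoryTheory AlgebraicGeometry
open scoped TensorProduct

section Away

variable {R B : Type u} [CommRing R] [CommRing B] {σ : R →+* B}
variable {M N : Type u} [AddCommGroup M] [Module R M] [AddCommGroup N] [Module B N]

/-- The ring homomorphism `σ : R → B` exhibits `B` as the localization of `R` at the powers
of `f`. -/
def IsRingAway (σ : R →+* B) (f : R) : Prop :=
  @IsLocalization.Away R _ f B _ σ.toAlgebra

theorem IsRingAway.surj {f : R} (h : IsRingAway σ f) (b : B) :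
    ∃ (n : ℕ) (r : R), σ f ^ n * b = σ r := by
  let _ := σ.toAlgebra
  have : IsLocalization.Away f B := h
  obtain ⟨⟨x, ⟨_, n, rfl⟩⟩, hn⟩ := IsLocalization.surj (Submonoid.powers f) b
  refine ⟨n, x, Eq.trans ?_ hn⟩
  rw [mul_comm, ← map_pow]
  rfl

theorem isLocalizedModule_iff_isAway [Algebra R B] [Module R N] [IsScalarTower R B N] {f : R}
    (hB : IsLocalization.Away f B) (ℓ : M →ₗ[R] N) (ℓ' : M →ₛₗ[algebraMap R B] N)
    (h : ∀ m, ℓ m = ℓ' m) : IsLocalizedModule (Submonoid.powers f) ℓ ↔ IsAway f ℓ' := by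
  constructor
  · intro hl
    refine ⟨IsLocalization.Away.algebraMap_isUnit f, fun m hm => ?_, fun y => ?_⟩
    · rw [← h, IsLocalizedModule.eq_zero_iff (Submonoid.powers f) ℓ] at hm
      obtain ⟨⟨_, n, rfl⟩, hn⟩ := hm
      exact ⟨n, hn⟩
    · obtain ⟨⟨x, ⟨_, n, rfl⟩⟩, hn⟩ := IsLocalizedModule.surj (Submonoid.powers f) ℓ y
      refine ⟨n, x, ?_⟩
      rw [← h, ← hn, ← map_pow, algebraMap_smul]
      rfl
  · intro hl
    refine IsLocalizedModule.Away.mk_of_addCommGroup ?_ (fun y => ?_) fun x hx => ?_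
    · have := (IsLocalization.Away.algebraMap_isUnit (S := B) f).map
        (Algebra.lsmul R R N)
      convert this using 1
      ext n
      simp
    · obtain ⟨n, x, hx⟩ := hl.surj y
      exact ⟨n, x, by rw [h, ← hx, ← map_pow, algebraMap_smul]⟩
    · exact hl.torsion x ((h x).symm.trans hx)

variable (ℓ : M →ₛₗ[σ] N)

/-- The surjectivity condition of `IsAway` has to be checked on generators only. -/
theorem exists_smul_eq_of_span {f : R} (hσ : IsRingAway σ f) {S : Set N}
    (hS : Submodule.span B S = ⊤) (h : ∀ s ∈ S, ∃ (n : ℕ) (x : M), σ f ^ n • s = ℓ x) (y : N) :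
    ∃ (n : ℕ) (x : M), σ f ^ n • y = ℓ x := by
  have hy : y ∈ Submodule.span B S := hS ▸ Submodule.mem_top
  induction hy using Submodule.span_induction with
  | mem s hs => exact h s hs
  | zero => exact ⟨0, 0, by simp⟩
  | add a b _ _ ha hb =>
    obtain ⟨m, x, hx⟩ := ha
    obtain ⟨n, y, hy⟩ := hb
    refine ⟨m + n, f ^ n • x + f ^ m • y, ?_⟩
    rw [map_add, LinearMap.map_smulₛₗ, LinearMap.map_smulₛₗ, ← hx, ← hy, smul_add, smul_smul,
      smul_smul, map_pow, map_pow, ← pow_add, ← pow_add, add_comm n m]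
  | smul b a _ ha =>
    obtain ⟨m, x, hx⟩ := ha
    obtain ⟨n, r, hr⟩ := hσ.surj b
    refine ⟨m + n, r • x, ?_⟩
    rw [LinearMap.map_smulₛₗ, ← hx, ← hr, smul_smul, smul_smul, pow_add]
    congr 1; ring

/-- The semilinear map `Λⁿ(M) → Λⁿ(N)` induced by a semilinear map `M → N`. -/
noncomputable def extMap (n : ℕ) : ⋀[R]^n M →ₛₗ[σ] ⋀[B]^n N :=
  letI : Module R (⋀[B]^n N) := Module.compHom _ σ
  let F : M [⋀^Fin n]→ₗ[R] ⋀[B]^n N :=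
    { toFun := fun m => exteriorPower.ιMulti B n (ℓ ∘ m)
      map_update_add' := fun m j x y => by
        rw [Function.comp_update, Function.comp_update, Function.comp_update, map_add,
          AlternatingMap.map_update_add]
      map_update_smul' := fun m j r x => by
        rw [Function.comp_update, Function.comp_update, LinearMap.map_smulₛₗ,
          AlternatingMap.map_update_smul]
        rfl
      map_eq_zero_of_eq' := fun m j k h hjk =>
        AlternatingMap.map_eq_zero_of_eq _ _ (i := j) (j := k) (by simp [h]) hjk }
  let G := exteriorPower.alternatingMapLinearEquiv F
  { toFun := G
    map_add' := fun x y => map_add G x y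
    map_smul' := fun r x => G.map_smul r x }

theorem extMap_ιMulti (n : ℕ) (m : Fin n → M) :
    extMap ℓ n (exteriorPower.ιMulti R n m) = exteriorPower.ιMulti B n (ℓ ∘ m) := by
  let _ : Module R (⋀[B]^n N) := Module.compHom _ σ
  simp only [extMap, LinearMap.coe_mk, AddHom.coe_mk]
  erw [exteriorPower.alternatingMapLinearEquiv_apply_ιMulti]
  rfl

variable {ℓ}

theorem IsAway.extMap_surj {f : R} (hσ : IsRingAway σ f) (hℓ : IsAway f ℓ) (n : ℕ)
    (y : ⋀[B]^n N) : ∃ (k : ℕ) (x : ⋀[R]^n M), σ f ^ k • y = extMap ℓ n x := by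
  refine exists_smul_eq_of_span _ hσ (exteriorPower.ιMulti_span B n N) ?_ y
  rintro _ ⟨w, rfl⟩
  obtain ⟨k, hk⟩ := exists_pow_common (fun j => hℓ.surj (w j)) fun j a b hab ⟨x, hx⟩ =>
    ⟨f ^ (b - a) • x, by
      rw [LinearMap.map_smulₛₗ, ← hx, map_pow, smul_smul, ← pow_add, Nat.sub_add_cancel hab]⟩
  choose x hx using hk
  refine ⟨k * n, exteriorPower.ιMulti R n x, ?_⟩
  have : ℓ ∘ x = fun j => σ f ^ k • w j := funext fun j => (hx j).symm
  rw [extMap_ιMulti, this, AlternatingMap.map_smul_univ]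
  simp [pow_mul]

/-- The map `Λⁿ(M) → B ⊗ Λ(M)`, `T ↦ 1 ⊗ T`, factors through `Λⁿ(N)`, and its kernel is torsion. -/
theorem IsAway.extMap_torsion {f : R} (hσ : IsRingAway σ f) (hℓ : IsAway f ℓ) (n : ℕ)
    (T : ⋀[R]^n M) (hT : extMap ℓ n T = 0) : ∃ k : ℕ, f ^ k • T = 0 := by
  let _ := σ.toAlgebra
  have hB : IsLocalization.Away f B := hσ
  let _ : Module R N := Module.compHom N σ
  have : IsScalarTower R B N := ⟨fun r b x => by rw [Algebra.smul_def, mul_smul]; rfl⟩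
  let ℓ' : M →ₗ[R] N :=
    { toFun := ℓ, map_add' := map_add ℓ, map_smul' := LinearMap.map_smulₛₗ ℓ }
  have hl : IsLocalizedModule (Submonoid.powers f) ℓ' :=
    (isLocalizedModule_iff_isAway hB ℓ' ℓ fun _ => rfl).2 hℓ
  have hbc : IsBaseChange B ℓ' := IsLocalizedModule.isBaseChange (Submonoid.powers f) B ℓ'
  let g : M →ₗ[R] B ⊗[R] ExteriorAlgebra R M :=
    (TensorProduct.mk R B (ExteriorAlgebra R M) 1) ∘ₗ ExteriorAlgebra.ι R
  let j : N →ₗ[B] B ⊗[R] ExteriorAlgebra R M := hbc.lift g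
  have hj : ∀ m, j (ℓ m) = 1 ⊗ₜ ExteriorAlgebra.ι R m := fun m => hbc.lift_eq g m
  have hjj : ∀ y, j y * j y = 0 := fun y => by
    obtain ⟨k, x, hx⟩ := hℓ.surj y
    have h1 : (σ f ^ k * σ f ^ k) • (j y * j y) = 0 := by
      rw [← smul_smul, ← mul_smul_comm, ← smul_mul_assoc, ← map_smul, hx, hj,
        Algebra.TensorProduct.tmul_mul_tmul, ExteriorAlgebra.ι_sq_zero, TensorProduct.tmul_zero]
    exact (((hℓ.isUnit.pow k).mul (hℓ.isUnit.pow k)).smul_eq_zero).1 h1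
  let θ : ExteriorAlgebra B N →ₐ[B] B ⊗[R] ExteriorAlgebra R M := ExteriorAlgebra.lift B ⟨j, hjj⟩
  have hθ : ∀ T : ⋀[R]^n M, θ (extMap ℓ n T : ExteriorAlgebra B N) =
      1 ⊗ₜ (T : ExteriorAlgebra R M) := fun T => by
    have hT : T ∈ Submodule.span R (Set.range (exteriorPower.ιMulti R n (M := M))) := by
      rw [exteriorPower.ιMulti_span]; exact Submodule.mem_top
    induction hT using Submodule.span_induction with
    | mem s hs =>
      obtain ⟨m, rfl⟩ := hs
      rw [extMap_ιMulti, exteriorPower.ιMulti_apply_coe, exteriorPower.ιMulti_apply_coe,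
        ExteriorAlgebra.ιMulti_apply, ExteriorAlgebra.ιMulti_apply, map_list_prod, List.map_ofFn]
      let inc : ExteriorAlgebra R M →ₐ[R] B ⊗[R] ExteriorAlgebra R M :=
        Algebra.TensorProduct.includeRight
      change _ = inc _
      rw [map_list_prod, List.map_ofFn]
      congr 2
      funext i
      simp only [Function.comp_apply, θ, ExteriorAlgebra.lift_ι_apply, hj]
      rfl
    | zero => simp
    | add a b _ _ ha hb =>
      rw [map_add, Submodule.coe_add, map_add, ha, hb, Submodule.coe_add, TensorProduct.tmul_add]
    | smul r a _ ha =>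
      rw [LinearMap.map_smulₛₗ, Submodule.coe_smul, map_smul, ha, Submodule.coe_smul,
        TensorProduct.tmul_smul]
      rw [TensorProduct.smul_tmul', TensorProduct.smul_tmul']
      congr 1
  have h0 := hθ T
  rw [hT] at h0
  have h1 : TensorProduct.mk R B (ExteriorAlgebra R M) 1 T = 0 := by
    rw [TensorProduct.mk_apply, ← h0]; simp
  rw [IsLocalizedModule.eq_zero_iff (Submonoid.powers f)] at h1
  obtain ⟨⟨_, k, rfl⟩, hk⟩ := h1
  exact ⟨k, Subtype.ext hk⟩

/-- Exterior powers commute with localization. -/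
theorem IsAway.extMap {f : R} (hσ : IsRingAway σ f) (hℓ : IsAway f ℓ) (n : ℕ) :
    IsAway f (extMap ℓ n) :=
  ⟨hℓ.isUnit, hℓ.extMap_torsion hσ n, hℓ.extMap_surj hσ n⟩

variable {M' N' : Type u} [AddCommGroup M'] [Module R M'] [AddCommGroup N'] [Module B N']
variable {ℓ' : M' →ₛₗ[σ] N'}

/-- Tensor products commute with localization. -/
theorem IsAway.tensor {f : R} (hσ : IsRingAway σ f) (hℓ : IsAway f ℓ) (hℓ' : IsAway f ℓ')
    (t : M ⊗[R] M' →ₛₗ[σ] N ⊗[B] N') (ht : ∀ m m', t (m ⊗ₜ m') = ℓ m ⊗ₜ ℓ' m') :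
    IsAway f t := by
  refine ⟨hℓ.isUnit, ?_, ?_⟩
  · intro T hT
    let _ := σ.toAlgebra
    have hB : IsLocalization.Away f B := hσ
    let _ : Module R N := Module.compHom N σ
    have : IsScalarTower R B N := ⟨fun r b x => by rw [Algebra.smul_def, mul_smul]; rfl⟩
    let _ : Module R N' := Module.compHom N' σ
    have : IsScalarTower R B N' := ⟨fun r b x => by rw [Algebra.smul_def, mul_smul]; rfl⟩
    let l : M →ₗ[R] N :=
      { toFun := ℓ, map_add' := map_add ℓ, map_smul' := LinearMap.map_smulₛₗ ℓ }
    have hl : IsLocalizedModule (Submonoid.powers f) l :=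
      (isLocalizedModule_iff_isAway hB l ℓ fun _ => rfl).2 hℓ
    let l' : M' →ₗ[R] N' :=
      { toFun := ℓ', map_add' := map_add ℓ', map_smul' := LinearMap.map_smulₛₗ ℓ' }
    have hl' : IsLocalizedModule (Submonoid.powers f) l' :=
      (isLocalizedModule_iff_isAway hB l' ℓ' fun _ => rfl).2 hℓ'
    let e := IsLocalization.moduleTensorEquiv (Submonoid.powers f) B N N'
    have he : ∀ T, e (t T) = TensorProduct.map l l' T := fun T => by
      induction T using TensorProduct.induction_on with
      | zero => simp
      | tmul m m' => rw [ht]; rfl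
      | add a b ha hb => rw [map_add, map_add, ha, hb, map_add]
    have h1 := he T
    rw [hT, map_zero, eq_comm, IsLocalizedModule.eq_zero_iff (Submonoid.powers f)] at h1
    obtain ⟨⟨_, k, rfl⟩, hk⟩ := h1
    exact ⟨k, hk⟩
  · refine exists_smul_eq_of_span _ hσ (TensorProduct.span_tmul_eq_top B N N') ?_
    rintro _ ⟨a, b, rfl⟩
    obtain ⟨m, x, hx⟩ := hℓ.surj a
    obtain ⟨n, y, hy⟩ := hℓ'.surj b
    refine ⟨m + n, x ⊗ₜ y, ?_⟩
    rw [ht, ← hx, ← hy, TensorProduct.smul_tmul_smul, pow_add]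

end Away
end QuadBundle

/-! ### Projectivity, and vanishing of elements that are locally torsion -/

namespace QuadBundle
open CategoryTheory AlgebraicGeometry
open scoped TensorProduct

section Sheaf

variable {X : Scheme.{u}}

theorem isRingAway_res {U W : X.Opens} (hU : IsAffineOpen U) (f : Γ(X, U)) (h : W ≤ U)
    (hW : W = X.basicOpen f) : IsRingAway (res h) f :=
  hU.isLocalization_of_eq_basicOpen f (homOfLE h) hW

variable {F : X.Opens → Type u} [∀ U, AddCommGroup (F U)] [∀ U, Module Γ(X, U) (F U)]
variable {ρ : ∀ ⦃U W : X.Opens⦄ (h : W ≤ U), F U →ₛₗ[res h] F W}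

/-- Sections over an affine open set of a sheaf of modules with local frames form a projective
module, since they are flat and of finite presentation locally. -/
theorem HasFrames.projective (hρ : IsModSheaf ρ) {n : ℕ} (hF : HasFrames ρ n) {U : X.Opens}
    (hU : IsAffineOpen U) : Module.Projective Γ(X, U) (F U) := by
  obtain ⟨t, ht, hv⟩ := hF.exists_finset hρ hU
  choose v hv using hv
  let s : Set Γ(X, U) := t
  have hs : Ideal.span s = ⊤ := (hU.self_le_iSup_basicOpen_iff (s := s)).1 ht
  have hD : ∀ g : s, X.basicOpen (g : Γ(X, U)) ≤ U := fun g => X.basicOpen_le _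
  let _ : ∀ g : s, Algebra Γ(X, U) Γ(X, X.basicOpen (g : Γ(X, U))) :=
    fun g => (res (hD g)).toAlgebra
  have hloc : ∀ g : s, IsLocalization.Away (g : Γ(X, U)) Γ(X, X.basicOpen (g : Γ(X, U))) :=
    fun g => isRingAway_res hU g (hD g) rfl
  let _ : ∀ g : s, Module Γ(X, U) (F (X.basicOpen (g : Γ(X, U)))) :=
    fun g => Module.compHom _ (res (hD g))
  have : ∀ g : s, IsScalarTower Γ(X, U) Γ(X, X.basicOpen (g : Γ(X, U)))
      (F (X.basicOpen (g : Γ(X, U)))) :=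
    fun g => ⟨fun r b x => by rw [Algebra.smul_def, mul_smul]; rfl⟩
  let l : ∀ g : s, F U →ₗ[Γ(X, U)] F (X.basicOpen (g : Γ(X, U))) := fun g =>
    { toFun := ρ (hD g), map_add' := map_add _, map_smul' := LinearMap.map_smulₛₗ _ }
  have hl : ∀ g : s, IsLocalizedModule (Submonoid.powers (g : Γ(X, U))) (l g) := fun g =>
    (isLocalizedModule_iff_isAway (hloc g) (l g) (ρ (hD g)) fun _ => rfl).2
      (hF.isAway hρ hU g (hD g) rfl)
  have hfree : ∀ g : s, Module.Free Γ(X, X.basicOpen (g : Γ(X, U)))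
      (F (X.basicOpen (g : Γ(X, U)))) := fun g => Module.Free.of_basis ((hv g).basis le_rfl)
  have hfin : ∀ g : s, Module.Finite Γ(X, X.basicOpen (g : Γ(X, U)))
      (F (X.basicOpen (g : Γ(X, U)))) := fun g => Module.Finite.of_basis ((hv g).basis le_rfl)
  have hfp : Module.FinitePresentation Γ(X, U) (F U) :=
    Module.FinitePresentation.of_localizationSpan' s hs
      (Rₚ := fun g : s => Γ(X, X.basicOpen (g : Γ(X, U)))) l fun g =>
      have := hfree g
      have := hfin g
      Module.finitePresentation_of_projective Γ(X, X.basicOpen (g : Γ(X, U)))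
        (F (X.basicOpen (g : Γ(X, U))))
  have hflat : Module.Flat Γ(X, U) (F U) :=
    Module.flat_of_isLocalized_span Γ(X, U) (F U) s hs _ l fun g =>
      have : Module.Flat Γ(X, U) Γ(X, X.basicOpen (g : Γ(X, U))) :=
        IsLocalization.flat _ (Submonoid.powers (g : Γ(X, U)))
      Module.Flat.trans Γ(X, U) Γ(X, X.basicOpen (g : Γ(X, U))) _
  exact Module.Flat.projective_of_finitePresentation

/-- An element killed, up to torsion, on a covering by basic open sets is zero. -/
theorem eq_zero_of_torsion {U : X.Opens} (hU : IsAffineOpen U) {M : Type*} [AddCommGroup M]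
    [Module Γ(X, U) M] (T : M)
    (h : ∀ x ∈ U, ∃ g : Γ(X, U), x ∈ X.basicOpen g ∧ ∃ n : ℕ, g ^ n • T = 0) : T = 0 := by
  let J : Ideal Γ(X, U) := Ideal.radical (LinearMap.ker (LinearMap.toSpanSingleton Γ(X, U) M T))
  have hJ : Ideal.span (J : Set Γ(X, U)) = ⊤ := by
    rw [← hU.self_le_iSup_basicOpen_iff]
    intro x hx
    obtain ⟨g, hxg, n, hn⟩ := h x hx
    exact TopologicalSpace.Opens.mem_iSup.2 ⟨⟨g, n, by simpa using hn⟩, hxg⟩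
  rw [Ideal.span_eq, Ideal.radical_eq_top, Ideal.eq_top_iff_one] at hJ
  simpa using hJ

theorem IsVectorBundle.hasFrames {M : X.Modules} {n : ℕ} (hM : IsVectorBundle M n) :
    HasFrames (@secRes X M) n := fun x => by
  obtain ⟨U, hx, v, hv⟩ := hM.exists_frame x
  exact ⟨U, hx, v, fun W h => hv h⟩

theorem IsVectorBundle.dual_hasFrames {I : X.Modules} (hI : IsVectorBundle I 1) :
    HasFrames (@dualRes X I) 1 := fun x => by
  obtain ⟨U, hx, v, hv⟩ := hI.hasFrames x
  exact ⟨U, hx, _, dualFrame_isFrame hv⟩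

variable (P : BundlePair X)

theorem isAway_V {U W : X.Opens} (hU : IsAffineOpen U) (f : Γ(X, U)) (h : W ≤ U)
    (hW : W = X.basicOpen f) : IsAway f (secRes P.V h) :=
  P.isVectorBundle.hasFrames.isAway (secRes_isModSheaf _) hU f h hW

theorem isAway_D {U W : X.Opens} (hU : IsAffineOpen U) (f : Γ(X, U)) (h : W ≤ U)
    (hW : W = X.basicOpen f) : IsAway f (dualRes P.I h) :=
  P.isLineBundle.dual_hasFrames.isAway (dualRes_isModSheaf _) hU f h hW

theorem lamMap_eq {R S : Type u} [CommRing R] [CommRing S] {σ : R →+* S}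
    {V D V' D' : Type u} [AddCommGroup V] [Module R V]
    [AddCommGroup D] [Module R D] [AddCommGroup V'] [Module S V']
    [AddCommGroup D'] [Module S D'] (v : V →ₛₗ[σ] V') (d : D →ₛₗ[σ] D') (ω : ⋀[R]^2 V) (δ : D) :
    lamMap v d (ω ⊗ₜ δ) = extMap v 2 ω ⊗ₜ d δ := by
  have hω : ω ∈ Submodule.span R (Set.range (exteriorPower.ιMulti R 2 (M := V))) := by
    rw [exteriorPower.ιMulti_span]; exact Submodule.mem_top
  induction hω using Submodule.span_induction with
  | mem s hs =>
    obtain ⟨m, rfl⟩ := hs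
    rw [lamMap_tmul, extMap_ιMulti]
  | zero => rw [TensorProduct.zero_tmul, map_zero, map_zero, TensorProduct.zero_tmul]
  | add a b _ _ ha hb =>
    rw [TensorProduct.add_tmul, map_add, ha, hb, map_add, TensorProduct.add_tmul]
  | smul r a _ ha =>
    rw [← TensorProduct.smul_tmul', LinearMap.map_smulₛₗ, ha, LinearMap.map_smulₛₗ,
      TensorProduct.smul_tmul']

theorem isAway_lamRes {U W : X.affineOpens} (f : Γ(X, U.1)) (h : W ≤ U)
    (hW : W.1 = X.basicOpen f) : IsAway (M := LamSec P U) (N := LamSec P W) f (lamRes P h) :=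
  ((isAway_V P U.2 f h hW).extMap (isRingAway_res U.2 f h hW) 2).tensor
    (isRingAway_res U.2 f h hW) (isAway_D P U.2 f h hW) _ fun m m' => lamMap_eq _ _ m m'

theorem projective_V {U : X.Opens} (hU : IsAffineOpen U) :
    Module.Projective Γ(X, U) Γ(P.V, U) :=
  P.isVectorBundle.hasFrames.projective (secRes_isModSheaf _) hU

end Sheaf
end QuadBundle

/-! ### The Bourbaki map on elements of degree zero -/

namespace QuadBundle
open scoped TensorProduct

section Algebra

variable {R : Type u} [CommRing R]
variable {V I D : Type u} [AddCommGroup V] [Module R V] [AddCommGroup I] [Module R I]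
  [AddCommGroup D] [Module R D]

/-- A quadratic map on a projective module comes from a bilinear map: it does on a free module, of
which the projective module is a direct summand. -/
theorem exists_bilin [Module.Projective R V] (q : QuadraticMap R V I) :
    ∃ b : V →ₗ[R] V →ₗ[R] I, ∀ x, q x = b x x := by
  obtain ⟨s, hs⟩ := Module.Projective.out (R := R) (P := V)
  obtain ⟨B, hB⟩ := LinearMap.BilinMap.toQuadraticMap_surjective
    (q.comp (Finsupp.linearCombination R (id : V → V)))
  refine ⟨B.compl₁₂ s s, fun x => ?_⟩
  have := congrArg (fun Q : QuadraticMap R (V →₀ R) I => Q (s x)) hB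
  simp only [QuadraticMap.comp_apply, LinearMap.BilinMap.toQuadraticMap_apply] at this
  rw [hs] at this
  exact this.symm

namespace LaurentRees

variable {ev : D →ₗ[R] I →ₗ[R] R}

/-- In a monomial of nonpositive degree the factors from `I` can be cancelled. -/
theorem ιI_prod_mul_ιD_prod (i : List I) (d : List D) (h : i.length ≤ d.length) :
    ∃ r : R, (i.map (ιI ev)).prod * (d.map (ιD ev)).prod =
      r • ((d.drop i.length).map (ιD ev)).prod := by
  induction i generalizing d with
  | nil => exact ⟨1, by simp⟩
  | cons a i ih =>
    cases d with
    | nil => simp at h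
    | cons c d =>
      obtain ⟨r, hr⟩ := ih d (by simpa using h)
      refine ⟨ev c a * r, ?_⟩
      have hcomm : ∀ l : List I, Commute (l.map (ιI ev)).prod (ιD ev c) := fun l =>
        Commute.list_prod_left _ _ fun x hx => by
          obtain ⟨x, -, rfl⟩ := List.mem_map.1 hx
          exact gen_comm _ _
      rw [List.map_cons, List.map_cons, List.prod_cons, List.prod_cons, List.length_cons,
        List.drop_succ_cons, mul_smul, ← hr, mul_assoc, ← mul_assoc _ (ιD ev c), (hcomm i).eq,
        mul_assoc, ← mul_assoc, pair_eq, Algebra.smul_def]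

end LaurentRees

namespace GenClifford

variable {ev : D →ₗ[R] I →ₗ[R] R} {q q' : QuadraticMap R V I}

theorem degreePart_mul {m n : ℤ} {a b : GenClifford ev q} (ha : a ∈ degreePart ev q m)
    (hb : b ∈ degreePart ev q n) : a * b ∈ degreePart ev q (m + n) := by
  induction ha, hb using Submodule.span_induction₂ with
  | mem_mem x y hx hy => exact Submodule.subset_span (hx.mul hy)
  | zero_left y hy => simp
  | zero_right x hx => simp
  | add_left x y z _ _ _ h1 h2 => rw [add_mul]; exact add_mem h1 h2
  | add_right x y z _ _ _ h1 h2 => rw [mul_add]; exact add_mem h1 h2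
  | smul_left r x y _ _ h => rw [smul_mul_assoc]; exact Submodule.smul_mem _ _ h
  | smul_right r x y _ _ h => rw [mul_smul_comm]; exact Submodule.smul_mem _ _ h

theorem ιV_mem (x : V) : ιV ev q x ∈ degreePart ev q 1 :=
  Submodule.subset_span (by simpa using IsMonomial.mk (ev := ev) (q := q) [x] [] [])

theorem ιI_mem (x : I) : ιI ev q x ∈ degreePart ev q 2 :=
  Submodule.subset_span (by simpa using IsMonomial.mk (ev := ev) (q := q) [] [x] [])

theorem lists_eq_ofL (i : List I) (d : List D) :
    (i.map (ιI ev q)).prod * (d.map (ιD ev q)).prod =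
      ofL ev q ((i.map (LaurentRees.ιI ev)).prod * (d.map (LaurentRees.ιD ev)).prod) := by
  rw [map_mul, map_list_prod, map_list_prod, List.map_map, List.map_map]
  rfl

/-- `d_f` is linear over `L[I]`. -/
theorem contr_ofL (f : V →ₗ[R] I) (l : LaurentRees ev) (c : GenClifford ev q) :
    contr f (ofL ev q l * c) = ofL ev q l * contr f c := by
  let S : Subalgebra R (LaurentRees ev) :=
    { carrier := {l | ∀ c, contr f (ofL ev q l * c) = ofL ev q l * contr f c}
      mul_mem' := fun {a b} ha hb c => by
        rw [map_mul (ofL ev q), mul_assoc, ha, hb, mul_assoc]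
      add_mem' := fun {a b} ha hb c => by rw [map_add, add_mul, map_add, ha, hb, add_mul]
      algebraMap_mem' := fun r c => by
        rw [AlgHom.commutes, ← Algebra.smul_def, map_smul, ← Algebra.smul_def] }
  refine LaurentRees.mem_of_gen S (fun a => ?_) l c
  have e : LaurentRees.gen ev a = LaurentRees.ιI ev a.1 + LaurentRees.ιD ev a.2 := by
    change _ = LaurentRees.gen ev (a.1, 0) + LaurentRees.gen ev (0, a.2)
    rw [← map_add]; simp
  rw [e]
  exact S.add_mem (fun c => contr_ιI f a.1 c) (fun c => contr_ιD f a.2 c)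

theorem contr_ofL_self (f : V →ₗ[R] I) (l : LaurentRees ev) :
    contr f (ofL ev q l) = 0 := by
  rw [← mul_one (ofL ev q l), contr_ofL, contr_one, mul_zero]

/-- `d_f` raises the degree by one, because `I` has degree two and `V` degree one. -/
theorem contr_mem (f : V →ₗ[R] I) {n : ℤ} {c : GenClifford ev q} (hc : c ∈ degreePart ev q n) :
    contr f c ∈ degreePart ev q (n + 1) := by
  induction hc using Submodule.span_induction with
  | mem x hx =>
    obtain ⟨v, i, d⟩ := hx
    rw [mul_assoc]
    induction v with
    | nil => rw [List.map_nil, List.prod_nil, one_mul, lists_eq_ofL, contr_ofL_self]; exact zero_mem _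
    | cons a v ih =>
      rw [List.map_cons, List.prod_cons, mul_assoc, contr_ιV]
      have h0 : (v.map (ιV ev q)).prod * ((i.map (ιI ev q)).prod * (d.map (ιD ev q)).prod) ∈
          degreePart ev q ((v.length : ℤ) + 2 * i.length - 2 * d.length) :=
        Submodule.subset_span (by rw [← mul_assoc]; exact IsMonomial.mk v i d)
      refine sub_mem ?_ ?_
      · convert degreePart_mul (ιI_mem (f a)) h0 using 1
        push_cast [List.length_cons]; ring_nf
      · convert degreePart_mul (ιV_mem a) ih using 1
        push_cast [List.length_cons]; ring_nf
  | zero => rw [map_zero]; exact zero_mem _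
  | add x y _ _ hx hy => rw [map_add]; exact add_mem hx hy
  | smul r x _ hx => rw [map_smul]; exact Submodule.smul_mem _ _ hx

section psi

variable (b : V →ₗ[R] V →ₗ[R] I) (h : ∀ x, q' x = q x + b x x)

/-- `ψ_b` is linear over `L[I]`. -/
theorem psi_ofL (l : LaurentRees ev) (c : GenClifford ev q') :
    psi b h (ofL ev q' l * c) = ofL ev q l * psi b h c := by
  let S : Subalgebra R (LaurentRees ev) :=
    { carrier := {l | ∀ c, psi b h (ofL ev q' l * c) = ofL ev q l * psi b h c}
      mul_mem' := fun {a b} ha hb c => by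
        rw [map_mul (ofL ev q'), mul_assoc, ha, hb, map_mul (ofL ev q), mul_assoc]
      add_mem' := fun {a b} ha hb c => by
        rw [map_add, add_mul, map_add, ha, hb, map_add, add_mul]
      algebraMap_mem' := fun r c => by
        rw [AlgHom.commutes, AlgHom.commutes, ← Algebra.smul_def, map_smul, ← Algebra.smul_def] }
  refine LaurentRees.mem_of_gen S (fun a => ?_) l c
  have e : LaurentRees.gen ev a = LaurentRees.ιI ev a.1 + LaurentRees.ιD ev a.2 := by
    change _ = LaurentRees.gen ev (a.1, 0) + LaurentRees.gen ev (0, a.2)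
    rw [← map_add]; simp
  rw [e]
  exact S.add_mem (fun c => psi_ιI b h a.1 c) (fun c => psi_ιD b h a.2 c)

theorem psi_ofL_self (l : LaurentRees ev) : psi b h (ofL ev q' l) = ofL ev q l := by
  rw [← mul_one (ofL ev q' l), psi_ofL, psi_one, mul_one]

/-- `ψ_b` preserves the degree. -/
theorem psi_mem {n : ℤ} {c : GenClifford ev q'} (hc : c ∈ degreePart ev q' n) :
    psi b h c ∈ degreePart ev q n := by
  induction hc using Submodule.span_induction with
  | mem x hx =>
    obtain ⟨v, i, d⟩ := hx
    rw [mul_assoc]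
    induction v with
    | nil =>
      rw [List.map_nil, List.prod_nil, one_mul, lists_eq_ofL, psi_ofL_self, ← lists_eq_ofL]
      exact Submodule.subset_span (by simpa using IsMonomial.mk (ev := ev) (q := q) [] i d)
    | cons a v ih =>
      rw [List.map_cons, List.prod_cons, mul_assoc, psi_ιV]
      refine add_mem ?_ ?_
      · convert degreePart_mul (ιV_mem a) ih using 1
        push_cast [List.length_cons]; ring_nf
      · convert contr_mem (b a) ih using 1
        push_cast [List.length_cons]; ring_nf
  | zero => rw [map_zero]; exact zero_mem _
  | add x y _ _ hx hy => rw [map_add]; exact add_mem hx hy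
  | smul r x _ hx => rw [map_smul]; exact Submodule.smul_mem _ _ hx

theorem contr_anticomm (f g : V →ₗ[R] I) (c : GenClifford ev q) :
    contr f (contr g c) = -contr g (contr f c) := by
  have := contr_contr (f + g) c
  rw [contr_add, contr_add, map_add, map_add, contr_contr, contr_contr, zero_add, add_zero] at this
  exact eq_neg_of_add_eq_zero_left this

theorem contr_neg (f : V →ₗ[R] I) (c : GenClifford ev q) : contr (-f) c = -contr f c := by
  have := contr_smul (-1) f c
  simpa using this

/-- The Bourbaki maps commute with the contractions. -/
theorem psi_contr (f : V →ₗ[R] I) (c : GenClifford ev q') :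
    psi b h (contr f c) = contr f (psi b h c) := by
  have : c ∈ LinearMap.ker (psi (ev := ev) b h ∘ₗ contr f - contr f ∘ₗ psi b h) := by
    refine mem_of_mul_mem _ ?_ ?_ ?_ ?_ c
    · simp [contr_one, psi_one]
    · intro x c hc
      rw [LinearMap.mem_ker, LinearMap.sub_apply, LinearMap.comp_apply, LinearMap.comp_apply,
        sub_eq_zero] at hc ⊢
      rw [contr_ιV, map_sub, psi_ιI, psi_ιV, psi_ιV, hc, map_add, contr_ιV,
        contr_anticomm f (b x)]
      abel
    · intro x c hc
      rw [LinearMap.mem_ker, LinearMap.sub_apply, LinearMap.comp_apply, LinearMap.comp_apply,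
        sub_eq_zero] at hc ⊢
      rw [contr_ιI, psi_ιI, psi_ιI, hc, contr_ιI]
    · intro x c hc
      rw [LinearMap.mem_ker, LinearMap.sub_apply, LinearMap.comp_apply, LinearMap.comp_apply,
        sub_eq_zero] at hc ⊢
      rw [contr_ιD, psi_ιD, psi_ιD, hc, contr_ιD]
  rwa [LinearMap.mem_ker, LinearMap.sub_apply, LinearMap.comp_apply, LinearMap.comp_apply,
        sub_eq_zero] at this

/-- `ψ_{-b}` is inverse to `ψ_b`. -/
theorem psi_neg_psi (h' : ∀ x, q x = q' x + (-b) x x) (c : GenClifford ev q') :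
    psi (-b) h' (psi b h c) = c := by
  have : c ∈ LinearMap.ker (psi (ev := ev) (-b) h' ∘ₗ psi b h - LinearMap.id) := by
    refine mem_of_mul_mem _ ?_ ?_ ?_ ?_ c
    · simp [psi_one]
    · intro x c hc
      rw [LinearMap.mem_ker, LinearMap.sub_apply, LinearMap.comp_apply, LinearMap.id_apply,
        sub_eq_zero] at hc ⊢
      rw [psi_ιV, map_add, psi_ιV, psi_contr, hc, LinearMap.neg_apply, contr_neg]
      abel
    · intro x c hc
      rw [LinearMap.mem_ker, LinearMap.sub_apply, LinearMap.comp_apply, LinearMap.id_apply,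
        sub_eq_zero] at hc ⊢
      rw [psi_ιI, psi_ιI, hc]
    · intro x c hc
      rw [LinearMap.mem_ker, LinearMap.sub_apply, LinearMap.comp_apply, LinearMap.id_apply,
        sub_eq_zero] at hc ⊢
      rw [psi_ιD, psi_ιD, hc]
  rwa [LinearMap.mem_ker, LinearMap.sub_apply, LinearMap.comp_apply, LinearMap.id_apply,
        sub_eq_zero] at this

end psi

section exterior

variable (ev) in
/-- The inverse of `toExterior`. -/
noncomputable def ofExterior :
    ExteriorAlgebra R V ⊗[R] LaurentRees ev →ₐ[R] GenClifford ev (0 : QuadraticMap R V I) :=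
  Algebra.TensorProduct.lift
    (ExteriorAlgebra.lift R ⟨ιV ev 0, fun x => by rw [ιV_sq]; simp⟩) (ofL ev 0) fun x y => by
      induction x using ExteriorAlgebra.induction with
      | algebraMap r => rw [AlgHom.commutes]; exact Algebra.commutes r _
      | ι x => rw [ExteriorAlgebra.lift_ι_apply]; exact ιV_ofL x y
      | mul a b ha hb => rw [map_mul]; exact ha.mul_left hb
      | add a b ha hb => rw [map_add]; exact ha.add_left hb

theorem ofExterior_toExterior (c : GenClifford ev (0 : QuadraticMap R V I)) :
    ofExterior ev (toExterior ev c) = c := by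
  have : (ofExterior ev).comp (toExterior ev) =
      AlgHom.id R (GenClifford ev (0 : QuadraticMap R V I)) := by
    refine hom_ext (fun x => ?_) (fun x => ?_) fun x => ?_
    · simp [toExterior, ofExterior]
    · simp [toExterior, ofExterior]; rfl
    · simp [toExterior, ofExterior]; rfl
  exact AlgHom.congr_fun this c

theorem toExterior_ιV (x : V) :
    toExterior ev (ιV ev 0 x) = ExteriorAlgebra.ι R x ⊗ₜ 1 := by
  simp [toExterior]

theorem toExterior_ofL (l : LaurentRees ev) :
    toExterior ev (ofL ev (0 : QuadraticMap R V I) l) = 1 ⊗ₜ l := by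
  have : (toExterior ev).comp (ofL ev (0 : QuadraticMap R V I)) =
      Algebra.TensorProduct.includeRight := by
    refine LaurentRees.hom_ext fun a => ?_
    have e : LaurentRees.gen ev a = LaurentRees.ιI ev a.1 + LaurentRees.ιD ev a.2 := by
      change _ = LaurentRees.gen ev (a.1, 0) + LaurentRees.gen ev (0, a.2)
      rw [← map_add]; simp
    rw [e, map_add, map_add]
    exact congrArg₂ (· + ·) (lift_ιI _ _) (lift_ιD _ _)
  exact AlgHom.congr_fun this l

theorem lambdaEv_tmul (r : R) (x y : V) (d : D) :
    lambdaEv V ev (r, exteriorPower.ιMulti R 2 ![x, y] ⊗ₜ d) =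
      r • 1 + (ExteriorAlgebra.ι R x * ExteriorAlgebra.ι R y) ⊗ₜ LaurentRees.ιD ev d := by
  simp only [lambdaEv, LinearMap.coprod_apply, Algebra.linearMap_apply, Algebra.algebraMap_eq_smul_one,
    TensorProduct.map_tmul, Submodule.subtype_apply, exteriorPower.ιMulti_apply_coe,
    ExteriorAlgebra.ιMulti_apply]
  simp [List.ofFn_succ]

/-- If `Λ⁴(V) = 0` then the elements of degree zero in `Λ(V) ⊗ L[I]` come from
`R ⊕ Λ²(V) ⊗ I⁻¹`. -/
theorem toExterior_mem_range (h4 : ∀ v : Fin 4 → V, ExteriorAlgebra.ιMulti R 4 v = 0)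
    {c : GenClifford ev (0 : QuadraticMap R V I)} (hc : c ∈ degreePart ev 0 0) :
    toExterior ev c ∈ LinearMap.range (lambdaEv V ev) := by
  refine Submodule.span_induction (p := fun c _ => toExterior ev c ∈
    LinearMap.range (lambdaEv V ev)) ?_ ?_ ?_ ?_ hc
  · rintro c hc
    generalize hn : (0 : ℤ) = n at hc
    obtain ⟨v, i, d⟩ := hc
    rw [mul_assoc, lists_eq_ofL, map_mul, toExterior_ofL, map_list_prod, List.map_map]
    have e1 : ⇑(toExterior ev) ∘ ⇑(ιV ev (0 : QuadraticMap R V I)) =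
        ⇑(Algebra.TensorProduct.includeLeft : ExteriorAlgebra R V →ₐ[R]
          ExteriorAlgebra R V ⊗[R] LaurentRees ev) ∘ ⇑(ExteriorAlgebra.ι R) :=
      funext fun x => toExterior_ιV x
    rw [e1, ← List.map_map, ← map_list_prod, Algebra.TensorProduct.includeLeft_apply,
      Algebra.TensorProduct.tmul_mul_tmul, mul_one, one_mul]
    -- the degree is zero, so there are at least as many factors in `I⁻¹` as in `I`
    have hle : i.length ≤ d.length := by omega
    obtain ⟨r, hr⟩ := LaurentRees.ιI_prod_mul_ιD_prod (ev := ev) i d hle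
    rw [hr]
    have hlen : ((d.drop i.length).length : ℤ) = d.length - i.length := by
      rw [List.length_drop]; omega
    generalize d.drop i.length = d' at *
    match v with
    | [] =>
      have : d' = [] := List.length_eq_zero_iff.1 (by simp at hn; omega)
      subst this
      refine ⟨(r, 0), ?_⟩
      simp [lambdaEv, Algebra.algebraMap_eq_smul_one, Algebra.TensorProduct.one_def]
    | [x] => simp at hn; omega
    | [x, y] =>
      have : d'.length = 1 := by simp at hn; omega
      obtain ⟨z, rfl⟩ := List.length_eq_one_iff.1 this
      refine ⟨(0, r • exteriorPower.ιMulti R 2 ![x, y] ⊗ₜ z), ?_⟩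
      have := lambdaEv_tmul (ev := ev) (0 : R) x y (r • z)
      rw [TensorProduct.tmul_smul] at this
      rw [this]
      simp
    | [x, y, z] => simp at hn; omega
    | x :: y :: z :: w :: v =>
      have h0 : ((x :: y :: z :: w :: v).map (ExteriorAlgebra.ι R)).prod = 0 := by
        have := h4 ![x, y, z, w]
        rw [ExteriorAlgebra.ιMulti_apply] at this
        simp [List.ofFn_succ] at this
        simp only [List.map_cons, List.prod_cons]
        simp only [← mul_assoc] at this ⊢
        rw [this, zero_mul]
      rw [h0, TensorProduct.zero_tmul]
      exact zero_mem _
  · simp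
  · intro x y _ _ hx hy; rw [map_add]; exact add_mem hx hy
  · intro r x _ hx; rw [map_smul]; exact Submodule.smul_mem _ _ hx

/-- The elements of `R ⊕ Λ²(V) ⊗ I⁻¹` have degree zero. -/
theorem range_lambdaEv_le (t : R × (⋀[R]^2 V ⊗[R] D)) :
    ∃ c ∈ degreePart ev (0 : QuadraticMap R V I) 0, toExterior ev c = lambdaEv V ev t := by
  let N : Submodule R (ExteriorAlgebra R V ⊗[R] LaurentRees ev) :=
    (degreePart ev (0 : QuadraticMap R V I) 0).map (toExterior ev).toLinearMap
  suffices h : lambdaEv V ev t ∈ N by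
    obtain ⟨c, hc, h⟩ := h
    exact ⟨c, hc, h⟩
  have h1 : ∀ r : R, lambdaEv V ev (r, (0 : ⋀[R]^2 V ⊗[R] D)) ∈ N := fun r =>
    ⟨r • 1, Submodule.smul_mem _ _ (Submodule.subset_span isMonomial_one), by
      simp [lambdaEv, Algebra.algebraMap_eq_smul_one]⟩
  have h2 : ∀ (ω : ⋀[R]^2 V) (d : D), lambdaEv V ev ((0 : R), ω ⊗ₜ d) ∈ N := fun ω d => by
    have hω : ω ∈ Submodule.span R (Set.range (exteriorPower.ιMulti R 2 (M := V))) := by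
      rw [exteriorPower.ιMulti_span]; exact Submodule.mem_top
    induction hω using Submodule.span_induction with
    | mem s hs =>
      obtain ⟨m, rfl⟩ := hs
      have hm : m = ![m 0, m 1] := by ext j; fin_cases j <;> rfl
      rw [hm, lambdaEv_tmul]
      refine ⟨ιV ev 0 (m 0) * ιV ev 0 (m 1) * ιD ev 0 d, ?_, ?_⟩
      · exact Submodule.subset_span (by
          simpa [mul_assoc] using
            IsMonomial.mk (ev := ev) (q := (0 : QuadraticMap R V I)) [m 0, m 1] [] [d])
      · have e : ιD ev (0 : QuadraticMap R V I) d = ofL ev 0 (LaurentRees.ιD ev d) := rfl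
        rw [AlgHom.toLinearMap_apply, map_mul, map_mul, toExterior_ιV, toExterior_ιV, e,
          toExterior_ofL]
        simp
    | zero => rw [TensorProduct.zero_tmul]; exact h1 0
    | add a b _ _ ha hb =>
      have e : ((0 : R), (a + b) ⊗ₜ[R] d) = (0, a ⊗ₜ d) + (0, b ⊗ₜ d) := by
        rw [TensorProduct.add_tmul]; simp
      rw [e, map_add]; exact N.add_mem ha hb
    | smul r a _ ha =>
      have e : ((0 : R), (r • a) ⊗ₜ[R] d) = r • (0, a ⊗ₜ d) := by
        rw [← TensorProduct.smul_tmul']; simp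
      rw [e, map_smul]; exact N.smul_mem _ ha
  have h3 : ∀ ω, lambdaEv V ev ((0 : R), ω) ∈ N := fun ω => by
    induction ω using TensorProduct.induction_on with
    | zero => exact h1 0
    | tmul ω d => exact h2 ω d
    | add a b ha hb =>
      have e : ((0 : R), a + b) = (0, a) + (0, b) := by simp
      rw [e, map_add]; exact N.add_mem ha hb
  obtain ⟨r, ω⟩ := t
  have e : (r, ω) = (r, 0) + (0, ω) := by simp
  rw [e, map_add]
  exact N.add_mem (h1 r) (h3 ω)

/-- `ψ_b` restricts to an isomorphism `C₀(V, q_b, I) ≅ R ⊕ Λ²(V) ⊗ I⁻¹`. -/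
theorem exists_psiEquiv (h4 : ∀ v : Fin 4 → V, ExteriorAlgebra.ιMulti R 4 v = 0)
    (hinj : Function.Injective (lambdaEv V ev)) (b : V →ₗ[R] V →ₗ[R] I) (hb : ∀ x, q x = b x x) :
    ∃ e : C0 ev q ≃ₗ[R] R × (⋀[R]^2 V ⊗[R] D), ∀ c : C0 ev q,
      lambdaEv V ev (e c) = psiExt ev b hb c := by
  have hb0 : ∀ x, q x = (0 : QuadraticMap R V I) x + b x x := fun x => by simp [hb]
  have hb1 : ∀ x, (0 : QuadraticMap R V I) x = q x + (-b) x x := fun x => by simp [hb]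
  have hb2 : ∀ x, q x = (0 : QuadraticMap R V I) x + (-(-b)) x x := fun x => by simp [hb]
  have hpsi : ∀ c, psiExt ev b hb c = toExterior ev (psi b hb0 c) := fun c => rfl
  have hinv : ∀ c : GenClifford ev (0 : QuadraticMap R V I),
      psi b hb0 (psi (-b) hb1 c) = c := fun c => by
    have := psi_neg_psi (-b) hb1 hb2 c
    simpa only [neg_neg] using this
  let Ψ : C0 ev q →ₗ[R] ExteriorAlgebra R V ⊗[R] LaurentRees ev :=
    psiExt ev b hb ∘ₗ (C0 ev q).val.toLinearMap
  have hΨ : Function.Injective Ψ := by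
    intro c c' hcc
    have h1 : toExterior ev (psi b hb0 c) = toExterior ev (psi b hb0 c') := hcc
    have h2 := congrArg (ofExterior ev) h1
    rw [ofExterior_toExterior, ofExterior_toExterior] at h2
    have h3 := congrArg (psi (-b) hb1) h2
    rw [psi_neg_psi, psi_neg_psi] at h3
    exact Subtype.ext h3
  have hr : LinearMap.range Ψ = LinearMap.range (lambdaEv V ev) := by
    apply le_antisymm
    · rintro _ ⟨c, rfl⟩
      exact toExterior_mem_range h4 (psi_mem b hb0 c.2)
    · rintro _ ⟨t, rfl⟩
      obtain ⟨c, hc, h⟩ := range_lambdaEv_le (ev := ev) t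
      refine ⟨⟨psi (-b) hb1 c, psi_mem _ hb1 hc⟩, ?_⟩
      change toExterior ev (psi b hb0 (psi (-b) hb1 c)) = _
      rw [hinv, h]
  refine ⟨LinearEquiv.ofInjective Ψ hΨ ≪≫ₗ LinearEquiv.ofEq _ _ hr ≪≫ₗ
    (LinearEquiv.ofInjective (lambdaEv V ev) hinj).symm, fun c => ?_⟩
  have := LinearEquiv.apply_symm_apply (LinearEquiv.ofInjective (lambdaEv V ev) hinj)
    (LinearEquiv.ofEq _ _ hr (LinearEquiv.ofInjective Ψ hΨ c))
  exact congrArg Subtype.val this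

end exterior

end GenClifford

end Algebra
end QuadBundle

/-! ### The projection of the even Clifford algebra to its exterior part -/

namespace QuadBundle
open scoped TensorProduct

section Quotients

variable {R A A' M M' : Type*} [CommRing R] [AddCommGroup A] [Module R A] [AddCommGroup A']
  [Module R A'] [AddCommGroup M] [Module R M] [AddCommGroup M'] [Module R M']
  {p : A →ₗ[R] M} {p' : A' →ₗ[R] M'}

/-- The isomorphism of quotients induced by an isomorphism that preserves the kernels. -/
noncomputable def quotEquiv (hp : Function.Surjective p) (hp' : Function.Surjective p')
    (φ : A ≃ₗ[R] A') (h : ∀ c, p c = 0 → p' (φ c) = 0) (h' : ∀ c, p' c = 0 → p (φ.symm c) = 0) :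
    M ≃ₗ[R] M' :=
  (p.quotKerEquivOfSurjective hp).symm ≪≫ₗ
    Submodule.Quotient.equiv (LinearMap.ker p) (LinearMap.ker p') φ (by
      apply le_antisymm
      · rintro _ ⟨c, hc, rfl⟩
        exact h c hc
      · intro c hc
        exact ⟨φ.symm c, h' c hc, φ.apply_symm_apply c⟩) ≪≫ₗ
    p'.quotKerEquivOfSurjective hp'

theorem quotEquiv_apply (hp : Function.Surjective p) (hp' : Function.Surjective p')
    (φ : A ≃ₗ[R] A') (h : ∀ c, p c = 0 → p' (φ c) = 0) (h' : ∀ c, p' c = 0 → p (φ.symm c) = 0)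
    (c : A) : quotEquiv hp hp' φ h h' (p c) = p' (φ c) := by
  have : (p.quotKerEquivOfSurjective hp).symm (p c) = Submodule.Quotient.mk c :=
    (LinearEquiv.symm_apply_eq _).2 rfl
  simp only [quotEquiv, LinearEquiv.trans_apply, this]
  rfl

end Quotients

section Algebra

variable {R : Type u} [CommRing R]
variable {V I D : Type u} [AddCommGroup V] [Module R V] [AddCommGroup I] [Module R I]
  [AddCommGroup D] [Module R D]
variable {B : Type u} [CommRing B] [Algebra R B]

/-- The action of `(i, d)` on `ℤ`-indexed families of elements of `B` by `g i · T + h d · T⁻¹`,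
where `T` is the shift. -/
def LaurentRees.shift (g : I →ₗ[R] B) (h : D →ₗ[R] B) : I × D →ₗ[R] Module.End R (ℤ → B) :=
  LinearMap.mk₂ R (fun a f n => g a.1 * f (n - 1) + h a.2 * f (n + 1))
    (fun a b f => by funext n; simp only [Prod.fst_add, Prod.snd_add, map_add, Pi.add_apply]; ring)
    (fun r a f => by
      funext n
      simp only [Prod.smul_fst, Prod.smul_snd, map_smul, Pi.smul_apply, smul_add, smul_mul_assoc])
    (fun a f f' => by funext n; simp only [Pi.add_apply]; ring)
    (fun r a f => by
      funext n; simp only [Pi.smul_apply, smul_add, mul_smul_comm])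

variable {ev : D →ₗ[R] I →ₗ[R] R}

/-- The action of `L[I]` on `ℤ`-indexed families given by a pair of linear maps `I → B`,
`I⁻¹ → B` that is compatible with the pairing. -/
noncomputable def LaurentRees.act (g : I →ₗ[R] B) (h : D →ₗ[R] B)
    (hgh : ∀ i d, g i * h d = algebraMap R B (ev d i)) : LaurentRees ev →ₐ[R] Module.End R (ℤ → B) :=
  LaurentRees.lift (LaurentRees.shift g h)
    (fun a b => by
      refine LinearMap.ext fun f => funext fun n => ?_
      simp only [LaurentRees.shift, Module.End.mul_apply, LinearMap.mk₂_apply]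
      ring_nf)
    (fun i d => by
      refine LinearMap.ext fun f => funext fun n => ?_
      simp only [LaurentRees.shift, Module.End.mul_apply, LinearMap.mk₂_apply, map_zero, zero_mul,
        zero_add, add_zero, sub_add_cancel, Module.algebraMap_end_apply, Pi.smul_apply,
        Algebra.smul_def, ← mul_assoc, hgh])

/-- The coefficient of degree `n` of an element of `L[I]`, with respect to a trivialization
of `I` over `B`. -/
noncomputable def LaurentRees.coeff (g : I →ₗ[R] B) (h : D →ₗ[R] B)
    (hgh : ∀ i d, g i * h d = algebraMap R B (ev d i)) (n : ℤ) : LaurentRees ev →ₗ[R] B :=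
  LinearMap.proj n ∘ₗ LinearMap.applyₗ (Pi.single 0 1) ∘ₗ (LaurentRees.act g h hgh).toLinearMap

theorem LaurentRees.coeff_one (g : I →ₗ[R] B) (h : D →ₗ[R] B)
    (hgh : ∀ i d, g i * h d = algebraMap R B (ev d i)) (n : ℤ) :
    LaurentRees.coeff g h hgh n 1 = Pi.single (M := fun _ => B) 0 1 n := by
  simp [LaurentRees.coeff]

theorem LaurentRees.coeff_ιD (g : I →ₗ[R] B) (h : D →ₗ[R] B)
    (hgh : ∀ i d, g i * h d = algebraMap R B (ev d i)) (n : ℤ) (d : D) :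
    LaurentRees.coeff g h hgh n (LaurentRees.ιD ev d) =
      h d * Pi.single (M := fun _ => B) 0 1 (n + 1) := by
  have : LaurentRees.act g h hgh (LaurentRees.ιD ev d) = LaurentRees.shift g h (0, d) :=
    LaurentRees.lift_gen _ _ _ _
  simp [LaurentRees.coeff, this, LaurentRees.shift]

variable (R V) in
/-- The projection of the exterior algebra to its part of degree two. -/
noncomputable def extProj : ExteriorAlgebra R V →ₗ[R] ⋀[R]^2 V :=
  DirectSum.component R ℕ (fun i => ⋀[R]^i V) 2 ∘ₗ
    (DirectSum.decomposeLinearEquiv (fun i : ℕ => ⋀[R]^i V)).toLinearMap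

theorem extProj_coe (ω : ⋀[R]^2 V) : extProj R V ω = ω := by
  simp only [extProj, LinearMap.comp_apply, LinearEquiv.coe_coe,
    DirectSum.decomposeLinearEquiv_apply, DirectSum.decompose_coe]
  exact DirectSum.component.lof_self (R := R) (ι := ℕ) (M := fun i => ⋀[R]^i V) 2 ω

theorem extProj_one : extProj R V 1 = 0 := by
  have : (1 : ExteriorAlgebra R V) ∈ ⋀[R]^0 V := SetLike.GradedOne.one_mem
  simp only [extProj, LinearMap.comp_apply, DirectSum.component]
  apply Subtype.ext
  exact DirectSum.decompose_of_mem_ne (fun i : ℕ => ⋀[R]^i V) this (by norm_num)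

theorem algebraMapInv_coe (ω : ⋀[R]^2 V) :
    ExteriorAlgebra.algebraMapInv (ω : ExteriorAlgebra R V) = 0 := by
  have hω : ω ∈ Submodule.span R (Set.range (exteriorPower.ιMulti R 2 (M := V))) := by
    rw [exteriorPower.ιMulti_span]; exact Submodule.mem_top
  induction hω using Submodule.span_induction with
  | mem s hs =>
    obtain ⟨m, rfl⟩ := hs
    rw [exteriorPower.ιMulti_apply_coe, ExteriorAlgebra.ιMulti_apply]
    simp [List.ofFn_succ, ExteriorAlgebra.algebraMapInv]
  | zero => simp
  | add a b _ _ ha hb => simp [ha, hb]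
  | smul r a _ ha => simp [ha]

namespace GenClifford

/-- An element of the kernel of `R ⊕ Λ²(V) ⊗ I⁻¹ → Λ(V) ⊗ L[I]` becomes zero when `I` and `I⁻¹` are
mapped to `B` compatibly with the pairing. -/
theorem eq_zero_of_lambdaEv_eq_zero (g : I →ₗ[R] B) (h : D →ₗ[R] B)
    (hgh : ∀ i d, g i * h d = algebraMap R B (ev d i)) {r : R} {ω : ⋀[R]^2 V ⊗[R] D}
    (h0 : lambdaEv V ev (r, ω) = 0) :
    algebraMap R B r = 0 ∧ TensorProduct.map LinearMap.id h ω = 0 := by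
  have e : lambdaEv V ev (r, ω) =
      r • (1 ⊗ₜ 1) + TensorProduct.map (⋀[R]^2 V).subtype (LaurentRees.ιD ev) ω := by
    simp [lambdaEv, Algebra.algebraMap_eq_smul_one, Algebra.TensorProduct.one_def]
  rw [e] at h0
  constructor
  · have h1 := congrArg (TensorProduct.lid R B ∘ TensorProduct.map
      (ExteriorAlgebra.algebraMapInv (R := R) (M := V)).toLinearMap
      (LaurentRees.coeff g h hgh 0)) h0
    have h2 : TensorProduct.map (ExteriorAlgebra.algebraMapInv (R := R) (M := V)).toLinearMap
        (LaurentRees.coeff g h hgh 0)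
        (TensorProduct.map (⋀[R]^2 V).subtype (LaurentRees.ιD ev) ω) = 0 := by
      rw [← LinearMap.comp_apply, ← TensorProduct.map_comp]
      have : (ExteriorAlgebra.algebraMapInv (R := R) (M := V)).toLinearMap ∘ₗ
          (⋀[R]^2 V).subtype = 0 := LinearMap.ext algebraMapInv_coe
      rw [this, TensorProduct.map_zero_left, LinearMap.zero_apply]
    simp only [Function.comp_apply, map_add, h2, map_smul, TensorProduct.map_tmul,
      LaurentRees.coeff_one, map_zero] at h1
    simpa [Algebra.algebraMap_eq_smul_one] using h1
  · have h1 := congrArg (TensorProduct.map (extProj R V) (LaurentRees.coeff g h hgh (-1))) h0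
    rw [map_add, map_smul, TensorProduct.map_tmul, extProj_one, TensorProduct.zero_tmul, smul_zero,
      zero_add, map_zero, ← LinearMap.comp_apply, ← TensorProduct.map_comp] at h1
    have e1 : extProj R V ∘ₗ (⋀[R]^2 V).subtype = LinearMap.id := LinearMap.ext extProj_coe
    have e2 : LaurentRees.coeff g h hgh (-1) ∘ₗ LaurentRees.ιD ev = h := LinearMap.ext fun d => by
      rw [LinearMap.comp_apply, LaurentRees.coeff_ιD]; simp
    rwa [e1, e2] at h1

variable {q : QuadraticMap R V I}

variable (ev q) in
/-- The element `x y ζ` of the even Clifford algebra, for `x`, `y` in `V` and `ζ` in `I⁻¹`. -/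
noncomputable def evenMul (x y : V) (d : D) : C0 ev q :=
  ⟨ιV ev q x * ιV ev q y * ιD ev q d, Submodule.subset_span (by
    simpa [mul_assoc] using IsMonomial.mk (ev := ev) (q := q) [x, y] [] [d])⟩

theorem psiExt_one (b : V →ₗ[R] V →ₗ[R] I) (hb : ∀ x, q x = b x x) :
    psiExt ev b hb 1 = lambdaEv V ev (1, 0) := by
  simp only [psiExt, LinearMap.comp_apply, psi_one, AlgHom.toLinearMap_apply, map_one]
  simp [lambdaEv, Algebra.TensorProduct.one_def]

/-- `ψ_b(x y ζ) = ζ(b(x, y)) + (x ∧ y) ⊗ ζ`. -/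
theorem psiExt_evenMul (b : V →ₗ[R] V →ₗ[R] I) (hb : ∀ x, q x = b x x) (x y : V) (d : D) :
    psiExt ev b hb (evenMul ev q x y d) =
      lambdaEv V ev (ev d (b x y), exteriorPower.ιMulti R 2 ![x, y] ⊗ₜ d) := by
  have e1 : ∀ q : QuadraticMap R V I, ιD ev q d = ofL ev q (LaurentRees.ιD ev d) := fun _ => rfl
  rw [lambdaEv_tmul]
  simp only [psiExt, LinearMap.comp_apply, evenMul, mul_assoc]
  rw [psi_ιV, psi_ιV, e1 q, psi_ofL_self, contr_ofL_self, add_zero, contr_ιV, contr_ofL_self,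
    mul_zero, sub_zero, ← e1, pair_eq, Algebra.algebraMap_eq_smul_one, e1]
  simp only [AlgHom.toLinearMap_apply, map_add, map_mul, map_smul, map_one, toExterior_ιV,
    toExterior_ofL, Algebra.TensorProduct.tmul_mul_tmul, one_mul, mul_one]
  rw [add_comm]

section

variable {b : V →ₗ[R] V →ₗ[R] I} {hb : ∀ x, q x = b x x}
  {e : C0 ev q ≃ₗ[R] R × (⋀[R]^2 V ⊗[R] D)}

theorem psiEquiv_one (hinj : Function.Injective (lambdaEv V ev))
    (he : ∀ c : C0 ev q, lambdaEv V ev (e c) = psiExt ev b hb c) : e 1 = (1, 0) :=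
  hinj ((he 1).trans (psiExt_one b hb))

theorem psiEquiv_evenMul (hinj : Function.Injective (lambdaEv V ev))
    (he : ∀ c : C0 ev q, lambdaEv V ev (e c) = psiExt ev b hb c) (x y : V) (d : D) :
    e (evenMul ev q x y d) = (ev d (b x y), exteriorPower.ιMulti R 2 ![x, y] ⊗ₜ d) :=
  hinj ((he _).trans (psiExt_evenMul b hb x y d))

/-- The even Clifford algebra is spanned by `1` and the products `x y ζ`. -/
theorem mem_of_evenMul (hinj : Function.Injective (lambdaEv V ev))
    (he : ∀ c : C0 ev q, lambdaEv V ev (e c) = psiExt ev b hb c)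
    (N : Submodule R (C0 ev q)) (h1 : 1 ∈ N) (h2 : ∀ x y d, evenMul ev q x y d ∈ N)
    (c : C0 ev q) : c ∈ N := by
  suffices h : ∀ t, e.symm t ∈ N by simpa using h (e c)
  have hr : ∀ r : R, e.symm (r, 0) ∈ N := fun r => by
    have : e (r • 1) = (r, 0) := by rw [map_smul, psiEquiv_one hinj he]; simp
    rw [← this, e.symm_apply_apply]
    exact N.smul_mem r h1
  have hm : ∀ (ω : ⋀[R]^2 V) (d : D), e.symm ((0 : R), ω ⊗ₜ d) ∈ N := fun ω d => by
    have hω : ω ∈ Submodule.span R (Set.range (exteriorPower.ιMulti R 2 (M := V))) := by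
      rw [exteriorPower.ιMulti_span]; exact Submodule.mem_top
    induction hω using Submodule.span_induction with
    | mem s hs =>
      obtain ⟨m, rfl⟩ := hs
      have hm : m = ![m 0, m 1] := by ext j; fin_cases j <;> rfl
      have e1 : ((0 : R), exteriorPower.ιMulti R 2 m ⊗ₜ[R] d) =
          e (evenMul ev q (m 0) (m 1) d) + (-ev d (b (m 0) (m 1)), 0) := by
        rw [psiEquiv_evenMul hinj he, ← hm]; simp
      rw [e1, map_add, e.symm_apply_apply]
      exact N.add_mem (h2 _ _ _) (hr _)
    | zero => rw [TensorProduct.zero_tmul]; exact hr 0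
    | add a b _ _ ha hb =>
      have e : ((0 : R), (a + b) ⊗ₜ[R] d) = (0, a ⊗ₜ d) + (0, b ⊗ₜ d) := by
        rw [TensorProduct.add_tmul]; simp
      rw [e, map_add]; exact N.add_mem ha hb
    | smul r a _ ha =>
      have e : ((0 : R), (r • a) ⊗ₜ[R] d) = r • (0, a ⊗ₜ d) := by
        rw [← TensorProduct.smul_tmul']; simp
      rw [e, map_smul]; exact N.smul_mem _ ha
  have h3 : ∀ ω, e.symm ((0 : R), ω) ∈ N := fun ω => by
    induction ω using TensorProduct.induction_on with
    | zero => exact hr 0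
    | tmul ω d => exact hm ω d
    | add a b ha hb =>
      have e : ((0 : R), a + b) = (0, a) + (0, b) := by simp
      rw [e, map_add]; exact N.add_mem ha hb
  rintro ⟨r, ω⟩
  have e : (r, ω) = (r, 0) + (0, ω) := by simp
  rw [e, map_add]
  exact N.add_mem (hr r) (h3 ω)

end

variable (ev q) in
/-- `p` is the canonical projection `C₀(V, q, I) → Λ²(V) ⊗ I⁻¹`, which sends `x y ζ` to
`(x ∧ y) ⊗ ζ` and has kernel `R · 1`. The last condition says that `1` and the products `x y ζ`
span the even Clifford algebra, which makes `p` unique. -/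
structure IsLamProj (p : C0 ev q →ₗ[R] ⋀[R]^2 V ⊗[R] D) : Prop where
  one : p 1 = 0
  evenMul : ∀ x y d, p (evenMul ev q x y d) = exteriorPower.ιMulti R 2 ![x, y] ⊗ₜ d
  surj : Function.Surjective p
  ker : ∀ c, p c = 0 → ∃ r, c = algebraMap R _ r
  gen : ∀ N : Submodule R (C0 ev q), 1 ∈ N → (∀ x y d, GenClifford.evenMul ev q x y d ∈ N) →
    ∀ c, c ∈ N

theorem isLamProj_psiEquiv {b : V →ₗ[R] V →ₗ[R] I} {hb : ∀ x, q x = b x x}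
    {e : C0 ev q ≃ₗ[R] R × (⋀[R]^2 V ⊗[R] D)} (hinj : Function.Injective (lambdaEv V ev))
    (he : ∀ c : C0 ev q, lambdaEv V ev (e c) = psiExt ev b hb c) :
    IsLamProj ev q (LinearMap.snd R R _ ∘ₗ e.toLinearMap) where
  one := congrArg Prod.snd (psiEquiv_one hinj he)
  evenMul x y d := congrArg Prod.snd (psiEquiv_evenMul hinj he x y d)
  surj := Prod.snd_surjective.comp e.surjective
  ker c hc := by
    refine ⟨(e c).1, e.injective ?_⟩
    rw [Algebra.algebraMap_eq_smul_one, map_smul, psiEquiv_one hinj he]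
    exact Prod.ext (by simp) ((show (e c).2 = 0 from hc).trans (by simp))
  gen := mem_of_evenMul hinj he

namespace IsLamProj

variable {p p₂ : C0 ev q →ₗ[R] ⋀[R]^2 V ⊗[R] D}

theorem unique (hp : IsLamProj ev q p) (hp₂ : IsLamProj ev q p₂) : p = p₂ :=
  LinearMap.ext fun c => hp.gen (LinearMap.eqLocus p p₂) (hp.one.trans hp₂.one.symm)
    (fun x y d => (hp.evenMul x y d).trans (hp₂.evenMul x y d).symm) c

/-- The projections are compatible with semilinear maps. -/
theorem map {S : Type u} [CommRing S] {σ : R →+* S} {V' I' D' : Type u}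
    [AddCommGroup V'] [Module S V'] [AddCommGroup I'] [Module S I'] [AddCommGroup D'] [Module S D']
    {ev' : D' →ₗ[S] I' →ₗ[S] S} {q' : QuadraticMap S V' I'} {p' : C0 ev' q' →ₗ[S] ⋀[S]^2 V' ⊗[S] D'}
    (hp : IsLamProj ev q p) (hp' : IsLamProj ev' q' p') (v : V →ₛₗ[σ] V') (i : I →ₛₗ[σ] I')
    (d : D →ₛₗ[σ] D') (hq : ∀ x, q' (v x) = i (q x)) (hev : ∀ a δ, ev' (d δ) (i a) = σ (ev δ a))
    (c : C0 ev q) : p' (mapC0 v i d hq hev c) = lamMap v d (p c) := by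
  let N : Submodule R (C0 ev q) :=
    { carrier := {c | p' (mapC0 v i d hq hev c) = lamMap v d (p c)}
      add_mem' := fun {a b} ha hb => by
        simp only [Set.mem_ofPred_eq] at ha hb ⊢
        rw [map_add, map_add, map_add, map_add, ha, hb]
      zero_mem' := by simp
      smul_mem' := fun r a ha => by
        simp only [Set.mem_ofPred_eq] at ha ⊢
        have : mapC0 v i d hq hev (r • a) = σ r • mapC0 v i d hq hev a :=
          Subtype.ext (GenClifford.map_smul' v i d hq hev r a)
        rw [this, map_smul, map_smul, LinearMap.map_smulₛₗ, ha] }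
  refine hp.gen N ?_ (fun x y δ => ?_) c
  · change p' (mapC0 v i d hq hev 1) = lamMap v d (p 1)
    rw [map_one, hp.one, hp'.one, map_zero]
  · change p' (mapC0 v i d hq hev (GenClifford.evenMul ev q x y δ)) = lamMap v d (p _)
    have : mapC0 v i d hq hev (GenClifford.evenMul ev q x y δ) =
        GenClifford.evenMul ev' q' (v x) (v y) (d δ) := by
      apply Subtype.ext
      change GenClifford.map v i d hq hev (_ * _ * _) = _ * _ * _
      rw [map_mul, map_mul, map_ιV, map_ιV, map_ιD]
    rw [this, hp'.evenMul, hp.evenMul, lamMap_tmul]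
    congr 2
    ext j; fin_cases j <;> rfl

variable {V' I' D' : Type u} [AddCommGroup V'] [Module R V'] [AddCommGroup I'] [Module R I']
  [AddCommGroup D'] [Module R D'] {ev' : D' →ₗ[R] I' →ₗ[R] R} {q' : QuadraticMap R V' I'}
  {p' : C0 ev' q' →ₗ[R] ⋀[R]^2 V' ⊗[R] D'}

/-- An algebra isomorphism preserves the kernels `R · 1` of the projections. -/
theorem apply_eq_zero (hp : IsLamProj ev q p) (hp' : IsLamProj ev' q' p')
    (φ : C0 ev q ≃ₐ[R] C0 ev' q') {c : C0 ev q} (hc : p c = 0) : p' (φ c) = 0 := by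
  obtain ⟨r, rfl⟩ := hp.ker c hc
  rw [AlgEquiv.commutes, Algebra.algebraMap_eq_smul_one, map_smul, hp'.one, smul_zero]

/-- The isomorphism `Λ²(V) ⊗ I⁻¹ ≅ Λ²(V') ⊗ I'⁻¹` induced by an isomorphism of even Clifford
algebras. -/
noncomputable def transfer (hp : IsLamProj ev q p) (hp' : IsLamProj ev' q' p')
    (φ : C0 ev q ≃ₐ[R] C0 ev' q') : (⋀[R]^2 V ⊗[R] D) ≃ₗ[R] (⋀[R]^2 V' ⊗[R] D') :=
  quotEquiv (M := ⋀[R]^2 V ⊗[R] D) (M' := ⋀[R]^2 V' ⊗[R] D') hp.surj hp'.surj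
    φ.toLinearEquiv (fun _ => hp.apply_eq_zero hp' φ)
    (fun _ => hp'.apply_eq_zero hp φ.symm)

theorem transfer_apply (hp : IsLamProj ev q p) (hp' : IsLamProj ev' q' p')
    (φ : C0 ev q ≃ₐ[R] C0 ev' q') (c : C0 ev q) :
    hp.transfer hp' φ (p c) = p' (φ c) :=
  quotEquiv_apply (M := ⋀[R]^2 V ⊗[R] D) (M' := ⋀[R]^2 V' ⊗[R] D') _ _ _ _ _ c

end IsLamProj

end GenClifford

end Algebra
end QuadBundle

/-! ### The Bourbaki isomorphism over affine open sets -/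

namespace QuadBundle
open CategoryTheory AlgebraicGeometry
open scoped TensorProduct

/-- A map of tensor products that factors through `id ⊗ h : M ⊗ D → M ⊗ B` kills the kernel of
`id ⊗ h`. -/
theorem eq_zero_of_map_id_eq_zero {R B : Type u} [CommRing R] [CommRing B] [Algebra R B]
    {M D N D' : Type u} [AddCommGroup M] [Module R M] [AddCommGroup D] [Module R D]
    [AddCommGroup N] [Module B N] [AddCommGroup D'] [Module B D'] (ℓ : M →ₛₗ[algebraMap R B] N)
    (h : D →ₗ[R] B) (d₀ : D') (t : M ⊗[R] D →ₛₗ[algebraMap R B] N ⊗[B] D')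
    (ht : ∀ m δ, t (m ⊗ₜ δ) = ℓ m ⊗ₜ (h δ • d₀)) {ω : M ⊗[R] D}
    (hω : TensorProduct.map LinearMap.id h ω = 0) : t ω = 0 := by
  let _ : Module R (N ⊗[B] D') := Module.compHom _ (algebraMap R B)
  let β : M →ₗ[R] B →ₗ[R] N ⊗[B] D' := LinearMap.mk₂ R (fun m c => ℓ m ⊗ₜ[B] (c • d₀))
    (fun a b c => by rw [map_add, TensorProduct.add_tmul])
    (fun s a c => by rw [LinearMap.map_smulₛₗ]; exact TensorProduct.smul_tmul' _ _ _)
    (fun a c c' => by rw [add_smul, TensorProduct.tmul_add])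
    (fun s a c => by
      rw [Algebra.smul_def, mul_smul]; exact TensorProduct.tmul_smul _ _ _)
  have hβ : ∀ ω, t ω = TensorProduct.lift β (TensorProduct.map LinearMap.id h ω) := fun ω => by
    induction ω using TensorProduct.induction_on with
    | zero => rw [map_zero, map_zero, map_zero]
    | tmul m δ => rw [TensorProduct.map_tmul, TensorProduct.lift.tmul]; exact ht m δ
    | add a b ha hb => rw [map_add, ha, hb, map_add, map_add]
  rw [hβ, hω, map_zero]

section Sheaf

variable {X : Scheme.{u}} (P : BundlePair X)

/-- The fourth exterior power of a vector bundle of rank three vanishes. -/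
theorem ιMulti_four_eq_zero {U : X.Opens} (hU : IsAffineOpen U) (m : Fin 4 → Γ(P.V, U)) :
    ExteriorAlgebra.ιMulti Γ(X, U) 4 m = 0 := by
  suffices h : exteriorPower.ιMulti Γ(X, U) 4 m = 0 by
    rw [← exteriorPower.ιMulti_apply_coe, h]; rfl
  refine eq_zero_of_torsion hU _ fun x hx => ?_
  obtain ⟨g, hxg, v, hv⟩ :=
    P.isVectorBundle.hasFrames.exists_basicOpen (secRes_isModSheaf _) hU hx
  have hg := X.basicOpen_le g
  refine ⟨g, hxg, ((isAway_V P hU g hg rfl).extMap (isRingAway_res hU g hg rfl) 4).torsion _ ?_⟩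
  rw [extMap_ιMulti]
  have : exteriorPower.ιMulti Γ(X, X.basicOpen g) 4 (M := Γ(P.V, X.basicOpen g)) = 0 := by
    refine Module.Basis.ext_alternating (hv.basis le_rfl) fun c hc => ?_
    exact absurd (Fintype.card_le_of_injective c hc) (by simp)
  rw [this]; rfl

/-- `𝒪 ⊕ Λ²(V) ⊗ I⁻¹` is a submodule of `Λ(V) ⊗ L[I]`. It suffices to see that an element of the
kernel is torsion locally, where `I` has a frame and `L[I]` maps to Laurent polynomials. -/
theorem lambdaEv_injective (U : X.affineOpens) :
    Function.Injective (GenClifford.lambdaEv Γ(P.V, U.1) (evalPair P.I U.1)) := by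
  rw [injective_iff_map_eq_zero]
  rintro ⟨r, ω⟩ h0
  have key : ∀ x ∈ U.1, ∃ g : Γ(X, U.1), x ∈ X.basicOpen g ∧
      (∃ n : ℕ, g ^ n • r = 0) ∧ ∃ n : ℕ, g ^ n • ω = 0 := fun x hx => by
    obtain ⟨f, hxf, i₀, hi⟩ :=
      P.isLineBundle.hasFrames.exists_basicOpen (secRes_isModSheaf _) U.2 hx
    let W : X.affineOpens := ⟨X.basicOpen f, U.2.basicOpen f⟩
    have hW : W ≤ U := X.basicOpen_le f
    refine ⟨f, hxf, ?_⟩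
    let _ : Algebra Γ(X, U.1) Γ(X, W.1) := (res (X := X) (U := U.1) (W := W.1) hW).toAlgebra
    let d₀ : DualSec P.I W.1 := dualFrame hi
    let g : Γ(P.I, U.1) →ₗ[Γ(X, U.1)] Γ(X, W.1) :=
      { toFun := fun a => evalPair P.I W.1 d₀ (secRes P.I hW a)
        map_add' := fun a b => by rw [map_add, map_add]
        map_smul' := fun c a => by rw [LinearMap.map_smulₛₗ, map_smul]; rfl }
    let h : DualSec P.I U.1 →ₗ[Γ(X, U.1)] Γ(X, W.1) :=
      { toFun := fun δ => evalPair P.I W.1 (dualRes P.I hW δ) (i₀ 0)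
        map_add' := fun a b => by rw [map_add, map_add]; rfl
        map_smul' := fun c a => by rw [LinearMap.map_smulₛₗ, map_smul]; rfl }
    have h1 : evalPair P.I W.1 d₀ (i₀ 0) = 1 := by
      have := dualFrame_apply hi (le_refl W.1)
      rwa [(show secRes P.I (le_refl W.1) (i₀ 0) = i₀ 0 from
        congrArg (fun f => f.hom (i₀ 0)) (P.I.presheaf.map_id (Opposite.op W.1)))] at this
    have hI : ∀ a : Γ(P.I, W.1), a = evalPair P.I W.1 d₀ a • i₀ 0 := fun a => by
      obtain ⟨c, hc⟩ := (hi (le_refl W.1)).2 a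
      have hi0 : secRes P.I (le_refl W.1) (i₀ 0) = i₀ 0 :=
        congrArg (fun f => f.hom (i₀ 0)) (P.I.presheaf.map_id (Opposite.op W.1))
      simp only [Fin.sum_univ_one, hi0] at hc
      rw [← hc, map_smul, h1, smul_eq_mul, mul_one]
    have hD : ∀ δ : DualSec P.I W.1, δ = evalPair P.I W.1 δ (i₀ 0) • d₀ := fun δ => by
      obtain ⟨c, hc⟩ := (dualFrame_isFrame hi (le_refl W.1)).2 δ
      simp only [Fin.sum_univ_one] at hc
      have hd : dualRes P.I (le_refl W.1) (dualFrame hi) = d₀ := rfl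
      rw [hd] at hc
      rw [← hc, map_smul, LinearMap.smul_apply, h1, smul_eq_mul, mul_one]
    have hgh : ∀ a δ, g a * h δ = algebraMap Γ(X, U.1) Γ(X, W.1) (evalPair P.I U.1 δ a) :=
      fun a δ => by
        change _ = res hW _
        rw [← evalPair_res P.I hW a δ, hI (secRes P.I hW a), map_smul]
        rfl
    obtain ⟨e1, e2⟩ := GenClifford.eq_zero_of_lambdaEv_eq_zero g h hgh h0
    refine ⟨res_torsion U.2 f hW rfl e1, (isAway_lamRes P f hW rfl).torsion ω ?_⟩
    refine eq_zero_of_map_id_eq_zero (extMap (secRes P.V hW) 2) h d₀ (lamRes P hW)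
      (fun ω δ => ?_) e2
    refine (lamMap_eq _ _ ω δ).trans ?_
    -- `d₀` trivializes `I⁻¹` over `W`
    rw [hD (dualRes P.I hW δ)]
    rfl
  have hr : r = 0 := eq_zero_of_torsion U.2 r fun x hx => by
    obtain ⟨g, hxg, h1, -⟩ := key x hx
    exact ⟨g, hxg, h1⟩
  have hω : ω = 0 := eq_zero_of_torsion U.2 ω fun x hx => by
    obtain ⟨g, hxg, -, h1⟩ := key x hx
    exact ⟨g, hxg, h1⟩
  rw [hr, hω]; rfl

variable {P} {P' P'' : BundlePair X} (q : QuadForm P) (q' : QuadForm P')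

theorem QuadForm.exists_inducedBy (U : X.affineOpens) : ∃ b : BilSec P U, q.InducedBy U b :=
  have := projective_V P U.2
  exists_bilin (q.form U.1)

variable {q q'}

theorem IsPsi.unique {U : X.affineOpens} {b : BilSec P U}
    {e e' : EvenSec q U ≃ₗ[Γ(X, U.1)] Γ(X, U.1) × LamSec P U} (he : IsPsi q U b e)
    (he' : IsPsi q U b e') : e = e' := by
  obtain ⟨hb, he⟩ := he
  obtain ⟨_, he'⟩ := he'
  exact LinearEquiv.ext fun c => lambdaEv_injective P U ((he c).trans (he' c).symm)

theorem QuadForm.InducedBy.exists_isPsi {U : X.affineOpens} {b : BilSec P U}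
    (hb : q.InducedBy U b) : ∃ e, IsPsi q U b e := by
  obtain ⟨e, he⟩ := GenClifford.exists_psiEquiv (ιMulti_four_eq_zero P U.2)
    (lambdaEv_injective P U) b hb
  exact ⟨e, hb, he⟩

end Sheaf
end QuadBundle

/-! ### The isomorphism of exterior parts induced by an algebra isomorphism -/

namespace QuadBundle
open CategoryTheory AlgebraicGeometry
open scoped TensorProduct

/-- Linear maps on a localization are determined by their values on the localized module. -/
theorem IsAway.hom_ext {R B : Type u} [CommRing R] [CommRing B] {σ : R →+* B} {M N N' : Type u}
    [AddCommGroup M] [Module R M] [AddCommGroup N] [Module B N] [AddCommGroup N'] [Module B N']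
    {f : R} {ℓ : M →ₛₗ[σ] N} (hℓ : IsAway f ℓ) {F G : N →ₗ[B] N'} (h : ∀ m, F (ℓ m) = G (ℓ m)) :
    F = G := by
  refine LinearMap.ext fun y => ?_
  obtain ⟨n, x, hx⟩ := hℓ.surj y
  apply (hℓ.isUnit.pow n).smul_left_cancel.1
  rw [← map_smul, ← map_smul, hx, h]

section Sheaf

variable {X : Scheme.{u}} {P P' P'' : BundlePair X} {q : QuadForm P} {q' : QuadForm P'}
  {q'' : QuadForm P''}

theorem QuadForm.exists_isLamProj (q : QuadForm P) (U : X.affineOpens) :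
    ∃ p, GenClifford.IsLamProj (evalPair P.I U.1) (q.form U.1) p := by
  obtain ⟨b, hb⟩ := q.exists_inducedBy U
  obtain ⟨e, _, he⟩ := hb.exists_isPsi
  exact ⟨_, GenClifford.isLamProj_psiEquiv (lambdaEv_injective P U) he⟩

/-- The canonical projection `C₀(V, q, I) → Λ²(V) ⊗ I⁻¹` on sections over an affine open set. -/
noncomputable def lamProj (q : QuadForm P) (U : X.affineOpens) :
    EvenSec q U →ₗ[Γ(X, U.1)] LamSec P U :=
  (q.exists_isLamProj U).choose

theorem isLamProj (q : QuadForm P) (U : X.affineOpens) :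
    GenClifford.IsLamProj (evalPair P.I U.1) (q.form U.1) (lamProj q U) :=
  (q.exists_isLamProj U).choose_spec

/-- The second component of `ψ_b` does not depend on `b`. -/
theorem IsPsi.snd_eq {U : X.affineOpens} {b : BilSec P U}
    {e : EvenSec q U ≃ₗ[Γ(X, U.1)] Γ(X, U.1) × LamSec P U} (he : IsPsi q U b e)
    (c : EvenSec q U) : (e c).2 = lamProj q U c := by
  obtain ⟨_, he⟩ := he
  exact LinearMap.congr_fun
    ((GenClifford.isLamProj_psiEquiv (lambdaEv_injective P U) he).unique (isLamProj q U)) c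

theorem lamProj_surjective (q : QuadForm P) {U : X.affineOpens} (ω : LamSec P U) :
    ∃ c, lamProj q U c = ω :=
  (isLamProj q U).surj ω

/-- The projection `C₀(V, q, I) → Λ²(V) ⊗ I⁻¹` is compatible with restriction. -/
theorem lamProj_evenRes {U W : X.affineOpens} (h : W ≤ U) (c : EvenSec q U) :
    lamProj q W (evenRes q h c) = lamRes P h (lamProj q U c) :=
  (isLamProj q U).map (isLamProj q W) _ _ _ _ _ c

/-- The isomorphism `φ_{Λ²}` induced by `φ`, over an affine open set. -/
noncomputable def transferApp (φ : EvenIso q q') (U : X.affineOpens) :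
    LamSec P U ≃ₗ[Γ(X, U.1)] LamSec P' U :=
  (isLamProj q U).transfer (isLamProj q' U) (φ.app U)

theorem transferApp_lamProj (φ : EvenIso q q') (U : X.affineOpens) (c : EvenSec q U) :
    transferApp φ U (lamProj q U c) = lamProj q' U (φ.app U c) :=
  (isLamProj q U).transfer_apply (isLamProj q' U) (φ.app U) c

theorem transferApp_res (φ : EvenIso q q') {U W : X.affineOpens} (h : W ≤ U) (ω : LamSec P U) :
    transferApp φ W (lamRes P h ω) = lamRes P' h (transferApp φ U ω) := by
  obtain ⟨c, rfl⟩ := lamProj_surjective q ω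
  calc transferApp φ W (lamRes P h (lamProj q U c))
      = transferApp φ W (lamProj q W (evenRes q h c)) := congrArg _ (lamProj_evenRes h c).symm
    _ = lamProj q' W (φ.app W (evenRes q h c)) := transferApp_lamProj φ W _
    _ = lamProj q' W (evenRes q' h (φ.app U c)) := congrArg _ (φ.app_res h c)
    _ = lamRes P' h (lamProj q' U (φ.app U c)) := lamProj_evenRes h _
    _ = lamRes P' h (transferApp φ U (lamProj q U c)) :=
      congrArg _ (transferApp_lamProj φ U c).symm

/-- The isomorphism `φ_{Λ²}` induced by an isomorphism `φ` of even Clifford algebras. -/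
noncomputable def transfer (φ : EvenIso q q') : LamIso P P' where
  app := transferApp φ
  app_res h ω := transferApp_res φ h ω

theorem transfer_lamProj (φ : EvenIso q q') (U : X.affineOpens) (c : EvenSec q U) :
    (transfer φ).app U (lamProj q U c) = lamProj q' U (φ.app U c) :=
  transferApp_lamProj φ U c

theorem transfer_isTransfer (φ : EvenIso q q') : IsTransfer φ (transfer φ) := by
  intro U b b' _ _ e e' he he' r ω
  rw [he'.snd_eq, ← transfer_lamProj, ← he.snd_eq, e.apply_symm_apply]

theorem IsTransferAt.app_eq {φ : EvenIso q q'} {f : LamIso P P'} {U : X.affineOpens}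
    {b : BilSec P U} {b' : BilSec P' U} (hf : IsTransferAt φ f U b b') (hb : q.InducedBy U b)
    (hb' : q'.InducedBy U b') : f.app U = (transfer φ).app U := by
  obtain ⟨e, he⟩ := hb.exists_isPsi
  obtain ⟨e', he'⟩ := hb'.exists_isPsi
  exact LinearEquiv.ext fun ω =>
    (hf e e' he he' 0 ω).symm.trans (transfer_isTransfer φ U b b' hb hb' e e' he he' 0 ω)

theorem LamIso.app_eq_of_basicOpen {f g : LamIso P P'} {U W : X.affineOpens}
    (h : f.app U = g.app U) (s : Γ(X, U.1)) (hWU : W ≤ U) (hW : W.1 = X.basicOpen s) :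
    f.app W = g.app W := by
  refine LinearEquiv.toLinearMap_injective
    (IsAway.hom_ext (M := LamSec P U) (N := LamSec P W) (N' := LamSec P' W)
      (F := (f.app W).toLinearMap) (G := (g.app W).toLinearMap) (isAway_lamRes P s hWU hW)
      fun η => ?_)
  calc f.app W (lamRes P hWU η) = lamRes P' hWU (f.app U η) := f.app_res hWU η
    _ = lamRes P' hWU (g.app U η) := congrArg (fun k => lamRes P' hWU (k η)) h
    _ = g.app W (lamRes P hWU η) := (g.app_res hWU η).symm

theorem LamIso.torsion_of_basicOpen {f g : LamIso P P'} {U W : X.affineOpens}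
    (h : f.app W = g.app W) (s : Γ(X, U.1)) (hWU : W ≤ U) (hW : W.1 = X.basicOpen s)
    (ω : LamSec P U) : ∃ n : ℕ, s ^ n • (f.app U ω - g.app U ω) = 0 := by
  refine (isAway_lamRes P' s hWU hW).torsion _ ((map_sub (lamRes P' hWU) _ _).trans ?_)
  refine sub_eq_zero.2 ?_
  calc lamRes P' hWU (f.app U ω) = f.app W (lamRes P hWU ω) := (f.app_res hWU ω).symm
    _ = g.app W (lamRes P hWU ω) := congrArg (fun k => k (lamRes P hWU ω)) h
    _ = lamRes P' hWU (g.app U ω) := g.app_res hWU ω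

/-- Morphisms of vector bundles that agree on an affine open covering are equal. -/
theorem LamIso.ext_of_iSup_eq_top {f g : LamIso P P'} {J : Type*} (U : J → X.affineOpens)
    (hU : (⨆ j, (U j).1) = ⊤) (h : ∀ j, f.app (U j) = g.app (U j)) : f = g := by
  refine LamIso.ext (funext fun Y => LinearEquiv.ext fun ω => sub_eq_zero.1 ?_)
  refine eq_zero_of_torsion Y.2 _ fun x hx => ?_
  obtain ⟨j, hj⟩ := TopologicalSpace.Opens.mem_iSup.1 (hU ▸ TopologicalSpace.Opens.mem_top x)
  obtain ⟨s, t, hst, hxs⟩ := exists_basicOpen_le_affine_inter Y.2 (U j).2 x ⟨hx, hj⟩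
  let W : X.affineOpens := ⟨X.basicOpen s, Y.2.basicOpen s⟩
  have hW := app_eq_of_basicOpen (W := W) (h j) t (hst.trans_le (X.basicOpen_le t)) hst
  exact ⟨s, hxs, torsion_of_basicOpen hW s (X.basicOpen_le s) rfl ω⟩

theorem transfer_refl (q : QuadForm P) : transfer (EvenIso.refl q) = LamIso.refl P :=
  LamIso.ext (funext fun U => LinearEquiv.ext fun ω => by
    obtain ⟨c, rfl⟩ := lamProj_surjective q ω
    rw [transfer_lamProj]; rfl)

theorem transfer_trans (φ : EvenIso q q') (χ : EvenIso q' q'') :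
    transfer (φ.trans χ) = (transfer φ).trans (transfer χ) :=
  LamIso.ext (funext fun U => LinearEquiv.ext fun ω => by
    obtain ⟨c, rfl⟩ := lamProj_surjective q ω
    exact (transfer_lamProj (φ.trans χ) U c).trans ((congrArg ((transfer χ).app U)
      (transfer_lamProj φ U c)).trans (transfer_lamProj χ U (φ.app U c))).symm)

theorem IsTransfer.eq_transfer {φ : EvenIso q q'} {f : LamIso P P'} (hf : IsTransfer φ f) :
    f = transfer φ :=
  LamIso.ext (funext fun U => by
    obtain ⟨b, hb⟩ := q.exists_inducedBy U
    obtain ⟨b', hb'⟩ := q'.exists_inducedBy U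
    exact (hf U b b' hb hb').app_eq hb hb')

end Sheaf
end QuadBundle

/-! ### Determinants -/

namespace QuadBundle
open CategoryTheory AlgebraicGeometry
open scoped TensorProduct

section DetScalar

variable {R : Type u} [CommRing R] {M : Type u} [AddCommGroup M] [Module R M]

/-- The endomorphism `Λ³(f)` is multiplication by `c`; for `M` locally free of rank three this
means `det f = c`. -/
def IsDetScalar (f : M →ₗ[R] M) (c : R) : Prop :=
  exteriorPower.map 3 f = c • LinearMap.id

theorem IsDetScalar.id : IsDetScalar (LinearMap.id : M →ₗ[R] M) 1 := by
  rw [IsDetScalar, exteriorPower.map_id, one_smul]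

theorem IsDetScalar.comp {f g : M →ₗ[R] M} {c d : R} (hf : IsDetScalar f c)
    (hg : IsDetScalar g d) : IsDetScalar (g ∘ₗ f) (c * d) := by
  rw [IsDetScalar] at *
  rw [exteriorPower.map_comp, hf, hg]
  ext
  simp [smul_smul, mul_comm]

/-- On a free module of rank `n`, every alternating map in `n` variables is a multiple of the
determinant. -/
theorem AlternatingMap.apply_eq_det_smul {N : Type*} [AddCommGroup N] [Module R N] {n : ℕ}
    (e : Module.Basis (Fin n) R M) (φ : M [⋀^Fin n]→ₗ[R] N) (m : Fin n → M) :
    φ m = e.det m • φ e := by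
  have : φ = (LinearMap.toSpanSingleton R N (φ e)).compAlternatingMap e.det := by
    refine Module.Basis.ext_alternating e fun i h => ?_
    let σ : Equiv.Perm (Fin n) := Equiv.ofBijective i (Finite.injective_iff_bijective.1 h)
    change φ (e ∘ σ) = e.det (e ∘ σ) • φ e
    simp [AlternatingMap.map_perm, Module.Basis.det_self]
  conv_lhs => rw [this]
  rfl

/-- On a free module of rank three, `Λ³(f)` is multiplication by the determinant. -/
theorem isDetScalar_det (e : Module.Basis (Fin 3) R M) (f : M →ₗ[R] M) :
    IsDetScalar f (LinearMap.det f) := by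
  refine exteriorPower.linearMap_ext (AlternatingMap.ext fun m => ?_)
  change exteriorPower.map 3 f (exteriorPower.ιMulti R 3 m) =
    LinearMap.det f • exteriorPower.ιMulti R 3 m
  rw [exteriorPower.map_apply_ιMulti, AlternatingMap.apply_eq_det_smul e _ (f ∘ m),
    Module.Basis.det_comp, mul_smul, ← AlternatingMap.apply_eq_det_smul]

theorem IsDetScalar.eq_of_basis (e : Module.Basis (Fin 3) R M) {f : M →ₗ[R] M} {c c' : R}
    (h : IsDetScalar f c) (h' : IsDetScalar f c') : c = c' := by
  have h1 := LinearMap.congr_fun (h.symm.trans h') (exteriorPower.ιMulti R 3 e)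
  have h2 := congrArg (exteriorPower.alternatingMapLinearEquiv e.det) h1
  simpa [Module.Basis.det_self] using h2

variable {B : Type u} [CommRing B] {σ : R →+* B} {N : Type u} [AddCommGroup N] [Module B N]
  {ℓ : M →ₛₗ[σ] N}

/-- Naturality of `extMap`. -/
theorem map_extMap {f : M →ₗ[R] M} {g : N →ₗ[B] N} (h : ∀ m, g (ℓ m) = ℓ (f m)) (n : ℕ)
    (T : ⋀[R]^n M) :
    exteriorPower.map n g (extMap ℓ n T) = extMap ℓ n (exteriorPower.map n f T) := by
  have hT : T ∈ Submodule.span R (Set.range (exteriorPower.ιMulti R n (M := M))) := by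
    rw [exteriorPower.ιMulti_span]; exact Submodule.mem_top
  induction hT using Submodule.span_induction with
  | mem s hs =>
    obtain ⟨m, rfl⟩ := hs
    rw [extMap_ιMulti, exteriorPower.map_apply_ιMulti, exteriorPower.map_apply_ιMulti,
      extMap_ιMulti]
    exact congrArg _ (funext fun j => h (m j))
  | zero => simp only [map_zero]
  | add a b _ _ ha hb => simp only [map_add, ha, hb]
  | smul r a _ ha => rw [LinearMap.map_smulₛₗ, map_smul, map_smul, LinearMap.map_smulₛₗ, ha]

/-- Localization preserves determinants. -/
theorem IsDetScalar.of_isAway {s : R} (hσ : IsRingAway σ s) (hℓ : IsAway s ℓ) {f : M →ₗ[R] M}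
    {g : N →ₗ[B] N} (h : ∀ m, g (ℓ m) = ℓ (f m)) {c : R} (hf : IsDetScalar f c) :
    IsDetScalar g (σ c) := by
  refine (hℓ.extMap hσ 3).hom_ext fun T => ?_
  rw [map_extMap h, hf]
  simp

/-- `Λ³(f)` is multiplication by `c` up to `s`-torsion. -/
def IsDetScalarUpTo (s : R) (f : M →ₗ[R] M) (c : R) : Prop :=
  ∀ T : ⋀[R]^3 M, ∃ n : ℕ, s ^ n • (exteriorPower.map 3 f T - c • T) = 0

theorem IsDetScalar.torsion {s : R} (hσ : IsRingAway σ s) (hℓ : IsAway s ℓ) {f : M →ₗ[R] M}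
    {g : N →ₗ[B] N} (h : ∀ m, g (ℓ m) = ℓ (f m)) {c : R} (hg : IsDetScalar g (σ c)) :
    IsDetScalarUpTo s f c := by
  intro T
  refine (hℓ.extMap hσ 3).torsion _ ?_
  rw [map_sub, ← map_extMap h, hg, LinearMap.map_smulₛₗ]
  simp

/-- A basis of `Λ²(V) ⊗ I⁻¹`, for `V` free of rank three and `I⁻¹` free of rank one. -/
theorem exists_basis_ext_tensor {D : Type u} [AddCommGroup D] [Module R D]
    (v : Module.Basis (Fin 3) R M) (d : Module.Basis (Fin 1) R D) :
    Nonempty (Module.Basis (Fin 3) R (⋀[R]^2 M ⊗[R] D)) := by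
  have hc : Nat.card (Set.powersetCard (Fin 3) 2 × Fin 1) = 3 := by
    rw [Nat.card_prod, Set.powersetCard.card]; simp
  exact ⟨((v.exteriorPower 2).tensorProduct d).reindex (Finite.equivFinOfCardEq hc)⟩

end DetScalar

section Sheaf

variable {X : Scheme.{u}} {P : BundlePair X}

theorem exists_lamSec_basis (P : BundlePair X) (U : X.affineOpens) {x : X} (hx : x ∈ U.1) :
    ∃ s : Γ(X, U.1), x ∈ X.basicOpen s ∧
      Nonempty (Module.Basis (Fin 3) Γ(X, X.basicOpen s)
        (LamSec P ⟨X.basicOpen s, U.2.basicOpen s⟩)) := by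
  obtain ⟨O, hxO, v, hv⟩ := P.isVectorBundle.hasFrames x
  obtain ⟨O', hxO', d, hd⟩ := P.isLineBundle.dual_hasFrames x
  obtain ⟨s, hs, hxs⟩ := U.2.exists_basicOpen_le (V := O ⊓ O') ⟨x, hxO, hxO'⟩ hx
  exact ⟨s, hxs, exists_basis_ext_tensor (hv.basis (hs.trans inf_le_left))
    (hd.basis (hs.trans inf_le_right))⟩

theorem isDetScalar_of_torsion {U : X.Opens} (hU : IsAffineOpen U) {M : Type u} [AddCommGroup M]
    [Module Γ(X, U) M] {f : M →ₗ[Γ(X, U)] M} {c : Γ(X, U)}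
    (h : ∀ x ∈ U, ∃ s : Γ(X, U), x ∈ X.basicOpen s ∧ IsDetScalarUpTo s f c) : IsDetScalar f c :=
  LinearMap.ext fun T => sub_eq_zero.1 (eq_zero_of_torsion hU
    (exteriorPower.map 3 f T - c • T) fun x hx => by
      obtain ⟨s, hxs, hs⟩ := h x hx
      exact ⟨s, hxs, hs T⟩)

namespace LamIso

/-- Over the affine open set `U`, the determinant of `f` is `c`. -/
def IsDetAt (f : LamIso P P) (U : X.affineOpens) (c : Γ(X, U.1)) : Prop :=
  IsDetScalar (R := Γ(X, U.1)) (M := LamSec P U) (f.app U).toLinearMap c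

variable {f : LamIso P P}

theorem IsDetAt.restrict {U W : X.affineOpens} {c : Γ(X, U.1)} (h : f.IsDetAt U c)
    (s : Γ(X, U.1)) (hWU : W ≤ U) (hW : W.1 = X.basicOpen s) :
    f.IsDetAt W (res (X := X) (U := U.1) (W := W.1) hWU c) :=
  IsDetScalar.of_isAway (M := LamSec P U) (N := LamSec P W) (isRingAway_res U.2 s hWU hW)
    (isAway_lamRes P s hWU hW) (fun m => f.app_res hWU m) h

theorem IsDetAt.unique {U : X.affineOpens} {c c' : Γ(X, U.1)} (h : f.IsDetAt U c)
    (h' : f.IsDetAt U c') : c = c' := by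
  refine sub_eq_zero.1 (eq_zero_of_torsion U.2 (c - c') fun x hx => ?_)
  obtain ⟨s, hxs, ⟨e⟩⟩ := exists_lamSec_basis P U hx
  let W : X.affineOpens := ⟨X.basicOpen s, U.2.basicOpen s⟩
  have hWU : W ≤ U := X.basicOpen_le s
  refine ⟨s, hxs, res_torsion U.2 s hWU rfl ?_⟩
  rw [map_sub, sub_eq_zero]
  exact IsDetScalar.eq_of_basis (M := LamSec P W) e (h.restrict (W := W) s hWU rfl)
    (h'.restrict (W := W) s hWU rfl)

theorem IsDetAt.upTo {U W : X.affineOpens} {c : Γ(X, U.1)} (s : Γ(X, U.1)) (hWU : W ≤ U)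
    (hW : W.1 = X.basicOpen s)
    (h : f.IsDetAt W (res (X := X) (U := U.1) (W := W.1) hWU c)) :
    IsDetScalarUpTo (R := Γ(X, U.1)) (M := LamSec P U) s (f.app U).toLinearMap c :=
  IsDetScalar.torsion (M := LamSec P U) (N := LamSec P W) (isRingAway_res U.2 s hWU hW)
    (isAway_lamRes P s hWU hW) (fun m => f.app_res hWU m) h

/-- The determinant can be computed on a covering by basic open sets. -/
theorem isDetAt_of_cover {U : X.affineOpens} {c : Γ(X, U.1)}
    (h : ∀ x ∈ U.1, ∃ s : Γ(X, U.1), x ∈ X.basicOpen s ∧ ∃ (W : X.affineOpens) (hWU : W ≤ U),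
      W.1 = X.basicOpen s ∧ f.IsDetAt W (res (X := X) (U := U.1) (W := W.1) hWU c)) :
    f.IsDetAt U c := by
  have key := @isDetScalar_of_torsion X U.1 U.2 (LamSec P U) inferInstance inferInstance
  refine @key (f.app U).toLinearMap c fun x hx => ?_
  obtain ⟨s, hxs, W, hWU, hW, hd⟩ := h x hx
  exact ⟨s, hxs, hd.upTo s hWU hW⟩

variable (f) in
/-- Determinants exist locally, where `Λ²(V) ⊗ I⁻¹` is free of rank three, and glue because they are
unique. -/
theorem exists_det : ∃ c : Γ(X, ⊤), ∀ U : X.affineOpens, f.IsDetAt U (res le_top c) := by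
  -- all affine open sets over which there is a determinant
  let J := {W : X.affineOpens // ∃ c, f.IsDetAt W c}
  choose d hd using fun W : J => W.2
  have hcov : ∀ x, ∃ W : J, x ∈ W.1.1 := fun x => by
    obtain ⟨O, hO, hxO, -⟩ := exists_isAffineOpen_mem_and_subset (TopologicalSpace.Opens.mem_top x)
    obtain ⟨s, hxs, ⟨e⟩⟩ := exists_lamSec_basis P ⟨O, hO⟩ hxO
    exact ⟨⟨⟨X.basicOpen s, hO.basicOpen s⟩, _, isDetScalar_det e _⟩, hxs⟩
  obtain ⟨c, hc⟩ := res_glue (X := X) (U := fun W : J => W.1.1) (V := ⊤) (fun _ => le_top)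
    (fun x _ => TopologicalSpace.Opens.mem_iSup.2 (hcov x)) d (by
      intro W W'
      -- the open sets on which the determinants over `W` and `W'` agree cover the intersection
      let K := {Z : X.Opens // ∃ (h : Z ≤ W.1.1) (h' : Z ≤ W'.1.1), res h (d W) = res h' (d W')}
      have hK : ∀ x ∈ W.1.1 ⊓ W'.1.1, ∃ Z : K, x ∈ Z.1 := fun x hx => by
        obtain ⟨s, t, hst, hxs⟩ := exists_basicOpen_le_affine_inter W.1.2 W'.1.2 x hx
        refine ⟨⟨X.basicOpen s, X.basicOpen_le s, hst.trans_le (X.basicOpen_le t), ?_⟩, hxs⟩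
        exact IsDetAt.unique (U := ⟨X.basicOpen s, W.1.2.basicOpen s⟩)
          ((hd W).restrict s (X.basicOpen_le s) rfl)
          ((hd W').restrict t (hst.trans_le (X.basicOpen_le t)) hst)
      refine res_sep (U := fun Z : {Z : K // Z.1 ≤ W.1.1 ⊓ W'.1.1} => Z.1.1) (fun Z => Z.2)
        (fun x hx => ?_) fun Z => ?_
      · obtain ⟨Z, hZ⟩ := hK x hx
        exact TopologicalSpace.Opens.mem_iSup.2 ⟨⟨Z, le_inf Z.2.choose Z.2.choose_spec.choose⟩, hZ⟩
      · rw [res_res, res_res]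
        exact Z.1.2.choose_spec.choose_spec)
  refine ⟨c, fun U => isDetAt_of_cover fun x hx => ?_⟩
  obtain ⟨W, hxW⟩ := hcov x
  obtain ⟨s, t, hst, hxs⟩ := exists_basicOpen_le_affine_inter U.2 W.1.2 x ⟨hx, hxW⟩
  refine ⟨s, hxs, ⟨X.basicOpen s, U.2.basicOpen s⟩, X.basicOpen_le s, rfl, ?_⟩
  have h1 := (hd W).restrict (W := ⟨X.basicOpen s, U.2.basicOpen s⟩) t
    (hst.trans_le (X.basicOpen_le t)) hst
  rw [← hc W, res_res] at h1
  rwa [res_res]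

theorem det_unique {c c' : Γ(X, ⊤)} (h : ∀ U : X.affineOpens, f.IsDetAt U (res le_top c))
    (h' : ∀ U : X.affineOpens, f.IsDetAt U (res le_top c')) : c = c' :=
  res_sep (U := fun U : X.affineOpens => U.1) (fun _ => le_top) (fun x _ => by
    obtain ⟨O, hO, hxO, -⟩ := exists_isAffineOpen_mem_and_subset (TopologicalSpace.Opens.mem_top x)
    exact TopologicalSpace.Opens.mem_iSup.2 ⟨⟨O, hO⟩, hxO⟩) fun U => (h U).unique (h' U)

/-- The inverse. -/
noncomputable def symm {P' : BundlePair X} (f : LamIso P P') : LamIso P' P :=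
  ⟨fun U => (f.app U).symm, fun {U W} h t =>
    (f.app W).injective (((f.app W).apply_symm_apply _).trans
      ((congrArg (lamRes P' h) ((f.app U).apply_symm_apply t)).symm.trans
        (f.app_res h _).symm))⟩

theorem trans_symm (f : LamIso P P) : f.trans f.symm = LamIso.refl P :=
  LamIso.ext (funext fun U => LinearEquiv.self_trans_symm (f.app U))

theorem isDetAt_refl (U : X.affineOpens) : (LamIso.refl P).IsDetAt U (res le_top (1 : Γ(X, ⊤))) := by
  rw [map_one]
  exact IsDetScalar.id (M := LamSec P U)

theorem isDetAt_trans {f g : LamIso P P} {c d : Γ(X, ⊤)}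
    (hf : ∀ U : X.affineOpens, f.IsDetAt U (res le_top c))
    (hg : ∀ U : X.affineOpens, g.IsDetAt U (res le_top d)) (U : X.affineOpens) :
    (f.trans g).IsDetAt U (res le_top (c * d)) := by
  rw [map_mul]
  exact IsDetScalar.comp (M := LamSec P U) (hf U) (hg U)

theorem exists_isDet (f : LamIso P P) : ∃ u, IsDet f u := by
  obtain ⟨c, hc⟩ := f.exists_det
  obtain ⟨d, hd⟩ := f.symm.exists_det
  have h := isDetAt_trans hc hd
  rw [trans_symm] at h
  have hcd : c * d = 1 := det_unique h isDetAt_refl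
  exact ⟨⟨c, d, hcd, (mul_comm d c).trans hcd⟩, hc⟩

end LamIso

theorem IsDet.unique {f : LamIso P P} {u u' : Γ(X, ⊤)ˣ} (h : IsDet f u) (h' : IsDet f u') :
    u = u' :=
  Units.ext (LamIso.det_unique h h')

theorem IsDet.refl (P : BundlePair X) : IsDet (LamIso.refl P) 1 := LamIso.isDetAt_refl

theorem IsDet.trans {f g : LamIso P P} {u u' : Γ(X, ⊤)ˣ} (hf : IsDet f u) (hg : IsDet g u') :
    IsDet (f.trans g) (u * u') :=
  LamIso.isDetAt_trans hf hg

/-- The determinant of an automorphism of `Λ²(V) ⊗ I⁻¹`. -/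
noncomputable def LamIso.det (f : LamIso P P) : Γ(X, ⊤)ˣ := f.exists_isDet.choose

theorem LamIso.isDet_iff (f : LamIso P P) (u : Γ(X, ⊤)ˣ) : IsDet f u ↔ u = f.det :=
  ⟨fun h => h.unique f.exists_isDet.choose_spec, fun h => h ▸ f.exists_isDet.choose_spec⟩

theorem LamIso.det_refl (P : BundlePair X) : (LamIso.refl P).det = 1 :=
  (((LamIso.refl P).isDet_iff 1).1 (IsDet.refl P)).symm

theorem LamIso.det_trans (f g : LamIso P P) : (f.trans g).det = f.det * g.det :=
  (((f.trans g).isDet_iff _).1 (((f.isDet_iff _).2 rfl).trans ((g.isDet_iff _).2 rfl))).symm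

variable {q q' : QuadForm P}

theorem isoSq_eq : IsoSq q q' = {φ : EvenIso q q' | IsSquare (transfer φ).det} := by
  ext φ
  constructor
  · rintro ⟨f, u, hf, hu, hs⟩
    rw [hf.eq_transfer, LamIso.isDet_iff] at hu
    exact show IsSquare _ from hu ▸ hs
  · exact fun h => ⟨_, _, transfer_isTransfer φ, (LamIso.isDet_iff _ _).2 rfl, h⟩

theorem sIso_eq : SIso q q' = {φ : EvenIso q q' | (transfer φ).det = 1} := by
  ext φ
  constructor
  · rintro ⟨f, hf, hu⟩
    rw [hf.eq_transfer, LamIso.isDet_iff] at hu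
    exact hu.symm
  · exact fun h => ⟨_, transfer_isTransfer φ, (LamIso.isDet_iff _ _).2 h.symm⟩

variable (q) in
/-- The homomorphism `φ ↦ det φ_{Λ²}` on `Aut(C₀(V, q, I))`. -/
noncomputable def detHom : EvenIso q q →* Γ(X, ⊤)ˣ where
  toFun φ := (transfer φ).det
  map_one' := (congrArg LamIso.det (transfer_refl q)).trans (LamIso.det_refl P)
  map_mul' φ χ := (congrArg LamIso.det (transfer_trans χ φ)).trans
    ((LamIso.det_trans _ _).trans (mul_comm _ _))

end Sheaf
end QuadBundle
theorem proposition1p3 (X : Scheme.{u}) :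
    -- over an affine open set, bilinear forms inducing `q` exist, and each of them gives an
    -- isomorphism of the even Clifford algebra with the sections of `𝒪 ⊕ Λ²(V) ⊗ I⁻¹`
    (∀ (P : BundlePair X) (q : QuadForm P) (U : X.affineOpens),
      (∃ b : BilSec P U, q.InducedBy U b) ∧
      ∀ b : BilSec P U, q.InducedBy U b → ∃! e, IsPsi q U b e) ∧
    -- the map `φ ↦ φ_{Λ²}`
    ∃ ζ : ∀ {P P' : BundlePair X} {q : QuadForm P} {q' : QuadForm P'},
        EvenIso q q' → LamIso P P',
      -- it is given locally by the isomorphisms `ψ_b`, for all choices of bilinear forms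
      (∀ {P P' : BundlePair X} {q : QuadForm P} {q' : QuadForm P'} (φ : EvenIso q q'),
        IsTransfer φ (ζ φ)) ∧
      -- it is determined by any choice of bilinear forms on any affine open covering
      (∀ {P P' : BundlePair X} {q : QuadForm P} {q' : QuadForm P'} (φ : EvenIso q q')
        (J : Type u) (U : J → X.affineOpens) (b : ∀ j, BilSec P (U j))
        (b' : ∀ j, BilSec P' (U j)),
        (⨆ j, (U j).1) = ⊤ → (∀ j, q.InducedBy (U j) (b j)) →
        (∀ j, q'.InducedBy (U j) (b' j)) →
        ∀ f : LamIso P P', (∀ j, IsTransferAt φ f (U j) (b j) (b' j)) → f = ζ φ) ∧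
      -- it is compatible with identities and compositions
      (∀ {P : BundlePair X} (q : QuadForm P), ζ (EvenIso.refl q) = LamIso.refl P) ∧
      (∀ {P P' P'' : BundlePair X} {q : QuadForm P} {q' : QuadForm P'} {q'' : QuadForm P''}
        (φ : EvenIso q q') (χ : EvenIso q' q''), ζ (φ.trans χ) = (ζ φ).trans (ζ χ)) ∧
      -- the subsets `S-Iso ⊆ Iso' ⊆ Iso` and the subgroups `S-Aut ≤ Aut' ≤ Aut`
      ∀ P : BundlePair X, ∃ det : LamIso P P → Γ(X, ⊤)ˣ,
        (∀ f u, IsDet f u ↔ u = det f) ∧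
        (∀ q q' : QuadForm P,
          IsoSq q q' = {φ : EvenIso q q' | IsSquare (det (ζ φ))} ∧
          SIso q q' = {φ : EvenIso q q' | det (ζ φ) = 1} ∧
          SIso q q' ⊆ IsoSq q q') ∧
        ∀ q : QuadForm P, ∃ A S : Subgroup (EvenIso q q),
          (A : Set (EvenIso q q)) = IsoSq q q ∧ (S : Set (EvenIso q q)) = SIso q q ∧
          S ≤ A := by
  refine ⟨fun P q U => ⟨q.exists_inducedBy U, fun b hb => ?_⟩, fun φ => transfer φ,
    transfer_isTransfer, fun φ J U b b' hU hb hb' f hf => ?_, transfer_refl, transfer_trans,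
    fun P => ⟨LamIso.det, LamIso.isDet_iff, fun q q' => ⟨isoSq_eq, sIso_eq, ?_⟩, fun q => ?_⟩⟩
  · obtain ⟨e, he⟩ := hb.exists_isPsi
    exact ⟨e, he, fun e' he' => he'.unique he⟩
  · exact LamIso.ext_of_iSup_eq_top U hU fun j => (hf j).app_eq (hb j) (hb' j)
  · rw [isoSq_eq, sIso_eq]
    intro φ hφ
    have h1 : (transfer φ).det = 1 := hφ
    exact show IsSquare _ from h1 ▸ IsSquare.one
  · refine ⟨(Subgroup.square _).comap (detHom q), (detHom q).ker, ?_, ?_, ?_⟩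
    · rw [isoSq_eq]; ext φ; simp [detHom]
    · rw [sIso_eq]; rfl
    · exact (detHom q).comap_bot ▸ Subgroup.comap_mono bot_le
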